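/- Let $k$ be a field of characteristic $0$ and let $H$ be a finite-dimensional Hopf algebra over $k$ with comultiplication $\Delta(h)=h_1\otimes h_2$, counit $\varepsilon$ and antipode $S$ (which is then bijective). For a finite-dimensional algebra $B$, let ${}_B\mathcal M$ be the category of finite-dimensional left $B$-modules. Notation. $H^*$ has the convolution product $\langle pq,x\rangle=\langle p,x_1\rangle\langle q,x_2\rangle$ and the coproduct $\langle p_1,x\rangle\langle p_2,y\rangle=\langle p,xy\rangle$. $H^{cop}$ is the algebra $H$ with the opposite comultiplication $h\mapsto h_2\otimes h_1$. For a bialgebra $K$ and a left $K$-module algebra $A$, the smash product $A\#K$ is the space $A\otimes K$ with the product $(a\#x)(b\#y)=a(x_1\cdot b)\#x_2y$. * The Drinfeld double $D(H)=H^{*cop}\bowtie H$ is the space $H^*\otimes H$ with the product $(p\bowtie h)(q\bowtie g)=p\,(h_1\rightharpoonup q\leftharpoonup S^{-1}(h_3))\bowtie h_2g$, where $\langle h\rightharpoonup q\leftharpoonup g,x\rangle=\langle q,gxh\rangle$, and the coproduct $\Delta(p\bowtie h)=(p_2\bowtie h_1)\otimes(p_1\bowtie h_2)$. It is quasitriangular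 with $R=R^1\otimes R^2=\sum_i(\varepsilon\bowtie x_i)\otimes(p_i\bowtie 1)$, where $(x_i)$ is a basis of $H$ with dual basis $(p_i)$. * $H$ is a quantum commutative $D(H)$-module algebra, that is, $ab=(R^2\cdot b)(R^1\cdot a)$, with the action $(\varepsilon\bowtie h)\cdot l=h_1\,l\,S(h_2)$ and $(p\bowtie 1)\cdot l=\langle p,S^{-1}(l_1)\rangle l_2$. * The Heisenberg double of a finite-dimensional bialgebra $B$ is $\mathcal H(B)=B\#B^*$ for the action $p\rightharpoonup b=b_1\langle p,b_2\rangle$. * ${}_{H\#D(H)}\mathcal M$ is a tensor category as follows. A module $M$ is an $H$-bimodule by $a\,m=(a\#1)m$ and $m\,a=((R^2\cdot a)\#R^1)m$; the tensor product is $M\otimes_HN$ with the action $(a\#x)(m\otimes n)=(a\#x_1)m\otimes(1\#x_2)n$; the unit object is $H$ with the action $(a\#x)b=a(x\cdot b)$; the associativity and unit constraints are the canonical ones of $\otimes_H$. * ${}_{H^{cop}}\mathcal M$ is the tensor category of modules over the bialgebra $H^{cop}$: the tensor product is $M\otimes_kN$ with $h(m\otimes n)=h_2m\otimes h_1n$,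 and the unit object is $k$. Proposition. There is an isomorphism of $k$-algebras $$H\#D(H)\;\cong\;\mathcal H(H^{cop})\otimes H .$$ Moreover, the tensor categories ${}_{H\#D(H)}\mathcal M$ and ${}_{H^{cop}}\mathcal M$ are tensor equivalent: there is a $k$-linear equivalence of categories ${}_{H^{cop}}\mathcal M\to{}_{H\#D(H)}\mathcal M$ that is a (strong) monoidal functor. -/

import Mathlib

open TensorProduct Coalgebra
universe u
set_option linter.unusedSectionVars false
set_option linter.unusedVariables false
set_option linter.unusedSimpArgs false

noncomputable section
namespace HopfDouble


/-! ### Matrix coefficients of a finite-dimensional coalgebra -/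

section Coefficients
variable (k : Type*) {C : Type*} [Field k] [AddCommGroup C] [Module k C] [Module.Finite k C]

theorem sum_basis_coord {X : Type*} [AddCommGroup X] [Module k X] (z : C ⊗[k] X) :
    ∑ i, (Module.finBasis k C i) ⊗ₜ[k]
      TensorProduct.lid k X (((Module.finBasis k C).coord i).rTensor X z) = z := by
  induction z with
  | zero => simp only [LinearMap.map_zero, LinearEquiv.map_zero, zero_tmul, tmul_zero, zero_smul, zero_mul, mul_zero, LinearMap.zero_apply, Finset.sum_const_zero]
  | add x y hx hy => simp only [LinearMap.map_add, LinearEquiv.map_add, tmul_add, Finset.sum_add_distrib, hx, hy]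
  | tmul c x =>
    simp only [LinearMap.rTensor_tmul, Module.Basis.coord_apply, TensorProduct.lid_tmul,
      ← smul_tmul, ← TensorProduct.sum_tmul, Module.Basis.sum_repr]

variable [Coalgebra k C]

/-- The matrix coefficients `c i j` of the regular comodule of a finite-dimensional coalgebra with
respect to a basis `e`: they satisfy `Δ (e j) = ∑ i, e i ⊗ c i j`. They are only used in proofs. -/
def coef (i j : Fin (Module.finrank k C)) : C :=
  TensorProduct.lid k C
    (((Module.finBasis k C).coord i).rTensor C (comul (R := k) (Module.finBasis k C j)))

theorem comul_basis (j : Fin (Module.finrank k C)) :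
    comul (R := k) (Module.finBasis k C j) = ∑ i, Module.finBasis k C i ⊗ₜ[k] coef k i j :=
  (sum_basis_coord k _).symm

theorem comul_coef (i j : Fin (Module.finrank k C)) :
    comul (R := k) (coef k i j : C) = ∑ l, coef k i l ⊗ₜ[k] coef k l j := by
  have h := Coalgebra.coassoc_apply (R := k) (Module.finBasis k C j)
  rw [comul_basis] at h
  simp only [map_sum, LinearMap.rTensor_tmul, LinearMap.lTensor_tmul, comul_basis,
    TensorProduct.sum_tmul, TensorProduct.assoc_tmul] at h
  have h2 := congrArg (fun z => TensorProduct.lid k _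
    (((Module.finBasis k C).coord i).rTensor (C ⊗[k] C) z)) h
  simp only [map_sum, LinearMap.rTensor_tmul, TensorProduct.lid_tmul, Module.Basis.coord_apply,
    Module.Basis.repr_self, Finsupp.single_apply, ite_smul, one_smul, zero_smul,
    Finset.sum_ite_eq', Finset.mem_univ, if_true] at h2
  exact h2.symm

theorem counit_coef (i j : Fin (Module.finrank k C)) :
    counit (R := k) (coef k i j : C) = if i = j then 1 else 0 := by
  have h := Coalgebra.lTensor_counit_comul (R := k) (Module.finBasis k C j)
  rw [comul_basis] at h
  have h2 := congrArg (fun z => TensorProduct.lid k _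
    (((Module.finBasis k C).coord i).rTensor k z)) h
  simpa [map_sum, Finsupp.single_apply, eq_comm] using h2

theorem basis_eq_sum_coef (j : Fin (Module.finrank k C)) :
    Module.finBasis k C j = ∑ i, counit (R := k) (Module.finBasis k C i) • coef k i j := by
  have h := Coalgebra.rTensor_counit_comul (R := k) (Module.finBasis k C j)
  rw [comul_basis] at h
  simpa [map_sum] using (congrArg (TensorProduct.lid k C) h).symm

/-- Two linear maps which agree on the matrix coefficients are equal. -/
theorem ext_coef {X : Type*} [AddCommGroup X] [Module k X] {f g : C →ₗ[k] X}
    (h : ∀ i j, f (coef k i j) = g (coef k i j)) : f = g := by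
  refine (Module.finBasis k C).ext fun j => ?_
  rw [basis_eq_sum_coef]
  simp [h]

/-- Extension of `ext_coef` to equalities of values at all points. -/
theorem eq_of_coef {X : Type*} [AddCommGroup X] [Module k X] (f g : C →ₗ[k] X)
    (h : ∀ i j, f (coef k i j) = g (coef k i j)) (c : C) : f c = g c :=
  LinearMap.congr_fun (ext_coef k h) c

theorem coef_induction {P : C → Prop} (c : C) (h0 : P 0) (hadd : ∀ x y, P x → P y → P (x + y))
    (hsmul : ∀ (r : k) x, P x → P (r • x)) (h : ∀ i j, P (coef k i j)) : P c := by
  have hs : ∀ (s : Finset (Fin (Module.finrank k C))) (f : Fin (Module.finrank k C) → C),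
      (∀ i, P (f i)) → P (∑ i ∈ s, f i) := by
    intro s f hf
    exact Finset.sum_induction _ _ hadd h0 fun i _ => hf i
  rw [← (Module.finBasis k C).sum_repr c]
  refine hs _ _ fun j => hsmul _ _ ?_
  rw [basis_eq_sum_coef]
  exact hs _ _ fun i => hsmul _ _ (h i j)

end Coefficients

section Antipode
variable {k : Type*} {H : Type*} [Field k] [Ring H] [HopfAlgebra k H] [Module.Finite k H]

open HopfAlgebra

theorem sum_antipode_coef (i j : Fin (Module.finrank k H)) :
    ∑ l, antipode k (coef k i l : H) * coef k l j = if i = j then 1 else 0 := by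
  have h := HopfAlgebra.mul_antipode_rTensor_comul_apply (R := k) (coef k i j : H)
  rw [comul_coef, counit_coef] at h
  simpa [map_sum, apply_ite] using h

theorem sum_coef_antipode (i j : Fin (Module.finrank k H)) :
    ∑ l, coef k i l * antipode k (coef k l j : H) = if i = j then 1 else 0 := by
  have h := HopfAlgebra.mul_antipode_lTensor_comul_apply (R := k) (coef k i j : H)
  rw [comul_coef, counit_coef] at h
  simpa [map_sum, apply_ite] using h

theorem inv_unique {n R : Type*} [Fintype n] [DecidableEq n] [Semiring R] {A B D : n → n → R}
    (h1 : ∀ i j, ∑ l, A i l * B l j = if i = j then 1 else 0)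
    (h2 : ∀ i j, ∑ l, D i l * A l j = if i = j then 1 else 0) : D = B := by
  have e1 : Matrix.of A * Matrix.of B = 1 := by
    ext i j; simp [Matrix.mul_apply, h1, Matrix.one_apply]
  have e2 : Matrix.of D * Matrix.of A = 1 := by
    ext i j; simp [Matrix.mul_apply, h2, Matrix.one_apply]
  exact Matrix.of.injective (left_inv_eq_right_inv e2 e1)

theorem comul_antipode (h : H) : comul (R := k) (antipode k h) =
    TensorProduct.comm k H H (TensorProduct.map (antipode k) (antipode k) (comul h)) := by
  refine eq_of_coef k (comul ∘ₗ antipode k) ((TensorProduct.comm k H H).toLinearMap ∘ₗ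
    TensorProduct.map (antipode k) (antipode k) ∘ₗ comul) (fun i j => ?_) h
  have h3 := inv_unique (A := fun i j => comul (R := k) (coef k i j : H))
    (B := fun i j => comul (R := k) (antipode k (coef k i j : H)))
    (D := fun i j => ∑ l, antipode k (coef k l j : H) ⊗ₜ[k] antipode k (coef k i l : H))
    (fun i j => by
      simp only [← Bialgebra.comul_mul, ← map_sum, sum_coef_antipode]
      split_ifs <;> simp)
    (fun i j => by
      simp only [comul_coef, Finset.sum_mul_sum, Algebra.TensorProduct.tmul_mul_tmul]
      have : ∀ a b : Fin (Module.finrank k H), ∑ l, (antipode k (coef k a l : H) * coef k l b) ⊗ₜ[k]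
        (antipode k (coef k i a : H) * coef k b j) = if a = b then 1 ⊗ₜ[k]
        (antipode k (coef k i a : H) * coef k b j) else 0 := by
        intro a b
        rw [← TensorProduct.sum_tmul, sum_antipode_coef]; split_ifs <;> simp
      rw [Finset.sum_comm]
      refine (Finset.sum_congr rfl fun a _ => Finset.sum_comm).trans ?_
      simp only [this, Finset.sum_ite_eq, Finset.mem_univ, if_true, ← TensorProduct.tmul_sum,
            sum_antipode_coef]
      split_ifs <;> simp [Algebra.TensorProduct.one_def])
  have := congrFun (congrFun h3 i) j
  simp only [LinearMap.comp_apply, comul_coef, map_sum, LinearEquiv.coe_coe, map_tmul, comm_tmul]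
  exact this.symm

/-- The square of the antipode can be cancelled from coalgebra maps. -/
theorem antipode_sq_cancel {f g : H →ₗ[k] H}
    (hf : ∀ h, comul (R := k) (f h) = TensorProduct.map f f (comul h))
    (hf' : ∀ h, counit (R := k) (f h) = counit (R := k) h)
    (hg : ∀ h, comul (R := k) (g h) = TensorProduct.map g g (comul h))
    (hg' : ∀ h, counit (R := k) (g h) = counit (R := k) h)
    (hfg : ∀ h, antipode k (antipode k (f h)) = antipode k (antipode k (g h))) : f = g := by
  have key : ∀ f : H →ₗ[k] H, (∀ h, comul (R := k) (f h) = TensorProduct.map f f (comul h)) →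
      (∀ h, counit (R := k) (f h) = counit (R := k) h) → ∀ i j,
      (∑ l, f (coef k i l) * antipode k (f (coef k l j)) = if i = j then 1 else 0) ∧
      (∑ l, antipode k (f (coef k i l)) * f (coef k l j) = if i = j then 1 else 0) := by
    intro f hf hf' i j
    have e1 := HopfAlgebra.mul_antipode_lTensor_comul_apply (R := k) (f (coef k i j))
    have e2 := HopfAlgebra.mul_antipode_rTensor_comul_apply (R := k) (f (coef k i j))
    rw [hf, hf', comul_coef, counit_coef] at e1 e2
    simp only [map_sum, map_tmul, LinearMap.lTensor_tmul, LinearMap.rTensor_tmul,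
      LinearMap.mul'_apply] at e1 e2
    exact ⟨e1.trans (by split_ifs <;> simp), e2.trans (by split_ifs <;> simp)⟩
  have key2 : ∀ f : H →ₗ[k] H, (∀ h, comul (R := k) (f h) = TensorProduct.map f f (comul h)) →
      (∀ h, counit (R := k) (f h) = counit (R := k) h) → ∀ i j,
      (∑ l, antipode k (antipode k (f (coef k l j))) * antipode k (f (coef k i l)) =
        if i = j then 1 else 0) ∧
      (∑ l, antipode k (f (coef k l j)) * antipode k (antipode k (f (coef k i l))) =
        if i = j then 1 else 0) := by
    intro f hf hf' i j
    have e1 := congrArg (antipode k) (key f hf hf' i j).1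
    have e2 := congrArg (antipode k) (key f hf hf' i j).2
    simp only [map_sum, HopfAlgebra.antipode_mul_antidistrib] at e1 e2
    exact ⟨e1.trans (by split_ifs <;> simp), e2.trans (by split_ifs <;> simp)⟩
  have s1 := inv_unique
      (D := fun i j => MulOpposite.op (antipode k (f (coef k i j))))
      (A := fun i j => MulOpposite.op (antipode k (antipode k (f (coef k i j)))))
      (B := fun i j => MulOpposite.op (antipode k (g (coef k i j))))
      (fun i j => by
        simp only [hfg, ← MulOpposite.op_mul, ← Finset.op_sum, (key2 g hg hg' i j).2]
        split_ifs <;> rfl)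
      (fun i j => by
        simp only [← MulOpposite.op_mul, ← Finset.op_sum, (key2 f hf hf' i j).1]
        split_ifs <;> rfl)
  have s2 : ∀ i j, antipode k (f (coef k i j)) = antipode k (g (coef k i j)) := fun i j =>
    MulOpposite.op_injective (congrFun (congrFun s1 i) j)
  have s3 := inv_unique
      (D := fun i j => f (coef k i j)) (A := fun i j => antipode k (f (coef k i j)))
      (B := fun i j => g (coef k i j))
      (fun i j => by simp only [s2]; exact (key g hg hg' i j).2)
      (fun i j => (key f hf hf' i j).1)
  exact ext_coef k fun i j => congrFun (congrFun s3 i) j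

theorem exists_pseudoinverse {V : Type*} [AddCommGroup V] [Module k V] (M : V →ₗ[k] V) :
    ∃ G : V →ₗ[k] V, M ∘ₗ G ∘ₗ M = M := by
  obtain ⟨s, hs⟩ := M.rangeRestrict.exists_rightInverse_of_surjective M.range_rangeRestrict
  obtain ⟨e, he⟩ := (LinearMap.range M).subtype.exists_leftInverse_of_injective
    (LinearMap.range M).ker_subtype
  refine ⟨s ∘ₗ e, LinearMap.ext fun v => ?_⟩
  have h1 : e (M v) = M.rangeRestrict v := LinearMap.congr_fun he (M.rangeRestrict v)
  have h2 := LinearMap.congr_fun hs (M.rangeRestrict v)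
  have h3 := congrArg Subtype.val h2
  simpa [h1] using h3

variable (k H) in
/-- The antipode of a finite-dimensional Hopf algebra is bijective. -/
theorem antipode_bijective : Function.Bijective (antipode k : H →ₗ[k] H) := by
  set S : Module.End k H := antipode k with hS
  set T : Module.End k H := S * S with hT
  set n := Module.finrank k H + 1 with hn
  set N : Module.End k H := T ^ n with hN
  have hTc : ∀ h, comul (R := k) (T h) = TensorProduct.map T T (comul h) := by
    intro h
    simp only [hT, Module.End.mul_apply, hS, comul_antipode]
    generalize comul (R := k) h = z
    induction z with
    | zero => simp only [LinearMap.map_zero, LinearEquiv.map_zero, zero_tmul, tmul_zero, zero_smul, zero_mul, mul_zero, LinearMap.zero_apply, Finset.sum_const_zero]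
    | add x y hx hy => simp only [LinearMap.map_add, LinearEquiv.map_add, hx, hy]
    | tmul x y => simp
  have hTe : ∀ h, counit (R := k) (T h) = counit (R := k) h := by
    intro h; simp [hT, hS]
  have hpow : ∀ m : ℕ, (∀ h, comul (R := k) ((T ^ m) h) =
      TensorProduct.map (T ^ m) (T ^ m) (comul h)) ∧
      ∀ h, counit (R := k) ((T ^ m) h) = counit (R := k) h := by
    intro m
    induction m with
    | zero => exact ⟨fun h => by simp [Module.End.one_eq_id], fun h => by simp⟩
    | succ m ih =>
      refine ⟨fun h => ?_, fun h => ?_⟩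
      · rw [pow_succ', Module.End.mul_apply, hTc, ih.1, ← LinearMap.comp_apply,
          ← TensorProduct.map_comp]; rfl
      · rw [pow_succ', Module.End.mul_apply, hTe, ih.2]
  have hNc := (hpow n).1
  have hNe := (hpow n).2
  rw [← hN] at hNc hNe
  have hker : LinearMap.ker (N * N) = LinearMap.ker N := by
    rw [hN, ← pow_add, Module.End.ker_pow_eq_ker_pow_finrank_of_le (m := n + n) (by omega),
      Module.End.ker_pow_eq_ker_pow_finrank_of_le (m := n) (by omega)]
  have hrange : LinearMap.range (N * N) = LinearMap.range N := by
    refine Submodule.eq_of_le_of_finrank_eq (LinearMap.range_comp_le_range _ _) ?_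
    have e1 := LinearMap.finrank_range_add_finrank_ker (N * N)
    have e2 := LinearMap.finrank_range_add_finrank_ker N
    rw [hker] at e1
    omega
  obtain ⟨P, hP⟩ := exists_pseudoinverse (N * N)
  have hP' : ∀ v, N (N (P (N (N v)))) = N (N v) := fun v => LinearMap.congr_fun hP v
  have hGv : ∀ v, N (P (N (N v))) = N v := by
    intro v
    have : P (N (N v)) - v ∈ LinearMap.ker (N * N) := by
      simp [LinearMap.mem_ker, map_sub, hP']
    rw [hker, LinearMap.mem_ker, map_sub, sub_eq_zero] at this
    exact this
  have hLv : ∀ v, N (N (P (N v))) = N v := by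
    intro v
    have : N v ∈ LinearMap.range (N * N) := hrange ▸ LinearMap.mem_range_self N v
    obtain ⟨w, hw⟩ := this
    rw [← hw]; exact hP' w
  -- the projection of `H` onto the range of `N` along its kernel
  set G : Module.End k H := N * P with hG
  set L : Module.End k H := P * N with hL
  set p : Module.End k H := G * N with hp
  have hNp : ∀ v, N (p v) = N v := hLv
  have hpc : ∀ h, comul (R := k) (p h) = TensorProduct.map p p (comul h) := by
    intro h
    have a1 : p h = N (L h) := rfl
    have a2 : TensorProduct.map p p = TensorProduct.map N N ∘ₗ TensorProduct.map L L :=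
      TensorProduct.map_comp N N L L
    have a3 : TensorProduct.map G G ∘ₗ TensorProduct.map N N ∘ₗ TensorProduct.map N N =
        TensorProduct.map N N := by
      rw [← TensorProduct.map_comp, ← TensorProduct.map_comp]
      congr 1 <;> exact LinearMap.ext hGv
    have a4 : TensorProduct.map N N ∘ₗ TensorProduct.map N N ∘ₗ TensorProduct.map L L =
        TensorProduct.map N N := by
      rw [← TensorProduct.map_comp, ← TensorProduct.map_comp]
      congr 1 <;> exact LinearMap.ext hLv
    rw [a1, hNc, a2]
    have b1 : TensorProduct.map N N (TensorProduct.map N N (comul (R := k) (L h))) =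
        TensorProduct.map N N (comul (R := k) h) := by
      rw [← hNc, ← hNc, ← hNc]; exact congrArg _ (hLv h)
    have b2 := LinearMap.congr_fun a4 (comul (R := k) h)
    have c1 := LinearMap.congr_fun a3 (comul (R := k) (L h))
    have c2 := LinearMap.congr_fun a3 (TensorProduct.map L L (comul (R := k) h))
    simp only [LinearMap.comp_apply] at b2 c1 c2 ⊢
    rw [← c1, b1, ← c2, b2]
  have hpe : ∀ h, counit (R := k) (p h) = counit (R := k) h := fun h => by
    rw [← hNe, hNp, hNe]
  have hcancel : ∀ m : ℕ, (∀ v, (T ^ m) (p v) = (T ^ m) v) → ∀ v, p v = v := by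
    intro m
    induction m with
    | zero => intro h; simpa using h
    | succ m ih =>
      intro h
      refine ih ?_
      have := antipode_sq_cancel (f := (T ^ m) ∘ₗ p) (g := (T ^ m : Module.End k H))
        (fun h => by
          rw [LinearMap.comp_apply, (hpow m).1, hpc, TensorProduct.map_comp]; rfl)
        (fun h => by rw [LinearMap.comp_apply, (hpow m).2, hpe])
        (hpow m).1 (hpow m).2
        (fun v => by
          have := h v
          rw [pow_succ'] at this
          exact this)
      exact fun v => LinearMap.congr_fun this v
  have hid := hcancel n hNp
  have hinj : Function.Injective S := by
    intro x y hxy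
    have hN' : N x = N y := by
      have : T x = T y := by simp only [hT, Module.End.mul_apply, hxy]
      have e : ∀ v, N v = (T ^ Module.finrank k H) (T v) := fun v => by
        rw [hN, hn, pow_succ]; rfl
      rw [e, e, this]
    rw [← hid x, ← hid y]
    change G (N x) = G (N y)
    rw [hN']
  exact ⟨hinj, LinearMap.surjective_of_injective hinj⟩

end Antipode


section AntipodeInv
variable (k : Type*) {H : Type*} [Field k] [Ring H] [HopfAlgebra k H] [Module.Finite k H]

open HopfAlgebra

/-- The inverse `S⁻¹` of the antipode of a finite-dimensional Hopf algebra. -/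
def antipodeInv : H →ₗ[k] H :=
  (LinearEquiv.ofBijective (antipode k : H →ₗ[k] H) (antipode_bijective k H)).symm.toLinearMap

@[simp] theorem antipode_antipodeInv (h : H) : antipode k (antipodeInv k h) = h :=
  (LinearEquiv.ofBijective (antipode k : H →ₗ[k] H) (antipode_bijective k H)).apply_symm_apply h

@[simp] theorem antipodeInv_antipode (h : H) : antipodeInv k (antipode k h) = h :=
  (LinearEquiv.ofBijective (antipode k : H →ₗ[k] H) (antipode_bijective k H)).symm_apply_apply h

theorem antipodeInv_mul (a b : H) :
    antipodeInv k (a * b) = antipodeInv k b * antipodeInv k a :=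
  (antipode_bijective k H).1 (by simp [antipode_mul_antidistrib])

@[simp] theorem antipodeInv_one : antipodeInv k (1 : H) = 1 :=
  (antipode_bijective k H).1 (by simp)

@[simp] theorem counit_antipodeInv (h : H) :
    counit (R := k) (antipodeInv k h) = counit (R := k) h := by
  conv_rhs => rw [← antipode_antipodeInv k h, counit_antipode]

theorem comul_antipodeInv_coef (i j : Fin (Module.finrank k H)) :
    comul (R := k) (antipodeInv k (coef k i j : H)) =
      ∑ l, antipodeInv k (coef k l j : H) ⊗ₜ[k] antipodeInv k (coef k i l : H) := by
  have h := comul_antipode (k := k) (antipodeInv k (coef k i j : H))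
  rw [antipode_antipodeInv, comul_coef] at h
  have h2 := congrArg (fun z => TensorProduct.comm k H H
    (TensorProduct.map (antipodeInv k) (antipodeInv k) z)) h
  have h3 : ∀ z : H ⊗[k] H, TensorProduct.comm k H H
      (TensorProduct.map (antipodeInv k) (antipodeInv k) (TensorProduct.comm k H H
        (TensorProduct.map (antipode k) (antipode k) z))) = z := by
    intro z
    induction z with
    | zero => simp only [LinearMap.map_zero, LinearEquiv.map_zero, zero_tmul, tmul_zero, zero_smul, zero_mul, mul_zero, LinearMap.zero_apply, Finset.sum_const_zero]
    | add x y hx hy => simp only [LinearMap.map_add, LinearEquiv.map_add, hx, hy]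
    | tmul x y => simp
  rw [h3] at h2
  simpa [map_sum] using h2.symm

theorem sum_coef_antipodeInv (i j : Fin (Module.finrank k H)) :
    ∑ l, coef k l j * antipodeInv k (coef k i l : H) = if i = j then 1 else 0 := by
  refine (antipode_bijective k H).1 ?_
  simp only [map_sum, antipode_mul_antidistrib, antipode_antipodeInv, sum_coef_antipode]
  split_ifs <;> simp

theorem sum_antipodeInv_coef (i j : Fin (Module.finrank k H)) :
    ∑ l, antipodeInv k (coef k l j : H) * coef k i l = if i = j then 1 else 0 := by
  refine (antipode_bijective k H).1 ?_
  simp only [map_sum, antipode_mul_antidistrib, antipode_antipodeInv, sum_antipode_coef]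
  split_ifs <;> simp

end AntipodeInv

/-! ### The co-opposite bialgebra -/

/-- The co-opposite `C^cop`: the same algebra, with the comultiplication `c ↦ c₂ ⊗ c₁`. -/
def Cop (C : Type*) : Type _ := C

namespace Cop

instance (C : Type*) [h : Ring C] : Ring (Cop C) := h

variable (k : Type*) (C : Type*) [Field k] [Ring C] [Bialgebra k C]

instance : Algebra k (Cop C) := inferInstanceAs (Algebra k C)

instance [h : Module.Finite k C] : Module.Finite k (Cop C) := h

/-- The coalgebra structure of `C^cop`. -/
instance : Coalgebra k (Cop C) where
  comul := (TensorProduct.comm k C C).toLinearMap ∘ₗ (comul : C →ₗ[k] C ⊗[k] C)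
  counit := (counit : C →ₗ[k] k)
  coassoc := by
    refine LinearMap.ext fun (c : C) => ?_
    let F : C ⊗[k] (C ⊗[k] C) →ₗ[k] C ⊗[k] (C ⊗[k] C) := (TensorProduct.assoc k C C C).toLinearMap ∘ₗ
      (TensorProduct.comm k C C).toLinearMap.rTensor C ∘ₗ
      (TensorProduct.comm k C (C ⊗[k] C)).toLinearMap
    have h1 : ∀ z : C ⊗[k] C, TensorProduct.assoc k C C C
        (LinearMap.rTensor C ((TensorProduct.comm k C C).toLinearMap ∘ₗ comul)
          (TensorProduct.comm k C C z)) = F (comul.lTensor C z) := by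
      intro z
      induction z with
      | zero => simp only [LinearMap.map_zero, LinearEquiv.map_zero, zero_tmul, tmul_zero, zero_smul, zero_mul, mul_zero, LinearMap.zero_apply, Finset.sum_const_zero]
      | add x y hx hy => simp only [LinearMap.map_add, LinearEquiv.map_add, hx, hy]
      | tmul x y => simp [F]
    have h2 : ∀ z : C ⊗[k] C, LinearMap.lTensor C ((TensorProduct.comm k C C).toLinearMap ∘ₗ comul)
        (TensorProduct.comm k C C z) = F (TensorProduct.assoc k C C C (comul.rTensor C z)) := by
      intro z
      induction z with
      | zero => simp only [LinearMap.map_zero, LinearEquiv.map_zero, zero_tmul, tmul_zero, zero_smul, zero_mul, mul_zero, LinearMap.zero_apply, Finset.sum_const_zero]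
      | add x y hx hy => simp only [LinearMap.map_add, LinearEquiv.map_add, hx, hy]
      | tmul x y =>
        simp only [comm_tmul, LinearMap.lTensor_tmul, LinearMap.rTensor_tmul, LinearMap.comp_apply,
          LinearEquiv.coe_coe]
        generalize comul (R := k) x = w
        induction w with
        | zero => simp only [LinearMap.map_zero, LinearEquiv.map_zero, zero_tmul, tmul_zero, zero_smul, zero_mul, mul_zero, LinearMap.zero_apply, Finset.sum_const_zero]
        | add a b ha hb => simp only [LinearMap.map_add, LinearEquiv.map_add, add_tmul, tmul_add, ha, hb]
        | tmul a b => simp [F]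
    exact (h1 _).trans ((congrArg F (Coalgebra.coassoc_apply c).symm).trans (h2 _).symm)
  rTensor_counit_comp_comul := by
    refine LinearMap.ext fun (c : C) => ?_
    have h := congrArg (TensorProduct.comm k C k) (Coalgebra.lTensor_counit_comul (R := k) c)
    change LinearMap.rTensor C counit (TensorProduct.comm k C C (comul c)) = _
    rw [comm_tmul] at h
    refine Eq.trans ?_ h
    generalize comul (R := k) c = z
    induction z with
    | zero => simp only [LinearMap.map_zero, LinearEquiv.map_zero, zero_tmul, tmul_zero, zero_smul, zero_mul, mul_zero, LinearMap.zero_apply, Finset.sum_const_zero]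
    | add x y hx hy => simp only [LinearMap.map_add, LinearEquiv.map_add, hx, hy]
    | tmul x y => simp
  lTensor_counit_comp_comul := by
    refine LinearMap.ext fun (c : C) => ?_
    have h := congrArg (TensorProduct.comm k k C) (Coalgebra.rTensor_counit_comul (R := k) c)
    change LinearMap.lTensor C counit (TensorProduct.comm k C C (comul c)) = _
    rw [comm_tmul] at h
    refine Eq.trans ?_ h
    generalize comul (R := k) c = z
    induction z with
    | zero => simp only [LinearMap.map_zero, LinearEquiv.map_zero, zero_tmul, tmul_zero, zero_smul, zero_mul, mul_zero, LinearMap.zero_apply, Finset.sum_const_zero]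
    | add x y hx hy => simp only [LinearMap.map_add, LinearEquiv.map_add, hx, hy]
    | tmul x y => simp

theorem comul_eq (c : C) : comul (R := k) (A := Cop C) c =
    TensorProduct.comm k C C (comul (R := k) (A := C) c) := rfl

theorem counit_eq (c : C) : counit (R := k) (A := Cop C) c = counit (R := k) (A := C) c := rfl

instance : Bialgebra k (Cop C) :=
  Bialgebra.mk' k (Cop C) (Bialgebra.counit_one (R := k) (A := C))
    (fun {a b} => Bialgebra.counit_mul (R := k) (A := C) a b)
    (by
      change TensorProduct.comm k C C (comul (R := k) (1 : C)) = _
      rw [Bialgebra.comul_one]; rfl)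
    (fun {a b} => by
      exact (congrArg (TensorProduct.comm k C C) (Bialgebra.comul_mul (R := k) (A := C) a b)).trans
        (map_mul (Algebra.TensorProduct.comm k C C) (comul (R := k) (A := C) a)
          (comul (R := k) (A := C) b)))

end Cop

/-! ### The dual bialgebra -/

/-- The dual `H^*` of a bialgebra `H`, with the convolution product
`⟨p q, x⟩ = ⟨p, x₁⟩ ⟨q, x₂⟩` as multiplication. -/
def HDual (k H : Type*) [Field k] [Ring H] [Bialgebra k H] : Type _ := Module.Dual k H

namespace HDual

section Basic
variable {k H : Type*} [Field k] [Ring H] [Bialgebra k H]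

instance : AddCommGroup (HDual k H) := inferInstanceAs (AddCommGroup (Module.Dual k H))
instance : Module k (HDual k H) := inferInstanceAs (Module k (Module.Dual k H))
instance : FunLike (HDual k H) H k := inferInstanceAs (FunLike (Module.Dual k H) H k)
instance : LinearMapClass (HDual k H) k H k :=
  inferInstanceAs (LinearMapClass (Module.Dual k H) k H k)

theorem ext_ev {p q : HDual k H} (h : ∀ x, p x = q x) : p = q := LinearMap.ext h

@[simp] theorem zero_apply (x : H) : (0 : HDual k H) x = 0 := rfl
@[simp] theorem add_apply (p q : HDual k H) (x : H) : (p + q) x = p x + q x := rfl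
@[simp] theorem smul_apply (c : k) (p : HDual k H) (x : H) : (c • p) x = c * p x := rfl

variable (k H) in
/-- The identity map from `H^*` to the underlying space of linear forms. -/
def toDual : HDual k H ≃ₗ[k] Module.Dual k H := LinearEquiv.refl k (Module.Dual k H)

@[simp] theorem toDual_apply (p : HDual k H) (x : H) : toDual k H p x = p x := rfl
@[simp] theorem toDual_symm_apply (p : Module.Dual k H) (x : H) : (toDual k H).symm p x = p x := rfl

instance : Ring (HDual k H) :=
  { (inferInstance : AddCommGroup (HDual k H)) with
    mul := fun p q => (toDual k H).symm
      (LinearMap.mul' k k ∘ₗ TensorProduct.map (toDual k H p) (toDual k H q) ∘ₗ comul)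
    one := (toDual k H).symm counit
    left_distrib := fun p q r => congrArg WithConv.ofConv (mul_add (WithConv.toConv (toDual k H p))
      (WithConv.toConv (toDual k H q)) (WithConv.toConv (toDual k H r)))
    right_distrib := fun p q r => congrArg WithConv.ofConv (add_mul
      (WithConv.toConv (toDual k H p)) (WithConv.toConv (toDual k H q))
      (WithConv.toConv (toDual k H r)))
    zero_mul := fun p => congrArg WithConv.ofConv (zero_mul (WithConv.toConv (toDual k H p)))
    mul_zero := fun p => congrArg WithConv.ofConv (mul_zero (WithConv.toConv (toDual k H p)))
    mul_assoc := fun p q r => congrArg WithConv.ofConv (mul_assoc (WithConv.toConv (toDual k H p))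
      (WithConv.toConv (toDual k H q)) (WithConv.toConv (toDual k H r)))
    one_mul := fun p => congrArg WithConv.ofConv (one_mul (WithConv.toConv (toDual k H p)))
    mul_one := fun p => congrArg WithConv.ofConv (mul_one (WithConv.toConv (toDual k H p))) }

theorem mul_apply (p q : HDual k H) (x : H) :
    (p * q) x = LinearMap.mul' k k (TensorProduct.map (toDual k H p) (toDual k H q) (comul x)) :=
  rfl

@[simp] theorem one_apply (x : H) : (1 : HDual k H) x = counit (R := k) x := rfl

instance : Algebra k (HDual k H) :=
  Algebra.ofModule
    (fun r p q => congrArg WithConv.ofConv (smul_mul_assoc r (WithConv.toConv (toDual k H p))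
      (WithConv.toConv (toDual k H q))))
    (fun r p q => congrArg WithConv.ofConv (mul_smul_comm r (WithConv.toConv (toDual k H p))
      (WithConv.toConv (toDual k H q))))

/-- Evaluation `⟨-, x⟩` at `x`. -/
def ev (x : H) : HDual k H →ₗ[k] k := LinearMap.applyₗ x ∘ₗ (toDual k H).toLinearMap

@[simp] theorem ev_apply (x : H) (p : HDual k H) : ev x p = p x := rfl

/-- Evaluation of the first leg, `p ⊗ z ↦ ⟨p, x⟩ z`. -/
def evT {X : Type*} [AddCommGroup X] [Module k X] (x : H) : HDual k H ⊗[k] X →ₗ[k] X :=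
  (TensorProduct.lid k X).toLinearMap ∘ₗ (ev x).rTensor X

@[simp] theorem evT_tmul {X : Type*} [AddCommGroup X] [Module k X] (x : H) (p : HDual k H)
    (z : X) : evT x (p ⊗ₜ[k] z) = p x • z := rfl

/-- `evT` as a linear map in the point of evaluation. -/
def evTLin {X : Type*} [AddCommGroup X] [Module k X] (z : HDual k H ⊗[k] X) : H →ₗ[k] X where
  toFun x := evT x z
  map_add' x y := by
    induction z with
    | zero => simp
    | add a b ha hb => simp only [map_add, ha, hb]; abel
    | tmul p a => simp [add_smul]
  map_smul' c x := by
    induction z with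
    | zero => simp
    | add a b ha hb => simp only [map_add, ha, hb, smul_add]
    | tmul p a => simp [smul_smul]

end Basic

section Finite
variable {k H : Type*} [Field k] [Ring H] [Bialgebra k H] [Module.Finite k H]

instance : Module.Finite k (HDual k H) :=
  Module.Finite.equiv (toDual k H).symm

theorem ext_evT {X : Type*} [AddCommGroup X] [Module k X] {z w : HDual k H ⊗[k] X}
    (h : ∀ x, evT x z = evT x w) : z = w := by
  have key : ∀ z : HDual k H ⊗[k] X, ∑ i, ((toDual k H).symm ((Module.finBasis k H).coord i)) ⊗ₜ[k] evT (Module.finBasis k H i) z = z := by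
    intro z
    induction z with
    | zero => simp only [LinearMap.map_zero, LinearEquiv.map_zero, zero_tmul, tmul_zero, zero_smul, zero_mul, mul_zero, LinearMap.zero_apply, Finset.sum_const_zero]
    | add x y hx hy => simp only [LinearMap.map_add, LinearEquiv.map_add, tmul_add, Finset.sum_add_distrib, hx, hy]
    | tmul p x =>
      simp only [evT_tmul, ← smul_tmul, ← sum_tmul]
      congr 1
      refine (toDual k H).injective ((Module.finBasis k H).ext fun j => ?_)
      simp [Finsupp.single_apply]
  rw [← key z, ← key w]
  simp only [h]

/-- The coalgebra structure of `H^*`: the comultiplication is the transpose of the multiplication of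
`H`, that is `⟨p₁, x⟩ ⟨p₂, y⟩ = ⟨p, x y⟩`, and the counit is evaluation at `1`. -/
instance : CoalgebraStruct k (HDual k H) where
  comul := TensorProduct.map (toDual k H).symm.toLinearMap
      (toDual k H).symm.toLinearMap ∘ₗ
    (TensorProduct.dualDistribEquiv k H H).symm.toLinearMap ∘ₗ
    (LinearMap.mul' k H).dualMap ∘ₗ (toDual k H).toLinearMap
  counit := ev 1

theorem counit_eq (p : HDual k H) : counit (R := k) p = p 1 := rfl

@[simp] theorem evT_evT_comul (p : HDual k H) (x y : H) :
    (evT x (comul (R := k) p)) y = p (x * y) := by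
  have key : ∀ z : Module.Dual k H ⊗[k] Module.Dual k H,
      (evT x (TensorProduct.map (toDual k H).symm.toLinearMap
      (toDual k H).symm.toLinearMap z)) y =
      TensorProduct.dualDistribEquiv k H H z (x ⊗ₜ y) := by
    intro z
    induction z with
    | zero => simp
    | add a b ha hb =>
      simp only [map_add, LinearMap.add_apply, ← ha, ← hb, add_apply]
    | tmul a b => simp [TensorProduct.dualDistribEquiv, TensorProduct.dualDistribEquivOfBasis]
  exact (key _).trans (LinearMap.congr_fun
    ((TensorProduct.dualDistribEquiv k H H).apply_symm_apply _) (x ⊗ₜ[k] y))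


theorem mul_coef (p q : HDual k H) (i j : Fin (Module.finrank k H)) :
    (p * q) (coef k i j) = ∑ l, p (coef k i l) * q (coef k l j) := by
  rw [mul_apply, comul_coef]
  simp [map_sum]

instance : Coalgebra k (HDual k H) where
  coassoc := by
    refine LinearMap.ext fun p => ext_evT fun x => ext_evT fun y => ext_ev fun w => ?_
    have h1 : ∀ z : HDual k H ⊗[k] HDual k H, evT y (evT x (TensorProduct.assoc k _ _ _
        ((comul (R := k)).rTensor (HDual k H) z))) = evT (x * y) z := by
      intro z
      induction z with
      | zero => simp only [LinearMap.map_zero, LinearEquiv.map_zero]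
      | add a b ha hb => simp only [LinearMap.map_add, LinearEquiv.map_add, ha, hb]
      | tmul a b =>
        have h2 : ∀ z : HDual k H ⊗[k] HDual k H, evT y (evT x (TensorProduct.assoc k _ _ _
            (z ⊗ₜ[k] b))) = (evT x z) y • b := by
          intro z
          induction z with
          | zero => simp only [LinearMap.map_zero, LinearEquiv.map_zero, zero_tmul, zero_apply,
              zero_smul]
          | add a b ha hb => simp only [LinearMap.map_add, LinearEquiv.map_add, add_tmul, ha, hb,
              add_apply, add_smul]
          | tmul a c => simp [smul_smul]
        rw [LinearMap.rTensor_tmul, h2, evT_evT_comul, evT_tmul]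
    have h3 : ∀ z : HDual k H ⊗[k] HDual k H, evT x ((comul (R := k)).lTensor (HDual k H) z) =
        comul (R := k) (evT x z) := by
      intro z
      induction z with
      | zero => simp only [LinearMap.map_zero, LinearEquiv.map_zero, zero_tmul, tmul_zero, zero_smul, zero_mul, mul_zero, LinearMap.zero_apply, Finset.sum_const_zero]
      | add a b ha hb => simp only [LinearMap.map_add, LinearEquiv.map_add, ha, hb]
      | tmul a b => simp
    change (evT y (evT x (TensorProduct.assoc k _ _ _ ((comul (R := k)).rTensor (HDual k H)
      (comul (R := k) p))))) w = (evT y (evT x ((comul (R := k)).lTensor (HDual k H)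
        (comul (R := k) p)))) w
    rw [h1, h3]
    simp [mul_assoc]
  rTensor_counit_comp_comul := by
    refine LinearMap.ext fun p => (TensorProduct.lid k (HDual k H)).injective (ext_ev fun x => ?_)
    have : ∀ z : HDual k H ⊗[k] HDual k H, TensorProduct.lid k (HDual k H)
        ((counit (R := k)).rTensor (HDual k H) z) = evT 1 z := fun z => rfl
    rw [LinearMap.comp_apply, this]
    simp
  lTensor_counit_comp_comul := by
    refine LinearMap.ext fun p => ext_evT fun x => ?_
    have : ∀ z : HDual k H ⊗[k] HDual k H, evT x ((counit (R := k)).lTensor (HDual k H) z) =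
        (evT x z) 1 := by
      intro z
      induction z with
      | zero => simp
      | add a b ha hb => simp only [map_add, ha, hb, add_apply]
      | tmul a b => simp [counit_eq]
    rw [LinearMap.comp_apply, this]
    simp

theorem evT_evT_mul (z w : HDual k H ⊗[k] HDual k H) (i j m n : Fin (Module.finrank k H)) :
    (evT (coef k i j) (z * w)) (coef k m n) = ∑ l, ∑ r,
      (evT (coef k i l) z) (coef k m r) * (evT (coef k l j) w) (coef k r n) := by
  induction z with
  | zero => simp
  | add a b ha hb =>
    simp only [map_add, add_mul, add_apply, ha, hb,
      Finset.sum_add_distrib]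
  | tmul a b =>
    induction w with
    | zero => simp
    | add c d hc hd =>
      simp only [map_add, mul_add, add_apply, hc, hd,
        Finset.sum_add_distrib]
    | tmul c d =>
      simp only [Algebra.TensorProduct.tmul_mul_tmul, evT_tmul, smul_apply, mul_coef, Finset.sum_mul_sum]
      exact Finset.sum_congr rfl fun _ _ => Finset.sum_congr rfl fun _ _ => by ring

theorem ext_coef_coef {z w : HDual k H ⊗[k] HDual k H}
    (h : ∀ i j m n, (evT (coef k i j) z) (coef k m n) = (evT (coef k i j) w) (coef k m n)) :
    z = w := by
  refine ext_evT fun x => ext_ev fun y => ?_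
  refine eq_of_coef k (toDual k H (evT x z)) (toDual k H (evT x w)) (fun m n => ?_) y
  exact eq_of_coef k (ev (coef k m n) ∘ₗ evTLin z) (ev (coef k m n) ∘ₗ evTLin w)
    (fun i j => h i j m n) x

instance : Bialgebra k (HDual k H) :=
  Bialgebra.mk' k (HDual k H) (by simp [counit_eq])
    (fun {p q} => by
      rw [counit_eq, counit_eq, counit_eq, mul_apply, Bialgebra.comul_one,
        Algebra.TensorProduct.one_def]
      simp)
    (by
      refine ext_evT fun x => ext_ev fun y => ?_
      rw [evT_evT_comul, Algebra.TensorProduct.one_def]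
      simp)
    (fun {p q} => by
      refine ext_coef_coef fun i j m n => ?_
      rw [evT_evT_comul, evT_evT_mul, mul_apply, Bialgebra.comul_mul, comul_coef,
        comul_coef]
      simp [Finset.sum_mul_sum, map_sum])

end Finite
end HDual


/-! ### Twisted tensor products of algebras -/

section Twisting
variable {k : Type*} {A : Type*} {B : Type*} [Field k] [Ring A] [Algebra k A] [Ring B] [Algebra k B]

/-- The product `(a ⊗ b)(a' ⊗ b') = a τ(b ⊗ a') b'` on `A ⊗ B` defined by a map
`τ : B ⊗ A → A ⊗ B`. -/
def twMul (τ : B ⊗[k] A →ₗ[k] A ⊗[k] B) : (A ⊗[k] B) ⊗[k] (A ⊗[k] B) →ₗ[k] A ⊗[k] B :=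
  TensorProduct.map (LinearMap.mul' k A) (LinearMap.mul' k B) ∘ₗ
  (TensorProduct.assoc k A A (B ⊗[k] B)).symm.toLinearMap ∘ₗ
  ((TensorProduct.assoc k A B B).toLinearMap ∘ₗ τ.rTensor B ∘ₗ
    (TensorProduct.assoc k B A B).symm.toLinearMap).lTensor A ∘ₗ
  (TensorProduct.assoc k A B (A ⊗[k] B)).toLinearMap

theorem twMul_tmul (τ : B ⊗[k] A →ₗ[k] A ⊗[k] B) (a a' : A) (b b' : B) :
    twMul τ ((a ⊗ₜ b) ⊗ₜ (a' ⊗ₜ b')) =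
      TensorProduct.map (LinearMap.mulLeft k a) (LinearMap.mulRight k b') (τ (b ⊗ₜ a')) := by
  simp only [twMul, LinearMap.comp_apply, LinearEquiv.coe_coe, assoc_tmul, LinearMap.lTensor_tmul,
    assoc_symm_tmul, LinearMap.rTensor_tmul]
  generalize τ (b ⊗ₜ a') = z
  induction z with
  | zero => simp only [LinearMap.map_zero, LinearEquiv.map_zero, zero_tmul, tmul_zero, zero_smul, zero_mul, mul_zero, LinearMap.zero_apply, HDual.zero_apply, Finset.sum_const_zero]
  | add x y hx hy => simp only [LinearMap.map_add, LinearEquiv.map_add, add_tmul, tmul_add, hx, hy]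
  | tmul x y => simp

variable (k A B) in
/-- A twisting map `τ : B ⊗ A → A ⊗ B` between algebras: it is compatible with the units and the
multiplications of `A` and `B`. -/
structure TwistingMap where
  /-- the underlying linear map -/
  map : B ⊗[k] A →ₗ[k] A ⊗[k] B
  one_tmul : ∀ a, map (1 ⊗ₜ a) = a ⊗ₜ 1
  tmul_one : ∀ b, map (b ⊗ₜ 1) = 1 ⊗ₜ b
  mul_tmul : ∀ b b' a, map ((b * b') ⊗ₜ a) = twMul map ((1 ⊗ₜ b) ⊗ₜ map (b' ⊗ₜ a))
  tmul_mul : ∀ b a a', map (b ⊗ₜ (a * a')) = twMul map (map (b ⊗ₜ a) ⊗ₜ (a' ⊗ₜ 1))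

namespace TwistingMap
variable (T : TwistingMap k A B)

/-- The twisted tensor product algebra: the vector space `A ⊗ B` with the product
`(a ⊗ b)(a' ⊗ b') = a τ(b ⊗ a') b'` and the unit `1 ⊗ 1`. -/
def Tensor (_T : TwistingMap k A B) : Type _ := A ⊗[k] B

instance : AddCommGroup T.Tensor := inferInstanceAs (AddCommGroup (A ⊗[k] B))
instance : Module k T.Tensor := inferInstanceAs (Module k (A ⊗[k] B))
instance [Module.Finite k A] [Module.Finite k B] : Module.Finite k T.Tensor :=
  inferInstanceAs (Module.Finite k (A ⊗[k] B))

/-- The identity map from `A ⊗ B` to the twisted tensor product. -/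
def of : A ⊗[k] B ≃ₗ[k] T.Tensor := LinearEquiv.refl k (A ⊗[k] B)

theorem twMul_map_left (τ : B ⊗[k] A →ₗ[k] A ⊗[k] B) (a : A) (z w : A ⊗[k] B) :
    twMul τ ((LinearMap.mulLeft k a).rTensor B z ⊗ₜ w) =
      (LinearMap.mulLeft k a).rTensor B (twMul τ (z ⊗ₜ w)) := by
  induction z with
  | zero => simp only [LinearMap.map_zero, LinearEquiv.map_zero, zero_tmul, tmul_zero, zero_smul, zero_mul, mul_zero, LinearMap.zero_apply, HDual.zero_apply, Finset.sum_const_zero]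
  | add x y hx hy => simp only [LinearMap.map_add, LinearEquiv.map_add, add_tmul, hx, hy]
  | tmul x y =>
    induction w with
    | zero => simp only [LinearMap.map_zero, LinearEquiv.map_zero, zero_tmul, tmul_zero, zero_smul, zero_mul, mul_zero, LinearMap.zero_apply, HDual.zero_apply, Finset.sum_const_zero]
    | add z w hx hy => simp only [LinearMap.map_add, LinearEquiv.map_add, tmul_add, hx, hy]
    | tmul z w =>
      simp only [LinearMap.rTensor_tmul, twMul_tmul, LinearMap.mulLeft_apply]
      generalize τ (y ⊗ₜ z) = v
      induction v with
      | zero => simp only [LinearMap.map_zero, LinearEquiv.map_zero, zero_tmul, tmul_zero, zero_smul, zero_mul, mul_zero, LinearMap.zero_apply, HDual.zero_apply, Finset.sum_const_zero]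
      | add x y hx hy => simp only [LinearMap.map_add, LinearEquiv.map_add, hx, hy]
      | tmul x y => simp [mul_assoc]

theorem twMul_map_right (τ : B ⊗[k] A →ₗ[k] A ⊗[k] B) (b : B) (z w : A ⊗[k] B) :
    twMul τ (z ⊗ₜ (LinearMap.mulRight k b).lTensor A w) =
      (LinearMap.mulRight k b).lTensor A (twMul τ (z ⊗ₜ w)) := by
  induction z with
  | zero => simp only [LinearMap.map_zero, LinearEquiv.map_zero, zero_tmul, tmul_zero, zero_smul, zero_mul, mul_zero, LinearMap.zero_apply, HDual.zero_apply, Finset.sum_const_zero]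
  | add x y hx hy => simp only [LinearMap.map_add, LinearEquiv.map_add, add_tmul, hx, hy]
  | tmul x y =>
    induction w with
    | zero => simp only [LinearMap.map_zero, LinearEquiv.map_zero, zero_tmul, tmul_zero, zero_smul, zero_mul, mul_zero, LinearMap.zero_apply, HDual.zero_apply, Finset.sum_const_zero]
    | add z w hx hy => simp only [LinearMap.map_add, LinearEquiv.map_add, tmul_add, hx, hy]
    | tmul z w =>
      simp only [LinearMap.lTensor_tmul, twMul_tmul, LinearMap.mulRight_apply]
      generalize τ (y ⊗ₜ z) = v
      induction v with
      | zero => simp only [LinearMap.map_zero, LinearEquiv.map_zero, zero_tmul, tmul_zero, zero_smul, zero_mul, mul_zero, LinearMap.zero_apply, HDual.zero_apply, Finset.sum_const_zero]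
      | add x y hx hy => simp only [LinearMap.map_add, LinearEquiv.map_add, hx, hy]
      | tmul x y => simp [mul_assoc]

theorem twMul_assoc (x y z : A ⊗[k] B) :
    twMul T.map (twMul T.map (x ⊗ₜ y) ⊗ₜ z) = twMul T.map (x ⊗ₜ twMul T.map (y ⊗ₜ z)) := by
  -- moving a factor of `B` in the middle
  have mid : ∀ (u w : A ⊗[k] B) (b : B) , twMul T.map ((LinearMap.mulRight k b).lTensor A u ⊗ₜ w) =
      twMul T.map (u ⊗ₜ twMul T.map ((1 ⊗ₜ b) ⊗ₜ w)) := by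
    intro u w b
    induction u with
    | zero => simp only [LinearMap.map_zero, LinearEquiv.map_zero, zero_tmul, tmul_zero, zero_smul, zero_mul, mul_zero, LinearMap.zero_apply, HDual.zero_apply, Finset.sum_const_zero]
    | add x y hx hy => simp only [LinearMap.map_add, LinearEquiv.map_add, add_tmul, hx, hy]
    | tmul a v =>
      induction w with
      | zero => simp only [LinearMap.map_zero, LinearEquiv.map_zero, zero_tmul, tmul_zero, zero_smul, zero_mul, mul_zero, LinearMap.zero_apply, HDual.zero_apply, Finset.sum_const_zero]
      | add z w hx hy => simp only [LinearMap.map_add, LinearEquiv.map_add, tmul_add, hx, hy]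
      | tmul c d =>
        have e1 : (c ⊗ₜ d : A ⊗[k] B) = (LinearMap.mulRight k d).lTensor A (c ⊗ₜ 1) := by simp
        have e2 : ∀ s : B, (a ⊗ₜ s : A ⊗[k] B) = (LinearMap.mulLeft k a).rTensor B (1 ⊗ₜ s) := by
          simp
        have e3 : ∀ s : B, twMul T.map ((1 ⊗ₜ s) ⊗ₜ (c ⊗ₜ 1)) = T.map (s ⊗ₜ c) := by
          intro s; rw [twMul_tmul]; simp
        rw [LinearMap.lTensor_tmul, LinearMap.mulRight_apply, e1, twMul_map_right, twMul_map_right,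
          twMul_map_right, e2, e2, twMul_map_left, twMul_map_left, e3, e3, T.mul_tmul]
  have midA : ∀ (u w : A ⊗[k] B) (a : A), twMul T.map (u ⊗ₜ (LinearMap.mulLeft k a).rTensor B w) =
      twMul T.map (twMul T.map (u ⊗ₜ (a ⊗ₜ 1)) ⊗ₜ w) := by
    intro u w a
    induction u with
    | zero => simp only [LinearMap.map_zero, LinearEquiv.map_zero, zero_tmul, tmul_zero, zero_smul, zero_mul, mul_zero, LinearMap.zero_apply, HDual.zero_apply, Finset.sum_const_zero]
    | add x y hx hy => simp only [LinearMap.map_add, LinearEquiv.map_add, add_tmul, hx, hy]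
    | tmul c v =>
      induction w with
      | zero => simp only [LinearMap.map_zero, LinearEquiv.map_zero, zero_tmul, tmul_zero, zero_smul, zero_mul, mul_zero, LinearMap.zero_apply, HDual.zero_apply, Finset.sum_const_zero]
      | add z w hx hy => simp only [LinearMap.map_add, LinearEquiv.map_add, tmul_add, hx, hy]
      | tmul s d =>
        have e1 : ∀ s : A, (s ⊗ₜ d : A ⊗[k] B) = (LinearMap.mulRight k d).lTensor A (s ⊗ₜ 1) := by
          simp
        have e2 : (c ⊗ₜ v : A ⊗[k] B) = (LinearMap.mulLeft k c).rTensor B (1 ⊗ₜ v) := by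
          simp
        have e3 : ∀ s : A, twMul T.map ((1 ⊗ₜ v) ⊗ₜ (s ⊗ₜ 1)) = T.map (v ⊗ₜ s) := by
          intro s; rw [twMul_tmul]; simp
        rw [LinearMap.rTensor_tmul, LinearMap.mulLeft_apply, e1, e1, twMul_map_right,
          twMul_map_right, e2, twMul_map_left, twMul_map_left, twMul_map_left, e3, e3, T.tmul_mul]
  induction y with
  | zero => simp only [LinearMap.map_zero, LinearEquiv.map_zero, zero_tmul, tmul_zero, zero_smul, zero_mul, mul_zero, LinearMap.zero_apply, HDual.zero_apply, Finset.sum_const_zero]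
  | add x y hx hy => simp only [LinearMap.map_add, LinearEquiv.map_add, add_tmul, tmul_add, hx, hy]
  | tmul a b =>
    have e1 : (a ⊗ₜ b : A ⊗[k] B) = (LinearMap.mulRight k b).lTensor A (a ⊗ₜ 1) := by simp
    have e2 : (a ⊗ₜ b : A ⊗[k] B) = (LinearMap.mulLeft k a).rTensor B (1 ⊗ₜ b) := by simp
    conv_lhs => rw [e1, twMul_map_right, mid]
    conv_rhs => rw [e2, twMul_map_left, midA]

theorem twMul_one_left (x : A ⊗[k] B) : twMul T.map ((1 ⊗ₜ 1) ⊗ₜ x) = x := by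
  induction x with
  | zero => simp only [LinearMap.map_zero, LinearEquiv.map_zero, zero_tmul, tmul_zero, zero_smul, zero_mul, mul_zero, LinearMap.zero_apply, HDual.zero_apply, Finset.sum_const_zero]
  | add x y hx hy => simp only [LinearMap.map_add, LinearEquiv.map_add, tmul_add, hx, hy]
  | tmul a b => simp [twMul_tmul, T.one_tmul]

theorem twMul_one_right (x : A ⊗[k] B) : twMul T.map (x ⊗ₜ (1 ⊗ₜ 1)) = x := by
  induction x with
  | zero => simp only [LinearMap.map_zero, LinearEquiv.map_zero, zero_tmul, tmul_zero, zero_smul, zero_mul, mul_zero, LinearMap.zero_apply, HDual.zero_apply, Finset.sum_const_zero]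
  | add x y hx hy => simp only [LinearMap.map_add, LinearEquiv.map_add, add_tmul, hx, hy]
  | tmul a b => simp [twMul_tmul, T.tmul_one]

/-- The multiplication as a bilinear map. -/
def mulLin : T.Tensor →ₗ[k] T.Tensor →ₗ[k] T.Tensor :=
  ((TensorProduct.mk k (A ⊗[k] B) (A ⊗[k] B)).compr₂ (T.of.toLinearMap ∘ₗ twMul T.map)).compl₁₂
    T.of.symm.toLinearMap T.of.symm.toLinearMap

instance : Ring T.Tensor :=
  { (inferInstance : AddCommGroup T.Tensor) with
    mul := fun x y => T.mulLin x y
    one := T.of (1 ⊗ₜ 1)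
    left_distrib := fun x y z => map_add (T.mulLin x) y z
    right_distrib := fun x y z => T.mulLin.map_add₂ x y z
    zero_mul := fun x => T.mulLin.map_zero₂ x
    mul_zero := fun x => map_zero (T.mulLin x)
    mul_assoc := fun x y z => T.twMul_assoc x y z
    one_mul := fun x => T.twMul_one_left x
    mul_one := fun x => T.twMul_one_right x }

instance : Algebra k T.Tensor :=
  Algebra.ofModule (fun r x y => T.mulLin.map_smul₂ r x y)
    (fun r x y => map_smul (T.mulLin x) r y)

theorem of_mul_of (x y : A ⊗[k] B) : T.of x * T.of y = T.of (twMul T.map (x ⊗ₜ y)) := rfl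
theorem one_def : (1 : T.Tensor) = T.of (1 ⊗ₜ 1) := rfl

/-- The inclusion of the first factor. -/
def inl : A →ₐ[k] T.Tensor :=
  AlgHom.ofLinearMap (T.of.toLinearMap ∘ₗ (TensorProduct.mk k A B).flip 1) rfl
    (fun x y => by
      change T.of ((x * y) ⊗ₜ 1) = T.of (x ⊗ₜ 1) * T.of (y ⊗ₜ 1)
      rw [of_mul_of, twMul_tmul, T.one_tmul]; simp)

/-- The inclusion of the second factor. -/
def inr : B →ₐ[k] T.Tensor :=
  AlgHom.ofLinearMap (T.of.toLinearMap ∘ₗ TensorProduct.mk k A B 1) rfl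
    (fun x y => by
      change T.of (1 ⊗ₜ (x * y)) = T.of (1 ⊗ₜ x) * T.of (1 ⊗ₜ y)
      rw [of_mul_of, twMul_tmul, T.tmul_one]; simp)

theorem inl_mul_inr (a : A) (b : B) : T.inl a * T.inr b = T.of (a ⊗ₜ b) := by
  change T.of (a ⊗ₜ 1) * T.of (1 ⊗ₜ b) = _
  rw [of_mul_of, twMul_tmul, T.one_tmul]; simp

theorem inr_mul_inl (a : A) (b : B) : T.inr b * T.inl a = T.of (T.map (b ⊗ₜ a)) := by
  change T.of (1 ⊗ₜ b) * T.of (a ⊗ₜ 1) = _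
  rw [of_mul_of, twMul_tmul]; simp

theorem of_eq_sum (z : A ⊗[k] B) : T.of z = LinearMap.mul' k T.Tensor
    (TensorProduct.map T.inl.toLinearMap T.inr.toLinearMap z) := by
  induction z with
  | zero => simp only [LinearMap.map_zero, LinearEquiv.map_zero, zero_tmul, tmul_zero, zero_smul, zero_mul, mul_zero, LinearMap.zero_apply, HDual.zero_apply, Finset.sum_const_zero]
  | add x y hx hy => simp only [LinearMap.map_add, LinearEquiv.map_add, hx, hy]
  | tmul a b => simp [inl_mul_inr]

theorem ext_linear {X : Type*} [AddCommGroup X] [Module k X] {f g : T.Tensor →ₗ[k] X}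
    (h : ∀ a b, f (T.inl a * T.inr b) = g (T.inl a * T.inr b)) : f = g := by
  have : f ∘ₗ T.of.toLinearMap = g ∘ₗ T.of.toLinearMap := by
    refine TensorProduct.ext' fun a b => ?_
    simpa [inl_mul_inr] using h a b
  exact LinearMap.ext fun x => LinearMap.congr_fun this x

/-- An additive and multiplicative property of elements of a twisted tensor product holds as soon
as it holds on the two factors. -/
theorem gen_induction {P : T.Tensor → Prop} (h0 : P 0) (hl : ∀ a, P (T.inl a)) (hr : ∀ b, P (T.inr b))
    (hadd : ∀ x y, P x → P y → P (x + y)) (hmul : ∀ x y, P x → P y → P (x * y)) (x : T.Tensor) :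
    P x := by
  have : ∀ z : A ⊗[k] B, P (T.of z) := by
    intro z
    induction z with
    | zero => simpa using h0
    | add x y hx hy => simpa using hadd _ _ hx hy
    | tmul a b => rw [← inl_mul_inr]; exact hmul _ _ (hl a) (hr b)
  exact this x

/-- Algebra maps out of a twisted tensor product. -/
def lift {E : Type*} [Ring E] [Algebra k E] (f : A →ₐ[k] E) (g : B →ₐ[k] E)
    (h : ∀ a b, g b * f a = LinearMap.mul' k E
      (TensorProduct.map f.toLinearMap g.toLinearMap (T.map (b ⊗ₜ a)))) : T.Tensor →ₐ[k] E :=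
  AlgHom.ofLinearMap (LinearMap.mul' k E ∘ₗ TensorProduct.map f.toLinearMap g.toLinearMap ∘ₗ
      T.of.symm.toLinearMap)
    (by
      change LinearMap.mul' k E (TensorProduct.map f.toLinearMap g.toLinearMap (1 ⊗ₜ 1)) = 1
      simp)
    (fun x y => by
      change LinearMap.mul' k E (TensorProduct.map f.toLinearMap g.toLinearMap
        (twMul T.map ((T.of.symm x) ⊗ₜ (T.of.symm y)))) =
        LinearMap.mul' k E (TensorProduct.map f.toLinearMap g.toLinearMap (T.of.symm x)) *
        LinearMap.mul' k E (TensorProduct.map f.toLinearMap g.toLinearMap (T.of.symm y))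
      generalize T.of.symm x = x'
      generalize T.of.symm y = y'
      induction x' with
      | zero => simp only [LinearMap.map_zero, LinearEquiv.map_zero, zero_tmul, tmul_zero, zero_smul, zero_mul, mul_zero, LinearMap.zero_apply, HDual.zero_apply, Finset.sum_const_zero]
      | add x y hx hy => simp only [LinearMap.map_add, LinearEquiv.map_add, add_tmul, add_mul, hx, hy]
      | tmul a b =>
        induction y' with
        | zero => simp only [LinearMap.map_zero, LinearEquiv.map_zero, zero_tmul, tmul_zero, zero_smul, zero_mul, mul_zero, LinearMap.zero_apply, HDual.zero_apply, Finset.sum_const_zero]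
        | add x y hx hy => simp only [LinearMap.map_add, LinearEquiv.map_add, tmul_add, mul_add, hx, hy]
        | tmul a' b' =>
          have key : ∀ z : A ⊗[k] B, LinearMap.mul' k E (TensorProduct.map f.toLinearMap
              g.toLinearMap (TensorProduct.map (LinearMap.mulLeft k a) (LinearMap.mulRight k b') z))
              = f a * (LinearMap.mul' k E (TensorProduct.map f.toLinearMap g.toLinearMap z))
                * g b' := by
            intro z
            induction z with
            | zero => simp only [LinearMap.map_zero, LinearEquiv.map_zero, zero_tmul, tmul_zero, zero_smul, zero_mul, mul_zero, LinearMap.zero_apply, HDual.zero_apply, Finset.sum_const_zero]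
            | add x y hx hy => simp only [LinearMap.map_add, LinearEquiv.map_add, mul_add, add_mul, hx, hy]
            | tmul x y => simp [mul_assoc]
          rw [twMul_tmul, key, ← h]
          simp [mul_assoc])

theorem lift_of {E : Type*} [Ring E] [Algebra k E] (f : A →ₐ[k] E) (g : B →ₐ[k] E) (h) (a : A)
    (b : B) : T.lift f g h (T.of (a ⊗ₜ b)) = f a * g b := by
  change LinearMap.mul' k E (TensorProduct.map f.toLinearMap g.toLinearMap (a ⊗ₜ b)) = _
  simp

@[simp] theorem lift_inl {E : Type*} [Ring E] [Algebra k E] (f : A →ₐ[k] E) (g : B →ₐ[k] E) (h)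
    (a : A) : T.lift f g h (T.inl a) = f a :=
  (T.lift_of f g h a 1).trans (by simp)

@[simp] theorem lift_inr {E : Type*} [Ring E] [Algebra k E] (f : A →ₐ[k] E) (g : B →ₐ[k] E) (h)
    (b : B) : T.lift f g h (T.inr b) = g b :=
  (T.lift_of f g h 1 b).trans (by simp)

end TwistingMap
end Twisting


/-! ### Module algebras and smash products -/

/-- `A` is a left `K`-module algebra: `x · (a b) = (x₁ · a) (x₂ · b)` and `x · 1 = ε(x) 1`. -/
class ModuleAlgebra (k K A : Type*) [Field k] [Ring K] [Bialgebra k K] [Ring A] [Algebra k A] where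
  /-- the action `x ↦ (a ↦ x · a)` -/
  act : K →ₐ[k] Module.End k A
  act_mul : ∀ (x : K) (a b : A), act x (a * b) = LinearMap.mul' k A
    (TensorProduct.map (LinearMap.applyₗ a ∘ₗ act.toLinearMap) (LinearMap.applyₗ b ∘ₗ act.toLinearMap)
      (comul (R := k) x))
  act_one : ∀ x : K, act x (1 : A) = counit (R := k) x • (1 : A)

section Smash
variable (k K A : Type*) [Field k] [Ring K] [Bialgebra k K] [Module.Finite k K]
  [Ring A] [Algebra k A] [ModuleAlgebra k K A]

open ModuleAlgebra

variable {K A} in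
/-- The map `x ↦ x · a`. -/
def actOn (a : A) : K →ₗ[k] A := LinearMap.applyₗ a ∘ₗ (act (k := k) (K := K) (A := A)).toLinearMap

variable {K A} in
theorem actOn_apply (a : A) (x : K) : actOn k a x = act (k := k) x a := rfl

variable {K A} in
theorem act_mul_coef (i j : Fin (Module.finrank k K)) (a b : A) :
    act (k := k) (coef k i j : K) (a * b) =
      ∑ l, act (k := k) (coef k i l : K) a * act (k := k) (coef k l j : K) b := by
  rw [act_mul, comul_coef]
  simp [map_sum]

/-- The map `x ⊗ a ↦ (x₁ · a) ⊗ x₂`. -/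
def smashMap : K ⊗[k] A →ₗ[k] A ⊗[k] K :=
  (TensorProduct.lift (act (k := k) (K := K) (A := A)).toLinearMap).rTensor K ∘ₗ
  (TensorProduct.assoc k K A K).symm.toLinearMap ∘ₗ
  (TensorProduct.comm k K A).toLinearMap.lTensor K ∘ₗ
  (TensorProduct.assoc k K K A).toLinearMap ∘ₗ (comul (R := k)).rTensor A

variable {K A} in
theorem smashMap_tmul (x : K) (a : A) :
    smashMap k K A (x ⊗ₜ a) = (actOn k a).rTensor K (comul (R := k) x) := by
  simp only [smashMap, LinearMap.comp_apply, LinearMap.rTensor_tmul]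
  generalize comul (R := k) x = z
  induction z with
  | zero => simp only [LinearMap.map_zero, LinearEquiv.map_zero, zero_tmul, tmul_zero, zero_smul, zero_mul, mul_zero, LinearMap.zero_apply, HDual.zero_apply, Finset.sum_const_zero]
  | add x y hx hy => simp only [LinearMap.map_add, LinearEquiv.map_add, add_tmul, hx, hy]
  | tmul x y => simp [actOn_apply]

variable {K A} in
theorem smashMap_coef (i j : Fin (Module.finrank k K)) (a : A) :
    smashMap k K A (coef k i j ⊗ₜ a) =
      ∑ l, act (k := k) (coef k i l : K) a ⊗ₜ[k] (coef k l j : K) := by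
  rw [smashMap_tmul, comul_coef]
  simp [map_sum, actOn_apply]

/-- The twisting map of a smash product. -/
def smashTwist : TwistingMap k A K where
  map := smashMap k K A
  one_tmul a := by
    rw [smashMap_tmul, Bialgebra.comul_one, Algebra.TensorProduct.one_def]
    simp [actOn_apply]
  tmul_one b := by
    refine eq_of_coef k (smashMap k K A ∘ₗ (TensorProduct.mk k K A).flip 1)
      (TensorProduct.mk k A K 1) (fun i j => ?_) b
    simp only [LinearMap.comp_apply, LinearMap.flip_apply, mk_apply, smashMap_coef, act_one,
      counit_coef]
    simp [ite_tmul]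
  mul_tmul b b' a := by
    refine eq_of_coef k (smashMap k K A ∘ₗ (TensorProduct.mk k K A).flip a ∘ₗ
      LinearMap.mulRight k b') (twMul (smashMap k K A) ∘ₗ (TensorProduct.mk k _ _).flip
        (smashMap k K A (b' ⊗ₜ a)) ∘ₗ TensorProduct.mk k A K 1) (fun i j => ?_) b
    refine eq_of_coef k (smashMap k K A ∘ₗ (TensorProduct.mk k K A).flip a ∘ₗ
      LinearMap.mulLeft k (coef k i j)) (twMul (smashMap k K A) ∘ₗ
        (TensorProduct.mk k _ _ (1 ⊗ₜ coef k i j)) ∘ₗ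
        smashMap k K A ∘ₗ (TensorProduct.mk k K A).flip a) (fun m n => ?_) b'
    simp only [LinearMap.comp_apply, LinearMap.flip_apply, mk_apply,
      LinearMap.mulLeft_apply, smashMap_tmul, Bialgebra.comul_mul, comul_coef, Finset.sum_mul_sum,
      Algebra.TensorProduct.tmul_mul_tmul, map_sum, twMul_tmul, LinearMap.rTensor_tmul,
      map_tmul, actOn_apply, map_mul, Module.End.mul_apply]
    rw [Finset.sum_comm]
    simp
  tmul_mul b a a' := by
    refine eq_of_coef k (smashMap k K A ∘ₗ (TensorProduct.mk k K A).flip (a * a'))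
      (twMul (smashMap k K A) ∘ₗ (TensorProduct.mk k _ _).flip (a' ⊗ₜ 1) ∘ₗ
        smashMap k K A ∘ₗ (TensorProduct.mk k K A).flip a) (fun i j => ?_) b
    simp only [LinearMap.comp_apply, LinearMap.flip_apply, mk_apply, smashMap_coef,
      act_mul_coef, map_sum, sum_tmul, twMul_tmul, map_tmul, LinearMap.mulLeft_apply,
      LinearMap.mulRight_apply, mul_one]
    rw [Finset.sum_comm]

/-- The smash product `A # K` of a finite-dimensional bialgebra `K` and a `K`-module algebra `A`:
the vector space `A ⊗ K` with the product `(a # x) (b # y) = a (x₁ · b) # x₂ y`. -/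
abbrev Smash (k K A : Type*) [Field k] [Ring K] [Bialgebra k K] [Module.Finite k K]
    [Ring A] [Algebra k A] [ModuleAlgebra k K A] : Type _ := (smashTwist k K A).Tensor

end Smash

/-! ### The Heisenberg double -/

section Heisenberg
variable (k H : Type*) [Field k] [Ring H] [Bialgebra k H] [Module.Finite k H]

/-- The linear map `p ↦ (h ↦ h₁ ⟨p, h₂⟩)`. -/
def hitLin : HDual k H →ₗ[k] Module.End k H where
  toFun p := (TensorProduct.rid k H).toLinearMap ∘ₗ
    (HDual.toDual k H p).lTensor H ∘ₗ comul
  map_add' p q := by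
    ext h; simp [LinearMap.lTensor_add]
  map_smul' c p := by
    ext h; simp [LinearMap.lTensor_smul]

variable {k H} in
theorem hitLin_coef (p : HDual k H) (i j : Fin (Module.finrank k H)) :
    hitLin k H p (coef k i j) = ∑ l, p (coef k l j : H) • coef k i l := by
  change (TensorProduct.rid k H) ((HDual.toDual k H p).lTensor H (comul (coef k i j))) = _
  rw [comul_coef]
  simp [map_sum]

/-- `H` as an `H^*`-module algebra, with the action `p ⇀ h = h₁ ⟨p, h₂⟩`. -/
instance hitModuleAlgebra : ModuleAlgebra k (HDual k H) H where
  act := AlgHom.ofLinearMap (hitLin k H)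
    (by
      refine ext_coef k fun i j => ?_
      rw [hitLin_coef]
      simp [counit_coef])
    (fun p q => by
      refine ext_coef k fun i j => ?_
      simp only [Module.End.mul_apply, hitLin_coef, HDual.mul_coef, map_sum, map_smul,
        Finset.smul_sum, Finset.sum_smul, smul_smul]
      rw [Finset.sum_comm]
      exact Finset.sum_congr rfl fun _ _ => Finset.sum_congr rfl fun _ _ => by rw [mul_comm])
  act_mul p a b := by
    have e : ∀ (z : HDual k H ⊗[k] HDual k H) (i j m n : Fin (Module.finrank k H)),
        LinearMap.mul' k H (TensorProduct.map (LinearMap.applyₗ (coef k i j) ∘ₗ hitLin k H)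
          (LinearMap.applyₗ (coef k m n) ∘ₗ hitLin k H) z) =
          ∑ l, ∑ r, (HDual.evT (coef k l j) z) (coef k r n) • (coef k i l * coef k m r) := by
      intro z i j m n
      induction z with
      | zero => simp only [LinearMap.map_zero, LinearEquiv.map_zero, zero_tmul, tmul_zero, zero_smul, zero_mul, mul_zero, LinearMap.zero_apply, HDual.zero_apply, Finset.sum_const_zero]
      | add x y hx hy => simp only [LinearMap.map_add, LinearEquiv.map_add, hx, hy, HDual.add_apply, add_smul,
          Finset.sum_add_distrib]
      | tmul x y =>
        simp only [map_tmul, LinearMap.comp_apply, LinearMap.applyₗ_apply_apply, hitLin_coef,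
          LinearMap.mul'_apply, Finset.sum_mul_sum, smul_mul_smul_comm, HDual.evT_tmul,
          HDual.smul_apply]
    change hitLin k H p (a * b) = LinearMap.mul' k H (TensorProduct.map
      (LinearMap.applyₗ a ∘ₗ hitLin k H) (LinearMap.applyₗ b ∘ₗ hitLin k H) (comul p))
    refine coef_induction k (P := fun a : H => hitLin k H p (a * b) = LinearMap.mul' k H
      (TensorProduct.map (LinearMap.applyₗ a ∘ₗ hitLin k H) (LinearMap.applyₗ b ∘ₗ hitLin k H)
      (comul p))) a ?_ ?_ ?_ fun i j => ?_
    · simp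
    · intro x y hx hy
      simp [add_mul, LinearMap.add_comp, map_add_left, hx, hy]
    · intro r x hx
      simp [LinearMap.smul_comp, map_smul_left, hx]
    · refine coef_induction k (P := fun b : H => hitLin k H p (coef k i j * b) = LinearMap.mul' k H
        (TensorProduct.map (LinearMap.applyₗ (coef k i j) ∘ₗ hitLin k H)
        (LinearMap.applyₗ b ∘ₗ hitLin k H) (comul p))) b ?_ ?_ ?_ fun m n => ?_
      · simp
      · intro x y hx hy
        simp [mul_add, LinearMap.add_comp, map_add_right, hx, hy]
      · intro r x hx
        simp [LinearMap.smul_comp, map_smul_right, hx]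
      · rw [e]
        change (TensorProduct.rid k H) ((HDual.toDual k H p).lTensor H (comul (coef k i j *
          coef k m n))) = _
        simp [Bialgebra.comul_mul, comul_coef, Finset.sum_mul_sum, map_sum]
  act_one p := by
    change (TensorProduct.rid k H) ((HDual.toDual k H p).lTensor H (comul 1)) = _
    rw [Bialgebra.comul_one, Algebra.TensorProduct.one_def]
    simp [HDual.counit_eq]

/-- The Heisenberg double `ℋ(H) = H # H^*`. -/
abbrev Heisenberg (k H : Type*) [Field k] [Ring H] [Bialgebra k H] [Module.Finite k H] : Type _ :=
  Smash k (HDual k H) H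

end Heisenberg


/-! ### The Drinfeld double -/

section Sums
variable {ι X : Type*} [Fintype ι] [AddCommMonoid X]

theorem sum_perm_3412 (f : ι → ι → ι → ι → X) :
    ∑ a, ∑ b, ∑ c, ∑ d, f a b c d = ∑ c, ∑ d, ∑ a, ∑ b, f a b c d := by
  simp only [← Fintype.sum_prod_type' (f := fun (a b : ι) => _)]
  exact Finset.sum_comm

theorem sum_perm_1324 (f : ι → ι → ι → ι → X) :
    ∑ a, ∑ b, ∑ c, ∑ d, f a b c d = ∑ b, ∑ d, ∑ a, ∑ c, f a b c d := by
  rw [Finset.sum_comm]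
  refine Finset.sum_congr rfl fun b _ => ?_
  refine Eq.trans ?_ Finset.sum_comm
  exact Finset.sum_congr rfl fun a _ => Finset.sum_comm

end Sums

section Drinfeld
variable (k H : Type*) [Field k] [Ring H] [HopfAlgebra k H] [Module.Finite k H]

/-- The map `(g, h, q) ↦ g ⇀ q ↼ S⁻¹(h)`, where `⟨g ⇀ q ↼ S⁻¹(h), x⟩ = ⟨q, S⁻¹(h) x g⟩`. -/
def conj : H →ₗ[k] H →ₗ[k] HDual k H →ₗ[k] HDual k H :=
  LinearMap.mk₂ k (fun g h => (HDual.toDual k H).symm.toLinearMap ∘ₗ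
      (LinearMap.mulLeft k (antipodeInv k h) ∘ₗ LinearMap.mulRight k g).dualMap ∘ₗ
      (HDual.toDual k H).toLinearMap)
    (fun g g' h => by
      refine LinearMap.ext fun q => HDual.ext_ev fun x => ?_
      simp [mul_add])
    (fun c g h => by
      refine LinearMap.ext fun q => HDual.ext_ev fun x => ?_
      simp)
    (fun g h h' => by
      refine LinearMap.ext fun q => HDual.ext_ev fun x => ?_
      simp [add_mul])
    (fun c g h => by
      refine LinearMap.ext fun q => HDual.ext_ev fun x => ?_
      simp)

variable {k H} in
theorem conj_apply (g h : H) (q : HDual k H) (x : H) :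
    conj k H g h q x = q (antipodeInv k h * (x * g)) := rfl

/-- The map `h₁ ⊗ (h₂ ⊗ h₃) ↦ (q ↦ (h₁ ⇀ q ↼ S⁻¹(h₃)) ⊗ h₂)`. -/
def straighten : H ⊗[k] (H ⊗[k] H) →ₗ[k] HDual k H →ₗ[k] HDual k H ⊗[k] H :=
  TensorProduct.lift
    { toFun := fun h₁ => TensorProduct.lift
        ((LinearMap.llcomp k (HDual k H) (HDual k H) (HDual k H ⊗[k] H)).compl₁₂
          (TensorProduct.mk k (HDual k H) H).flip (conj k H h₁))
      map_add' := fun x y => by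
        refine TensorProduct.ext' fun a b => LinearMap.ext fun q => ?_
        simp
      map_smul' := fun c x => by
        refine TensorProduct.ext' fun a b => LinearMap.ext fun q => ?_
        simp [smul_tmul'] }

/-- The map `h ⊗ q ↦ (h₁ ⇀ q ↼ S⁻¹(h₃)) ⊗ h₂`. -/
def drinfeldMap : H ⊗[k] HDual k H →ₗ[k] HDual k H ⊗[k] H :=
  TensorProduct.lift (straighten k H ∘ₗ (comul (R := k) (A := H)).lTensor H ∘ₗ comul (R := k))

variable {k H}

theorem drinfeldMap_coef (i j : Fin (Module.finrank k H)) (q : HDual k H) :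
    drinfeldMap k H (coef k i j ⊗ₜ q) =
      ∑ a, ∑ b, conj k H (coef k i a) (coef k b j) q ⊗ₜ[k] (coef k a b : H) := by
  simp only [drinfeldMap, lift.tmul, LinearMap.comp_apply, comul_coef, map_sum,
    LinearMap.lTensor_tmul, tmul_sum, LinearMap.sum_apply]
  rfl

theorem conj_mul (g g' h h' : H) (q : HDual k H) :
    conj k H (g * g') (h * h') q = conj k H g h (conj k H g' h' q) := by
  refine HDual.ext_ev fun x => ?_
  simp [conj_apply, antipodeInv_mul, mul_assoc]

theorem conj_mul_dual (i a b j : Fin (Module.finrank k H)) (q q' : HDual k H) :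
    conj k H (coef k i a) (coef k b j) (q * q') = ∑ e, ∑ l,
      conj k H (coef k i e) (coef k l j) q * conj k H (coef k e a) (coef k b l) q' := by
  refine HDual.ext_ev fun x => ?_
  have hs : ∀ (x : H) (f : Fin (Module.finrank k H) → Fin (Module.finrank k H) → HDual k H),
      (∑ e, ∑ l, f e l) x = ∑ e, ∑ l, f e l x := by
    intro x f
    change HDual.ev x (∑ e, ∑ l, f e l) = _
    simp [map_sum]
  refine eq_of_coef k (HDual.toDual k H (conj k H (coef k i a) (coef k b j) (q * q')))
    (HDual.toDual k H (∑ e, ∑ l,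
      conj k H (coef k i e) (coef k l j) q * conj k H (coef k e a) (coef k b l) q'))
    (fun m n => ?_) x
  simp only [HDual.toDual_apply, hs, HDual.mul_coef, conj_apply]
  have hc : comul (R := k) (antipodeInv k (coef k b j : H) * (coef k m n * coef k i a)) =
      ∑ e, ∑ l, ∑ r, (antipodeInv k (coef k l j : H) * (coef k m r * coef k i e)) ⊗ₜ[k]
        (antipodeInv k (coef k b l : H) * (coef k r n * coef k e a)) := by
    simp only [Bialgebra.comul_mul, comul_antipodeInv_coef, comul_coef, Finset.sum_mul,
      Finset.mul_sum, Algebra.TensorProduct.tmul_mul_tmul]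
    exact Finset.sum_congr rfl fun _ _ => Finset.sum_comm
  rw [HDual.mul_apply, hc]
  simp only [map_sum, map_tmul, LinearMap.mul'_apply, HDual.toDual_apply]

variable (k H) in
/-- The twisting map of the Drinfeld double. -/
def drinfeldTwist : TwistingMap k (HDual k H) H where
  map := drinfeldMap k H
  one_tmul q := by
    have h : straighten k H (1 ⊗ₜ (1 ⊗ₜ 1)) q = q ⊗ₜ 1 := by
      change conj k H 1 1 q ⊗ₜ[k] (1 : H) = _
      congr 1
      refine HDual.ext_ev fun x => ?_
      simp [conj_apply]
    rw [← h]
    simp [drinfeldMap, Algebra.TensorProduct.one_def]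
  tmul_one b := by
    refine eq_of_coef k (drinfeldMap k H ∘ₗ (TensorProduct.mk k H (HDual k H)).flip 1)
      (TensorProduct.mk k (HDual k H) H 1) (fun i j => ?_) b
    have h : ∀ g h : H, conj k H g h 1 = (counit (R := k) g * counit (R := k) h) •
        (1 : HDual k H) := by
      intro g h
      refine HDual.ext_ev fun x => ?_
      simp [conj_apply]
      ring
    simp only [LinearMap.comp_apply, LinearMap.flip_apply, mk_apply, drinfeldMap_coef, h,
      counit_coef]
    simp [ite_smul, ite_tmul]
  mul_tmul b b' q := by
    refine eq_of_coef k (drinfeldMap k H ∘ₗ (TensorProduct.mk k _ _).flip q ∘ₗ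
      LinearMap.mulRight k b') (twMul (drinfeldMap k H) ∘ₗ (TensorProduct.mk k _ _).flip
        (drinfeldMap k H (b' ⊗ₜ q)) ∘ₗ TensorProduct.mk k (HDual k H) H 1) (fun i j => ?_) b
    refine eq_of_coef k (drinfeldMap k H ∘ₗ (TensorProduct.mk k _ _).flip q ∘ₗ
      LinearMap.mulLeft k (coef k i j)) (twMul (drinfeldMap k H) ∘ₗ
        (TensorProduct.mk k _ _ (1 ⊗ₜ coef k i j)) ∘ₗ
        drinfeldMap k H ∘ₗ (TensorProduct.mk k _ _).flip q) (fun m n => ?_) b'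
    simp only [LinearMap.comp_apply, LinearMap.flip_apply, mk_apply,
      LinearMap.mulLeft_apply, drinfeldMap_coef, map_sum, twMul_tmul, map_tmul,
      LinearMap.mulRight_apply, one_mul, ← conj_mul]
    simp only [drinfeldMap, lift.tmul, LinearMap.comp_apply, comul_coef, map_sum,
      LinearMap.lTensor_tmul, tmul_sum, LinearMap.sum_apply, Bialgebra.comul_mul,
      Finset.sum_mul_sum, Algebra.TensorProduct.tmul_mul_tmul]
    exact sum_perm_1324 _
  tmul_mul b q q' := by
    refine eq_of_coef k (drinfeldMap k H ∘ₗ (TensorProduct.mk k _ _).flip (q * q'))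
      (twMul (drinfeldMap k H) ∘ₗ (TensorProduct.mk k _ _).flip (q' ⊗ₜ 1) ∘ₗ
        drinfeldMap k H ∘ₗ (TensorProduct.mk k _ _).flip q) (fun i j => ?_) b
    simp only [LinearMap.comp_apply, LinearMap.flip_apply, mk_apply, drinfeldMap_coef,
      conj_mul_dual, map_sum, sum_tmul, twMul_tmul, map_tmul, LinearMap.mulLeft_apply,
      LinearMap.mulRight_apply, mul_one]
    exact sum_perm_3412 _

end Drinfeld


section DrinfeldBialgebra
variable (k H : Type*) [Field k] [Ring H] [HopfAlgebra k H] [Module.Finite k H]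

/-- The Drinfeld double `D(H) = H^{*cop} ⋈ H`: the vector space `H^* ⊗ H` with the product
`(p ⋈ h) (q ⋈ g) = p (h₁ ⇀ q ↼ S⁻¹(h₃)) ⋈ h₂ g`. -/
def DrinfeldDouble : Type _ := (drinfeldTwist k H).Tensor

namespace DrinfeldDouble

instance : Ring (DrinfeldDouble k H) := inferInstanceAs (Ring (drinfeldTwist k H).Tensor)
instance : Algebra k (DrinfeldDouble k H) :=
  inferInstanceAs (Algebra k (drinfeldTwist k H).Tensor)
instance : Module.Finite k (DrinfeldDouble k H) :=
  inferInstanceAs (Module.Finite k (drinfeldTwist k H).Tensor)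

/-- The map `p ↦ p ⋈ 1`. -/
def inl : HDual k H →ₐ[k] DrinfeldDouble k H := (drinfeldTwist k H).inl

/-- The map `h ↦ ε ⋈ h`. -/
def inr : H →ₐ[k] DrinfeldDouble k H := (drinfeldTwist k H).inr

/-- The identity map from `H^* ⊗ H` to `D(H)`. -/
def of : HDual k H ⊗[k] H ≃ₗ[k] DrinfeldDouble k H := (drinfeldTwist k H).of

/-- The coalgebra structure of `D(H)` is that of `H^{*cop} ⊗ H`:
`Δ(p ⋈ h) = (p₂ ⋈ h₁) ⊗ (p₁ ⋈ h₂)`. -/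
instance : Coalgebra k (DrinfeldDouble k H) :=
  inferInstanceAs (Coalgebra k (Cop (HDual k H) ⊗[k] H))

variable {k H}

theorem inl_mul_inr (p : HDual k H) (h : H) : inl k H p * inr k H h = of k H (p ⊗ₜ h) :=
  (drinfeldTwist k H).inl_mul_inr p h

theorem inr_mul_inl (i j : Fin (Module.finrank k H)) (q : HDual k H) :
    inr k H (coef k i j) * inl k H q = 
      ∑ a, ∑ b, of k H (conj k H (coef k i a) (coef k b j) q ⊗ₜ[k] (coef k a b : H)) := by
  refine ((drinfeldTwist k H).inr_mul_inl q (coef k i j)).trans ?_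
  change of k H (drinfeldMap k H (coef k i j ⊗ₜ[k] q)) = _
  rw [drinfeldMap_coef]
  simp [map_sum]

/-- The comultiplication on `H^*`. -/
def comulL : HDual k H →ₐ[k] DrinfeldDouble k H ⊗[k] DrinfeldDouble k H :=
  (Algebra.TensorProduct.map (inl k H) (inl k H)).comp
    (Bialgebra.comulAlgHom k (Cop (HDual k H)))

/-- The comultiplication on `H`. -/
def comulR : H →ₐ[k] DrinfeldDouble k H ⊗[k] DrinfeldDouble k H :=
  (Algebra.TensorProduct.map (inr k H) (inr k H)).comp
    (Bialgebra.comulAlgHom k H)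

theorem comul_of (p : HDual k H) (h : H) : comul (R := k) (of k H (p ⊗ₜ h)) =
    comulL p * comulR h := by
  have e : comul (R := k) (of k H (p ⊗ₜ h)) =
     TensorProduct.AlgebraTensorModule.tensorTensorTensorComm k k k k (HDual k H) (HDual k H) H H
      (comul (R := k) (A := Cop (HDual k H)) p ⊗ₜ comul (R := k) h) := 
    rfl
  rw [e, Cop.comul_eq]
  have key : ∀ (L : (HDual k H ⊗[k] HDual k H) ⊗[k] (H ⊗[k] H) →ₗ[k]
        DrinfeldDouble k H ⊗[k] DrinfeldDouble k H)
      (_ : ∀ x y a b, L ((x ⊗ₜ y) ⊗ₜ (a ⊗ₜ b)) = of k H (x ⊗ₜ a) ⊗ₜ of k H (y ⊗ₜ b))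
      (z : HDual k H ⊗[k] HDual k H) (w : H ⊗[k] H),
      L (z ⊗ₜ w) = Algebra.TensorProduct.map (inl k H) (inl k H) z *
        Algebra.TensorProduct.map (inr k H) (inr k H) w := by
    intro L hL z w
    induction z with
    | zero => simp
    | add x y hx hy => simp only [map_add, add_tmul, add_mul, hx, hy]
    | tmul x y =>
      induction w with
      | zero => simp
      | add x y hx hy => simp only [map_add, tmul_add, mul_add, hx, hy]
      | tmul a b => simp [inl_mul_inr, hL]
  have hid : (LinearMap.id : DrinfeldDouble k H ⊗[k] DrinfeldDouble k H →ₗ[k] _) =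
      (of k H).toLinearMap.lTensor _ ∘ₗ (of k H).toLinearMap.rTensor _ :=
    TensorProduct.ext' fun x y => rfl
  exact (LinearMap.congr_fun hid _).trans (key ((of k H).toLinearMap.lTensor _ ∘ₗ
    (of k H).toLinearMap.rTensor _ ∘ₗ (TensorProduct.AlgebraTensorModule.tensorTensorTensorComm
      k k k k (HDual k H) (HDual k H) H H).toLinearMap) (fun _ _ _ _ => rfl) _ _)

/-- Evaluation of the two copies of `H^*` in `D(H) ⊗ D(H)`. -/
def evD (x y : H) : DrinfeldDouble k H ⊗[k] DrinfeldDouble k H →ₗ[k] H ⊗[k] H :=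
  TensorProduct.map (HDual.evT x ∘ₗ (of k H).symm.toLinearMap)
    (HDual.evT y ∘ₗ (of k H).symm.toLinearMap)

theorem evD_eq (x y : H) (z : DrinfeldDouble k H ⊗[k] DrinfeldDouble k H) : evD x y z =
    HDual.evT y (TensorProduct.leftComm k _ _ _ (HDual.evT x (TensorProduct.assoc k _ _ _
      (TensorProduct.congr (of k H).symm (of k H).symm z)))) := by
  induction z with
  | zero => simp only [LinearMap.map_zero, LinearEquiv.map_zero]
  | add u v hu hv => simp only [LinearMap.map_add, LinearEquiv.map_add, hu, hv]
  | tmul u v =>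
    simp only [evD, map_tmul, congr_tmul, LinearMap.comp_apply, LinearEquiv.coe_coe]
    generalize (of k H).symm u = u'
    generalize (of k H).symm v = v'
    induction u' with
    | zero => simp only [LinearMap.map_zero, LinearEquiv.map_zero, zero_tmul]
    | add u w hu hw => simp only [LinearMap.map_add, LinearEquiv.map_add, add_tmul, hu, hw]
    | tmul p g =>
      induction v' with
      | zero => simp only [LinearMap.map_zero, LinearEquiv.map_zero, tmul_zero]
      | add u w hu hw => simp only [LinearMap.map_add, LinearEquiv.map_add, tmul_add, hu, hw]
      | tmul q h => simp [smul_tmul', tmul_smul, smul_smul, mul_comm]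

theorem ext_evD {z w : DrinfeldDouble k H ⊗[k] DrinfeldDouble k H}
    (h : ∀ x y, evD x y z = evD x y w) : z = w := by
  refine (TensorProduct.congr (of k H).symm (of k H).symm).injective
    ((TensorProduct.assoc k _ _ _).injective (HDual.ext_evT fun x =>
      (TensorProduct.leftComm k _ _ _).injective (HDual.ext_evT fun y => ?_)))
  rw [← evD_eq, ← evD_eq, h]

theorem ext_evD_coef {z w : DrinfeldDouble k H ⊗[k] DrinfeldDouble k H}
    (h : ∀ x m n, evD x (coef k m n) z = evD x (coef k m n) w) : z = w := by
  refine ext_evD fun x y => ?_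
  rw [evD_eq, evD_eq]
  let G (z : DrinfeldDouble k H ⊗[k] DrinfeldDouble k H) : HDual k H ⊗[k] (H ⊗[k] H) :=
    TensorProduct.leftComm k _ _ _ (HDual.evT x (TensorProduct.assoc k _ _ _
      (TensorProduct.congr (of k H).symm (of k H).symm z)))
  refine eq_of_coef k (HDual.evTLin (G z)) (HDual.evTLin (G w)) (fun m n => ?_) y
  exact (evD_eq _ _ _).symm.trans ((h x m n).trans (evD_eq _ _ _))

theorem comul_compat (q : HDual k H) (h : H) : comulR h * comulL q =
    LinearMap.mul' k _ (TensorProduct.map comulL.toLinearMap comulR.toLinearMap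
      ((drinfeldTwist k H).map (h ⊗ₜ q))) := by
  refine eq_of_coef k (LinearMap.mulRight k (comulL q) ∘ₗ comulR.toLinearMap)
    (LinearMap.mul' k _ ∘ₗ TensorProduct.map comulL.toLinearMap comulR.toLinearMap ∘ₗ
      drinfeldMap k H ∘ₗ (TensorProduct.mk k _ _).flip q) (fun i j => ?_) h
  have c1 : ∀ i j, comulR (coef k i j : H) = 
      ∑ l, inr k H (coef k i l : H) ⊗ₜ[k] inr k H (coef k l j : H) := by
    intro i j
    change Algebra.TensorProduct.map (inr k H) (inr k H) (comul (coef k i j : H)) = _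
    simp [comul_coef, map_sum]
  have c2 : ∀ q : HDual k H, comulL q = Algebra.TensorProduct.map (inl k H) (inl k H) 
      (TensorProduct.comm k _ _ (comul q)) := fun q => rfl
  simp only [LinearMap.comp_apply, LinearMap.flip_apply, mk_apply, AlgHom.toLinearMap_apply,
    LinearMap.mulRight_apply, drinfeldMap_coef, map_sum, map_tmul, LinearMap.mul'_apply]
  refine ext_evD fun x y => ?_
  have e1 : ∀ (w : HDual k H ⊗[k] HDual k H) (i l j : Fin (Module.finrank k H)), 
      evD x y ((inr k H (coef k i l : H) ⊗ₜ[k] inr k H (coef k l j : H)) *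
      Algebra.TensorProduct.map (inl k H) (inl k H) (TensorProduct.comm k _ _ w)) =
      ∑ a, ∑ b, ∑ a', ∑ b', 
        HDual.evT (antipodeInv k (coef k b' j : H) * (y * coef k l a')) w
          (antipodeInv k (coef k b l : H) * (x * coef k i a)) • 
            ((coef k a b : H) ⊗ₜ[k] (coef k a' b' : H)) := by
    intro w i l j
    induction w with
    | zero => simp only [LinearMap.map_zero, LinearEquiv.map_zero, TensorProduct.tmul_zero, mul_zero, zero_mul,
        zero_smul, HDual.zero_apply, Finset.sum_const_zero, map_zero (Algebra.TensorProduct.map (inl k H) (inl k H))]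
    | add u v hu hv => simp only [LinearMap.map_add, LinearEquiv.map_add,
        map_add (Algebra.TensorProduct.map (inl k H) (inl k H)), mul_add, HDual.add_apply, add_smul,
        Finset.sum_add_distrib, hu, hv]
    | tmul u v =>
      simp only [comm_tmul, Algebra.TensorProduct.map_tmul, Algebra.TensorProduct.tmul_mul_tmul,
        inr_mul_inl, sum_tmul, tmul_sum, map_sum, HDual.evT_tmul, HDual.smul_apply]
      refine (sum_perm_3412 _).trans ?_
      refine Finset.sum_congr rfl fun a _ => Finset.sum_congr rfl fun b _ => 
        Finset.sum_congr rfl fun a' _ => Finset.sum_congr rfl fun b' _ => ?_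
      simp [evD, conj_apply, smul_tmul', tmul_smul, smul_smul, mul_comm]
  have e2 : ∀ (w : HDual k H ⊗[k] HDual k H) (a l b : Fin (Module.finrank k H)), 
      evD x y (Algebra.TensorProduct.map (inl k H) (inl k H) (TensorProduct.comm k _ _ w) *
        (inr k H (coef k a l : H) ⊗ₜ[k] inr k H (coef k l b : H))) =
        HDual.evT y w x • ((coef k a l : H) ⊗ₜ[k] (coef k l b : H)) := by
    intro w i l j
    induction w with
    | zero => simp only [LinearMap.map_zero, LinearEquiv.map_zero, TensorProduct.tmul_zero, mul_zero, zero_mul,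
        zero_smul, HDual.zero_apply, Finset.sum_const_zero, map_zero (Algebra.TensorProduct.map (inl k H) (inl k H))]
    | add u v hu hv => simp only [LinearMap.map_add, LinearEquiv.map_add,
        map_add (Algebra.TensorProduct.map (inl k H) (inl k H)), add_mul, HDual.add_apply, add_smul, hu, hv]
    | tmul u v =>
      simp [inl_mul_inr, evD, smul_tmul', tmul_smul, smul_smul]
  have e3 : ∀ (b' j a' b i a : Fin (Module.finrank k H)), 
    ∑ l, q (antipodeInv k (coef k b' j : H) * (y * coef k l a') *
      (antipodeInv k (coef k b l : H) * (x * coef k i a))) = if b = a' then 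
      q (antipodeInv k (coef k b' j : H) * (y * x * coef k i a)) else 0 := by
    intro b' j a' b i a
    have := congrArg (fun z => q (antipodeInv k (coef k b' j : H) * y * z * (x * coef k i a)))
      (sum_coef_antipodeInv (k := k) (H := H) b a')
    simp only [Finset.mul_sum, Finset.sum_mul, map_sum] at this
    simp only [mul_assoc] at this ⊢
    rw [this]
    split_ifs <;> simp
  simp only [c1, c2, Finset.sum_mul, Finset.mul_sum, map_sum, e1, e2, HDual.evT_evT_comul,
    conj_apply]
  rw [Finset.sum_comm]
  refine Finset.sum_congr rfl fun a _ => ?_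
  rw [Finset.sum_comm]
  refine Eq.trans ?_ Finset.sum_comm
  refine Finset.sum_congr rfl fun b _ => ?_
  rw [Finset.sum_comm]
  refine (Finset.sum_congr rfl fun a' _ => Finset.sum_comm).trans ?_
  simp only [← Finset.sum_smul, e3, ite_smul, zero_smul]
  rw [Finset.sum_comm]
  simp

/-- The comultiplication as an algebra map. -/
def comulHom : DrinfeldDouble k H →ₐ[k] DrinfeldDouble k H ⊗[k] DrinfeldDouble k H :=
  (drinfeldTwist k H).lift comulL comulR fun q h => comul_compat q h

theorem comulHom_apply (x : DrinfeldDouble k H) : comulHom x = comul (R := k) x := by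
  refine LinearMap.congr_fun (f := (comulHom (k := k) (H := H)).toLinearMap)
    (g := comul (R := k)) ?_ x
  refine (drinfeldTwist k H).ext_linear fun p h => ?_
  rw [TwistingMap.inl_mul_inr]
  exact ((drinfeldTwist k H).lift_of _ _ (fun q h => comul_compat q h) p h).trans (comul_of p h).symm

theorem counit_compat (q : HDual k H) (h : H) :
    Bialgebra.counitAlgHom k H h * Bialgebra.counitAlgHom k (HDual k H) q =
    LinearMap.mul' k _ (TensorProduct.map (Bialgebra.counitAlgHom k (HDual k H)).toLinearMap
      (Bialgebra.counitAlgHom k H).toLinearMap ((drinfeldTwist k H).map (h ⊗ₜ q))) := by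
  refine eq_of_coef k (LinearMap.mulRight k (counit (R := k) q) ∘ₗ counit (R := k) (A := H))
    (LinearMap.mul' k _ ∘ₗ TensorProduct.map (counit (R := k)) (counit (R := k)) ∘ₗ
      drinfeldMap k H ∘ₗ (TensorProduct.mk k _ _).flip q) (fun i j => ?_) h
  have e : ∑ a, ∑ b, q (antipodeInv k (coef k b j : H) * coef k i a) *
      (if a = b then 1 else 0) = if i = j then q 1 else 0 := by
    have := congrArg q (sum_antipodeInv_coef (k := k) (H := H) i j)
    rw [map_sum] at this
    simpa [apply_ite] using this
  simp only [LinearMap.comp_apply, LinearMap.flip_apply, mk_apply, LinearMap.mulRight_apply,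
    drinfeldMap_coef]
  rw [map_sum, map_sum]
  simp only [map_sum, map_tmul, LinearMap.mul'_apply, counit_coef, HDual.counit_eq, conj_apply,
    one_mul, e]
  split_ifs <;> simp

/-- The counit as an algebra map. -/
def counitHom : DrinfeldDouble k H →ₐ[k] k :=
  (drinfeldTwist k H).lift (Bialgebra.counitAlgHom k (HDual k H)) (Bialgebra.counitAlgHom k H)
    fun q h => counit_compat q h

theorem counitHom_apply (x : DrinfeldDouble k H) : counitHom x = counit (R := k) x := by
  refine LinearMap.congr_fun (f := (counitHom (k := k) (H := H)).toLinearMap)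
    (g := counit (R := k)) ?_ x
  refine (drinfeldTwist k H).ext_linear fun p h => ?_
  rw [TwistingMap.inl_mul_inr]
  refine ((drinfeldTwist k H).lift_of _ _ (fun q h => counit_compat q h) p h).trans ?_
  first | rfl | exact mul_comm _ _

instance : Bialgebra k (DrinfeldDouble k H) :=
  Bialgebra.mk' k (DrinfeldDouble k H)
    (by rw [← counitHom_apply, map_one])
    (fun {a b} => by simp only [← counitHom_apply, map_mul])
    (by rw [← comulHom_apply, map_one])
    (fun {a b} => by simp only [← comulHom_apply, map_mul])

theorem comul_inl (p : HDual k H) : comul (R := k) (inl k H p) =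
    Algebra.TensorProduct.map (inl k H) (inl k H) (TensorProduct.comm k _ _ (comul p)) := by
  rw [← comulHom_apply]
  exact (drinfeldTwist k H).lift_inl _ _ _ p

theorem comul_inr (h : H) : comul (R := k) (inr k H h) =
    Algebra.TensorProduct.map (inr k H) (inr k H) (comul h) := by
  rw [← comulHom_apply]
  exact (drinfeldTwist k H).lift_inr _ _ _ h

theorem counit_inl (p : HDual k H) : counit (R := k) (inl k H p) = p 1 := by
  rw [← counitHom_apply]
  exact (drinfeldTwist k H).lift_inl _ _ _ p

theorem counit_inr (h : H) : counit (R := k) (inr k H h) = counit (R := k) h := by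
  rw [← counitHom_apply]
  exact (drinfeldTwist k H).lift_inr _ _ _ h

theorem gen_induction {P : DrinfeldDouble k H → Prop} (h0 : P 0) (hl : ∀ p, P (inl k H p))
    (hr : ∀ h, P (inr k H h)) (hadd : ∀ x y, P x → P y → P (x + y))
    (hmul : ∀ x y, P x → P y → P (x * y)) (x : DrinfeldDouble k H) : P x :=
  (drinfeldTwist k H).gen_induction (P := P) h0 hl hr hadd hmul x

end DrinfeldDouble
end DrinfeldBialgebra


section DrinfeldAction
variable (k H : Type*) [Field k] [Ring H] [HopfAlgebra k H] [Module.Finite k H]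

open HopfAlgebra

/-- The linear map `p ↦ (l ↦ l ↼ S⁻¹(p) = ⟨p, S⁻¹(l₁)⟩ l₂)`. -/
def actDualLin : HDual k H →ₗ[k] Module.End k H where
  toFun p := (TensorProduct.lid k H).toLinearMap ∘ₗ
    (HDual.toDual k H p ∘ₗ antipodeInv k).rTensor H ∘ₗ comul
  map_add' p q := by
    ext h; simp [LinearMap.add_comp, LinearMap.rTensor_add]
  map_smul' c p := by
    ext h; simp [LinearMap.smul_comp, LinearMap.rTensor_smul]

/-- The linear map `h ↦ (l ↦ h₁ l S(h₂))`. -/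
def adjLin : H →ₗ[k] Module.End k H :=
  TensorProduct.lift (LinearMap.mk₂ k (fun g h => LinearMap.mulLeft k g ∘ₗ
      LinearMap.mulRight k (antipode k h))
    (fun x y z => by ext l; simp [add_mul]) (fun c x y => by ext l; simp)
    (fun x y z => by ext l; simp [mul_add]) (fun c x y => by ext l; simp)) ∘ₗ comul

variable {k H}

theorem actDualLin_coef (p : HDual k H) (m n : Fin (Module.finrank k H)) :
    actDualLin k H p (coef k m n) =
      ∑ r, p (antipodeInv k (coef k m r : H)) • (coef k r n : H) := by
  change TensorProduct.lid k H ((HDual.toDual k H p ∘ₗ antipodeInv k).rTensor H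
    (comul (coef k m n))) = _
  rw [comul_coef]
  simp [map_sum]

theorem adjLin_coef (i j : Fin (Module.finrank k H)) (l : H) :
    adjLin k H (coef k i j) l = ∑ a, coef k i a * (l * antipode k (coef k a j : H)) := by
  simp only [adjLin, LinearMap.comp_apply, comul_coef, map_sum, lift.tmul, LinearMap.sum_apply]
  rfl

variable (k H)

/-- The action `(p ⋈ 1) · l = l ↼ S⁻¹(p) = ⟨p, S⁻¹(l₁)⟩ l₂` of `H^*` on `H`. -/
def actDual : HDual k H →ₐ[k] Module.End k H :=
  AlgHom.ofLinearMap (actDualLin k H)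
    (by
      refine ext_coef k fun i j => ?_
      rw [actDualLin_coef]
      simp [counit_coef])
    (fun p q => by
      refine ext_coef k fun i j => ?_
      have e : ∀ s, (p * q) (antipodeInv k (coef k i s : H)) =
          ∑ r, p (antipodeInv k (coef k r s : H)) * q (antipodeInv k (coef k i r : H)) := by
        intro s
        rw [HDual.mul_apply, comul_antipodeInv_coef]
        simp [map_sum]
      simp only [Module.End.mul_apply, actDualLin_coef, e, map_sum, map_smul,
        Finset.smul_sum, Finset.sum_smul, smul_smul]
      rw [Finset.sum_comm]
      exact Finset.sum_congr rfl fun _ _ => Finset.sum_congr rfl fun _ _ => by rw [mul_comm])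

/-- The adjoint action `(ε ⋈ h) · l = h₁ l S(h₂)` of `H` on itself. -/
def adj : H →ₐ[k] Module.End k H :=
  AlgHom.ofLinearMap (adjLin k H)
    (by
      ext l
      simp [adjLin, Algebra.TensorProduct.one_def])
    (fun g h => by
      refine LinearMap.ext fun l => ?_
      refine eq_of_coef k (LinearMap.applyₗ l ∘ₗ adjLin k H ∘ₗ LinearMap.mulRight k h)
        (LinearMap.applyₗ (adjLin k H h l) ∘ₗ adjLin k H) (fun i j => ?_) g
      refine eq_of_coef k (LinearMap.applyₗ l ∘ₗ adjLin k H ∘ₗ LinearMap.mulLeft k (coef k i j))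
        (adjLin k H (coef k i j) ∘ₗ LinearMap.applyₗ l ∘ₗ adjLin k H) (fun m n => ?_) h
      simp only [LinearMap.comp_apply, LinearMap.applyₗ_apply_apply, LinearMap.mulLeft_apply,
        adjLin_coef, map_sum]
      simp only [adjLin, LinearMap.comp_apply, Bialgebra.comul_mul, comul_coef,
        Finset.sum_mul_sum, Algebra.TensorProduct.tmul_mul_tmul, map_sum, lift.tmul,
        LinearMap.sum_apply, LinearMap.mk₂_apply, LinearMap.mulLeft_apply,
        LinearMap.mulRight_apply, antipode_mul_antidistrib]
      rw [Finset.sum_comm]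
      simp only [mul_assoc])

theorem act_compat (q : HDual k H) (h : H) : adj k H h * actDual k H q =
    LinearMap.mul' k _ (TensorProduct.map (actDual k H).toLinearMap (adj k H).toLinearMap
      ((drinfeldTwist k H).map (h ⊗ₜ q))) := by
  refine eq_of_coef k (LinearMap.mulRight k (actDual k H q) ∘ₗ adjLin k H)
    (LinearMap.mul' k _ ∘ₗ TensorProduct.map (actDualLin k H) (adjLin k H) ∘ₗ
      drinfeldMap k H ∘ₗ (TensorProduct.mk k _ _).flip q) (fun i j => ?_) h
  refine ext_coef k fun m n => ?_
  have e1 : ∀ (q : HDual k H) (x : H), actDualLin k H q x = TensorProduct.lid k H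
    ((HDual.toDual k H q ∘ₗ antipodeInv k).rTensor H (comul x)) := fun _ _ => rfl
  have e2 : ∀ a b, comul (R := k) (adjLin k H (coef k a b) (coef k m n) : H) =
    ∑ e, ∑ t, ∑ r, ∑ s, (coef k a s * (coef k m r * antipode k (coef k t b : H))) ⊗ₜ[k]
      (coef k s e * (coef k r n * antipode k (coef k e t : H))) := by
    intro a b
    simp only [adjLin_coef, map_sum, Bialgebra.comul_mul, comul_antipode, comul_coef, comm_tmul,
      map_tmul, Finset.sum_mul, Finset.mul_sum, Algebra.TensorProduct.tmul_mul_tmul]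

  simp only [LinearMap.comp_apply, LinearMap.flip_apply, mk_apply, LinearMap.mulRight_apply,
    drinfeldMap_coef, map_sum, map_tmul, LinearMap.mul'_apply, LinearMap.sum_apply,
    Module.End.mul_apply]
  have e3 : ∀ a b, actDualLin k H (conj k H (coef k i a) (coef k b j) q)
      (adjLin k H (coef k a b) (coef k m n)) = ∑ e, ∑ t, ∑ r, ∑ s,
       q (antipodeInv k (coef k b j) * coef k t b * antipodeInv k (coef k m r : H) * 
        (antipodeInv k (coef k a s) * coef k i a)) •
      (coef k s e * (coef k r n * antipode k (coef k e t : H))) := by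
    intro a b
    rw [e1, e2]
    simp only [map_sum, LinearMap.rTensor_tmul, lid_tmul, LinearMap.comp_apply,
      HDual.toDual_apply, conj_apply, antipodeInv_mul, antipodeInv_antipode, mul_assoc]
  have e4 : ∀ r s t, ∑ a, ∑ b, q (antipodeInv k (coef k b j) * coef k t b *
      antipodeInv k (coef k m r : H) * (antipodeInv k (coef k a s) * coef k i a)) =
      if i = s then if t = j then q (antipodeInv k (coef k m r : H)) else 0 else 0 := by
    intro r s t
    have h1 : ∀ z : H, ∑ b, q (antipodeInv k (coef k b j) * coef k t b *
        antipodeInv k (coef k m r : H) * z) =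
        if t = j then q (antipodeInv k (coef k m r : H) * z) else 0 := by
      intro z
      have := congrArg (fun w => q (w * antipodeInv k (coef k m r : H) * z))
        (sum_antipodeInv_coef (k := k) (H := H) t j)
      simp only [Finset.sum_mul, map_sum] at this
      rw [this]
      split_ifs <;> simp
    simp only [h1]
    have h4 : ∑ a, q (antipodeInv k (coef k m r : H) *
        (antipodeInv k (coef k a s) * coef k i a)) =
        if i = s then q (antipodeInv k (coef k m r : H)) else 0 := by
      have := congrArg (fun w => q (antipodeInv k (coef k m r : H) * w))
        (sum_antipodeInv_coef (k := k) (H := H) i s)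
      simp only [Finset.mul_sum, map_sum] at this
      rw [this]
      split_ifs <;> simp
    by_cases h2 : t = j
    · simp only [h2, if_true, h4]
    · simp only [h2, if_false, Finset.sum_const_zero, ite_self]
  have e5 : ∀ f : Fin (Module.finrank k H) → Fin (Module.finrank k H) →
      Fin (Module.finrank k H) → Fin (Module.finrank k H) →
      Fin (Module.finrank k H) → Fin (Module.finrank k H) → H,
      ∑ a, ∑ b, ∑ e, ∑ t, ∑ r, ∑ s, f a b e t r s = ∑ e, ∑ t, ∑ r, ∑ s, ∑ a, ∑ b, f a b e t r s := by
    intro f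
    rw [sum_perm_3412]
    refine Finset.sum_congr rfl fun e _ => Finset.sum_congr rfl fun t _ => ?_
    exact sum_perm_3412 _
  simp only [e3]
  rw [e5]
  simp only [← Finset.sum_smul, e4, ite_smul, zero_smul, Finset.sum_ite_eq, Finset.mem_univ,
    if_true]
  change adjLin k H (coef k i j) (actDualLin k H q (coef k m n)) = _
  simp only [actDualLin_coef, map_sum, map_smul, adjLin_coef, Finset.smul_sum]
  rw [Finset.sum_comm]
  refine Finset.sum_congr rfl fun e _ => ?_
  rw [Finset.sum_comm]
  refine Finset.sum_congr rfl fun r _ => ?_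
  simp

/-- The action of the Drinfeld double on `H`. -/
def drinfeldAct : DrinfeldDouble k H →ₐ[k] Module.End k H :=
  (drinfeldTwist k H).lift (actDual k H) (adj k H) (act_compat k H)

variable {k H} in
theorem drinfeldAct_inl (p : HDual k H) :
    drinfeldAct k H (DrinfeldDouble.inl k H p) = actDual k H p :=
  (drinfeldTwist k H).lift_inl _ _ (act_compat k H) p

variable {k H} in
theorem drinfeldAct_inr (h : H) : drinfeldAct k H (DrinfeldDouble.inr k H h) = adj k H h :=
  (drinfeldTwist k H).lift_inr _ _ (act_compat k H) h

/-- `H` is a `D(H)`-module algebra, with `(ε ⋈ h) · l = h₁ l S(h₂)` and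
`(p ⋈ 1) · l = l ↼ S⁻¹(p)`. -/
instance drinfeldModuleAlgebra : ModuleAlgebra k (DrinfeldDouble k H) H where
  act := drinfeldAct k H
  act_mul x a b := by
    let Φ : DrinfeldDouble k H ⊗[k] DrinfeldDouble k H →ₐ[k] Module.End k (H ⊗[k] H) :=
      (Module.endTensorEndAlgHom (R := k) (A := k) (M := H) (N := H)).comp
        (Algebra.TensorProduct.map (drinfeldAct k H) (drinfeldAct k H))
    have hΦ : ∀ z a b, LinearMap.mul' k H (TensorProduct.map
        (LinearMap.applyₗ a ∘ₗ (drinfeldAct k H).toLinearMap)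
        (LinearMap.applyₗ b ∘ₗ (drinfeldAct k H).toLinearMap) z) =
        LinearMap.mul' k H (Φ z (a ⊗ₜ b)) := by
      intro z a b
      induction z with
      | zero => simp
      | add x y hx hy => simp only [map_add, LinearMap.add_apply, hx, hy]
      | tmul x y => rfl
    rw [hΦ]
    suffices h : ∀ x, drinfeldAct k H x ∘ₗ LinearMap.mul' k H =
        LinearMap.mul' k H ∘ₗ Φ (comul x) by
      exact LinearMap.congr_fun (h x) (a ⊗ₜ b)
    clear x a b
    intro x
    refine DrinfeldDouble.gen_induction (P := fun x => drinfeldAct k H x ∘ₗ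
      LinearMap.mul' k H = LinearMap.mul' k H ∘ₗ Φ (comul (R := k) (A := DrinfeldDouble k H) x))
      ?_ (fun p => ?_) (fun h => ?_) ?_ ?_ x
    · simp
    · rw [DrinfeldDouble.comul_inl]
      refine TensorProduct.ext (ext_coef k fun i j => ext_coef k fun m n => ?_)
      have e1 : ∀ w : HDual k H ⊗[k] HDual k H, LinearMap.mul' k H
          (Φ (Algebra.TensorProduct.map (DrinfeldDouble.inl k H) (DrinfeldDouble.inl k H)
            (TensorProduct.comm k _ _ w)) (coef k i j ⊗ₜ coef k m n)) =
          ∑ r, ∑ s, HDual.evT (antipodeInv k (coef k m s : H)) w (antipodeInv k (coef k i r : H)) •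
            ((coef k r j : H) * (coef k s n : H)) := by
        intro w
        induction w with
        | zero => simp
        | add u v hu hv => simp only [map_add, LinearMap.add_apply, HDual.add_apply, add_smul,
            Finset.sum_add_distrib, hu, hv]
        | tmul u v =>
          have e2 : Φ (DrinfeldDouble.inl k H v ⊗ₜ DrinfeldDouble.inl k H u)
              (coef k i j ⊗ₜ coef k m n) =
              actDualLin k H v (coef k i j) ⊗ₜ actDualLin k H u (coef k m n) := by
            change drinfeldAct k H (DrinfeldDouble.inl k H v) (coef k i j) ⊗ₜ
              drinfeldAct k H (DrinfeldDouble.inl k H u) (coef k m n) = _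
            rw [drinfeldAct_inl, drinfeldAct_inl]; rfl
          rw [comm_tmul, Algebra.TensorProduct.map_tmul, e2]
          simp only [actDualLin_coef, LinearMap.mul'_apply, Finset.sum_mul_sum, HDual.evT_tmul,
            HDual.smul_apply, smul_mul_smul_comm]
          exact Finset.sum_congr rfl fun _ _ => Finset.sum_congr rfl fun _ _ => by
            rw [mul_comm (u _)]
      have e3 : drinfeldAct k H (DrinfeldDouble.inl k H p) = actDualLin k H p := by
        rw [drinfeldAct_inl]; rfl
      have e4 : ∀ x : H, actDualLin k H p x = TensorProduct.lid k H
        ((HDual.toDual k H p ∘ₗ antipodeInv k).rTensor H (comul x)) := fun _ => rfl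
      change drinfeldAct k H (DrinfeldDouble.inl k H p) (coef k i j * coef k m n) =
        LinearMap.mul' k H (Φ (Algebra.TensorProduct.map (DrinfeldDouble.inl k H)
          (DrinfeldDouble.inl k H) (TensorProduct.comm k _ _ (comul p)))
          (coef k i j ⊗ₜ coef k m n))
      rw [e1, e3, e4, Bialgebra.comul_mul, comul_coef, comul_coef]
      simp [Finset.sum_mul_sum, map_sum, antipodeInv_mul]
    · refine TensorProduct.ext' fun a b => ?_
      have e1 : ∀ g l : H, Φ (DrinfeldDouble.inr k H g ⊗ₜ DrinfeldDouble.inr k H l)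
          (a ⊗ₜ b) = adjLin k H g a ⊗ₜ adjLin k H l b := by
        intro g l
        change drinfeldAct k H (DrinfeldDouble.inr k H g) a ⊗ₜ
          drinfeldAct k H (DrinfeldDouble.inr k H l) b = _
        rw [drinfeldAct_inr, drinfeldAct_inr]; rfl
      rw [DrinfeldDouble.comul_inr, drinfeldAct_inr]
      refine eq_of_coef k (LinearMap.applyₗ (a * b) ∘ₗ adjLin k H) (LinearMap.mul' k H ∘ₗ
        LinearMap.applyₗ (a ⊗ₜ b) ∘ₗ Φ.toLinearMap ∘ₗ (Algebra.TensorProduct.map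
          (DrinfeldDouble.inr k H) (DrinfeldDouble.inr k H)).toLinearMap ∘ₗ comul) (fun i j => ?_) h
      simp only [LinearMap.comp_apply, LinearMap.applyₗ_apply_apply, comul_coef, map_sum,
        AlgHom.toLinearMap_apply, Algebra.TensorProduct.map_tmul, e1, adjLin_coef,
        LinearMap.mul'_apply, Finset.sum_mul_sum]
      have e2 : ∀ x y, ∑ l, coef k i x * (a * antipode k (coef k x l : H)) *
          (coef k l y * (b * antipode k (coef k y j : H))) = if x = y then
          coef k i x * (a * b * antipode k (coef k y j : H)) else 0 := by
        intro x y
        have := congrArg (fun z => coef k i x * a * z * (b * antipode k (coef k y j : H)))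
          (sum_antipode_coef (k := k) (H := H) x y)
        simp only [Finset.sum_mul, Finset.mul_sum, mul_assoc] at this ⊢
        rw [this]
        split_ifs <;> simp
      rw [Finset.sum_comm]
      refine Finset.sum_congr rfl fun x _ => ?_
      rw [Finset.sum_comm]
      simp [e2]
    · intro x y hx hy
      simp only [map_add, LinearMap.add_comp, LinearMap.comp_add, hx, hy]
    · intro x y hx hy
      rw [Bialgebra.comul_mul, map_mul, map_mul, Module.End.mul_eq_comp, Module.End.mul_eq_comp,
        LinearMap.comp_assoc, hy, ← LinearMap.comp_assoc, hx, LinearMap.comp_assoc]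
  act_one x := by
    refine DrinfeldDouble.gen_induction (P := fun x => drinfeldAct k H x 1 =
      counit (R := k) (A := DrinfeldDouble k H) x • 1) ?_ (fun p => ?_) (fun h => ?_) ?_ ?_ x
    · simp
    · rw [drinfeldAct_inl, DrinfeldDouble.counit_inl]
      change TensorProduct.lid k H ((HDual.toDual k H p ∘ₗ antipodeInv k).rTensor H (comul 1)) = _
      simp [Algebra.TensorProduct.one_def]
    · rw [drinfeldAct_inr, DrinfeldDouble.counit_inr]
      refine eq_of_coef k (LinearMap.applyₗ 1 ∘ₗ adjLin k H)
        ((LinearMap.toSpanSingleton k H 1) ∘ₗ counit (R := k)) (fun i j => ?_) h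
      simp only [LinearMap.comp_apply, LinearMap.applyₗ_apply_apply, adjLin_coef, one_mul,
        sum_coef_antipode, counit_coef, LinearMap.toSpanSingleton_apply]
      split_ifs <;> simp
    · intro x y hx hy
      simp only [map_add, LinearMap.add_apply, add_smul, hx, hy]
    · intro x y hx hy
      rw [map_mul, Module.End.mul_apply, hy, map_smul, hx, Bialgebra.counit_mul, smul_smul,
        mul_comm]

end DrinfeldAction


/-! ### Quasitriangular bialgebras and quantum commutative module algebras -/

section QuasiTriangular
variable (k K : Type*) [Field k] [Ring K] [Bialgebra k K]

/-- The map `x ⊗ y ↦ x ⊗ y ⊗ 1`. -/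
def leg₁₂ : K ⊗[k] K →ₐ[k] K ⊗[k] (K ⊗[k] K) :=
  Algebra.TensorProduct.map (AlgHom.id k K) Algebra.TensorProduct.includeLeft

/-- The map `x ⊗ y ↦ x ⊗ 1 ⊗ y`. -/
def leg₁₃ : K ⊗[k] K →ₐ[k] K ⊗[k] (K ⊗[k] K) :=
  Algebra.TensorProduct.map (AlgHom.id k K) Algebra.TensorProduct.includeRight

/-- The map `x ⊗ y ↦ 1 ⊗ x ⊗ y`. -/
def leg₂₃ : K ⊗[k] K →ₐ[k] K ⊗[k] (K ⊗[k] K) := Algebra.TensorProduct.includeRight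

/-- A quasitriangular structure on `K`: an invertible `R = R¹ ⊗ R²` in `K ⊗ K` with
`R Δ(x) = Δ^op(x) R`, `(Δ ⊗ id) R = R₁₃ R₂₃` and `(id ⊗ Δ) R = R₁₃ R₁₂`. -/
class QuasiTriangular where
  /-- the universal `R`-matrix -/
  R : K ⊗[k] K
  isUnit_R : IsUnit R
  R_mul_comul : ∀ x : K, R * comul (R := k) x = TensorProduct.comm k K K (comul (R := k) x) * R
  comul_left : TensorProduct.assoc k K K K ((comul (R := k)).rTensor K R) =
    leg₁₃ k K R * leg₂₃ k K R
  comul_right : (comul (R := k)).lTensor K R = leg₁₃ k K R * leg₁₂ k K R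

/-- A module algebra `A` over a quasitriangular bialgebra is quantum commutative if
`a b = (R² · b) (R¹ · a)`. -/
class QuantumCommutative (k K A : Type*) [Field k] [Ring K] [Bialgebra k K]
    [QuasiTriangular k K] [Ring A] [Algebra k A] [ModuleAlgebra k K A] : Prop where
  mul_eq : ∀ a b : A, a * b = LinearMap.mul' k A
    (TensorProduct.map (actOn k b) (actOn k a) (TensorProduct.comm k K K (QuasiTriangular.R)))

end QuasiTriangular

section DrinfeldQT
variable (k H : Type*) [Field k] [Ring H] [HopfAlgebra k H] [Module.Finite k H]

open DrinfeldDouble HopfAlgebra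

/-- The dual basis `p_i` of the basis `x_i = Module.finBasis k H i` of `H`. -/
def dualBasis (i : Fin (Module.finrank k H)) : HDual k H :=
  (HDual.toDual k H).symm ((Module.finBasis k H).coord i)

/-- The canonical element `∑ (ε ⋈ x_i) ⊗ (p_i ⋈ 1)` of `D(H) ⊗ D(H)`, where `(x_i, p_i)` is a dual
basis of `H`. -/
def drinfeldR : DrinfeldDouble k H ⊗[k] DrinfeldDouble k H :=
  ∑ i, inr k H (Module.finBasis k H i) ⊗ₜ[k] inl k H (dualBasis k H i)

variable {k H}

theorem sum_dualBasis {X : Type*} [AddCommGroup X] [Module k X] (F : H →ₗ[k] X) (y : H) :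
    ∑ i, dualBasis k H i y • F (Module.finBasis k H i) = F y := by
  conv_rhs => rw [← (Module.finBasis k H).sum_repr y]
  simp only [map_sum, map_smul]
  rfl

theorem sum_dualBasis₂ {X : Type*} [AddCommGroup X] [Module k X] (F : H →ₗ[k] H →ₗ[k] X)
    (y z : H) : ∑ i, ∑ j, (dualBasis k H i y * dualBasis k H j z) •
      F (Module.finBasis k H i) (Module.finBasis k H j) = F y z := by
  simp only [mul_smul, ← Finset.smul_sum, sum_dualBasis]
  exact sum_dualBasis (F.flip z) y

theorem sum_dualBasis_mul {X Y : Type*} [AddCommGroup X] [Module k X] [AddCommGroup Y]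
    [Module k Y] (F : H →ₗ[k] X) (a : Fin (Module.finrank k H) → H)
    (c d : Fin (Module.finrank k H) → k) (w : Y) :
    ∑ i, F (Module.finBasis k H i) ⊗ₜ[k]
      ((∑ l, c l * dualBasis k H i (a l) * d l) • w) = ∑ l, (c l * d l) • (F (a l) ⊗ₜ[k] w) := by
  simp only [Finset.sum_smul, tmul_sum]
  rw [Finset.sum_comm]
  refine Finset.sum_congr rfl fun l _ => ?_
  rw [← sum_dualBasis F (a l), sum_tmul, Finset.smul_sum]
  refine Finset.sum_congr rfl fun i _ => ?_
  rw [tmul_smul, ← smul_tmul', smul_smul]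
  congr 1
  ring

theorem sum_dualBasis_left {X Y : Type*} [AddCommGroup X] [Module k X] [AddCommGroup Y]
    [Module k Y] (F : H →ₗ[k] X) (a : Fin (Module.finrank k H) → H)
    (d : Fin (Module.finrank k H) → k) (w : Y) : ∑ i, F (Module.finBasis k H i) ⊗ₜ[k]
      ((∑ l, dualBasis k H i (a l) * d l) • w) = ∑ l, d l • (F (a l) ⊗ₜ[k] w) := by
  simpa using sum_dualBasis_mul F a (fun _ => 1) d w

theorem sum_dualBasis_right {X Y : Type*} [AddCommGroup X] [Module k X] [AddCommGroup Y]
    [Module k Y] (F : H →ₗ[k] X) (a : Fin (Module.finrank k H) → H)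
    (d : Fin (Module.finrank k H) → k) (w : Y) : ∑ i, F (Module.finBasis k H i) ⊗ₜ[k]
      ((∑ l, d l * dualBasis k H i (a l)) • w) = ∑ l, d l • (F (a l) ⊗ₜ[k] w) := by
  simpa using sum_dualBasis_mul F a d (fun _ => 1) w

theorem sum_dualBasis_one {X Y : Type*} [AddCommGroup X] [Module k X] [AddCommGroup Y]
    [Module k Y] (F : H →ₗ[k] X) (y : H) (w : Y) : ∑ i, F (Module.finBasis k H i) ⊗ₜ[k]
      (dualBasis k H i y • w) = F y ⊗ₜ[k] w := by
  simp only [← smul_tmul, ← sum_tmul, sum_dualBasis]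

/-- Two elements of the form `∑ F(x_i) ⊗ p_i` which agree after evaluation are equal. -/
theorem ext_evR {X : Type*} [AddCommGroup X] [Module k X] {z w : X ⊗[k] HDual k H}
    (h : ∀ m n, HDual.evT (coef k m n) (TensorProduct.comm k _ _ z) =
      HDual.evT (coef k m n) (TensorProduct.comm k _ _ w)) : z = w := by
  refine (TensorProduct.comm k _ _).injective (HDual.ext_evT fun y => ?_)
  exact eq_of_coef k (HDual.evTLin (TensorProduct.comm k _ _ z))
    (HDual.evTLin (TensorProduct.comm k _ _ w)) (fun m n => h m n) y

theorem evD_tmul (x y : H) (a b : DrinfeldDouble k H) : evD x y (a ⊗ₜ[k] b) =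
    HDual.evT x ((of k H).symm a) ⊗ₜ[k] HDual.evT y ((of k H).symm b) := rfl

theorem of_symm_inl (p : HDual k H) : (of k H).symm (inl k H p) = p ⊗ₜ 1 := rfl
theorem of_symm_inr (h : H) : (of k H).symm (inr k H h) = 1 ⊗ₜ h := rfl

theorem drinfeldR_comul_inl (q : HDual k H) : drinfeldR k H * comul (R := k) (inl k H q) =
    TensorProduct.comm k _ _ (comul (R := k) (inl k H q)) * drinfeldR k H := by
  refine ext_evD_coef fun x m n => ?_
  rw [comul_inl]
  have e1 : ∀ w : HDual k H ⊗[k] HDual k H, evD x (coef k m n) (drinfeldR k H *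
      Algebra.TensorProduct.map (inl k H) (inl k H) (TensorProduct.comm k _ _ w)) =
      ∑ r, ∑ a, ∑ b, (HDual.evT (coef k r n) w) (antipodeInv k (coef k b r : H) *
        (x * coef k m a)) • ((coef k a b : H) ⊗ₜ[k] (1 : H)) := by
    intro w
    induction w with
    | zero => simp only [LinearMap.map_zero, LinearEquiv.map_zero, TensorProduct.tmul_zero, mul_zero, zero_mul,
        zero_smul, HDual.zero_apply, Finset.sum_const_zero, map_zero (Algebra.TensorProduct.map (inl k H) (inl k H))]
    | add u v hu hv => simp only [LinearMap.map_add, LinearEquiv.map_add,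
        map_add (Algebra.TensorProduct.map (inl k H) (inl k H)), mul_add, HDual.add_apply, add_smul,
        Finset.sum_add_distrib, hu, hv]
    | tmul u v =>
      simp only [comm_tmul, Algebra.TensorProduct.map_tmul, drinfeldR, Finset.sum_mul,
        Algebra.TensorProduct.tmul_mul_tmul, map_sum, evD_tmul, ← map_mul, of_symm_inl,
        HDual.evT_tmul, HDual.mul_coef]
      refine (sum_dualBasis_left (HDual.evT x ∘ₗ (of k H).symm.toLinearMap ∘ₗ
        LinearMap.mulRight k (inl k H v) ∘ₗ (inr k H).toLinearMap) _ _ _).trans ?_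
      simp only [LinearMap.comp_apply, LinearMap.mulRight_apply, AlgHom.toLinearMap_apply,
        LinearEquiv.coe_coe, inr_mul_inl, map_sum, LinearEquiv.symm_apply_apply, HDual.evT_tmul,
        conj_apply, sum_tmul, Finset.smul_sum, HDual.smul_apply, ← smul_tmul', smul_smul]
  have e2 : ∀ w : HDual k H ⊗[k] HDual k H, evD x (coef k m n) (TensorProduct.comm k _ _
      (Algebra.TensorProduct.map (inl k H) (inl k H) (TensorProduct.comm k _ _ w)) *
      drinfeldR k H) = ∑ r, (HDual.evT x w) (coef k m r) • ((coef k r n : H) ⊗ₜ[k] (1 : H)) := by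
    intro w
    induction w with
    | zero => simp only [LinearMap.map_zero, LinearEquiv.map_zero, TensorProduct.tmul_zero, mul_zero, zero_mul,
        zero_smul, HDual.zero_apply, Finset.sum_const_zero, map_zero (Algebra.TensorProduct.map (inl k H) (inl k H))]
    | add u v hu hv => simp only [LinearMap.map_add, LinearEquiv.map_add,
        map_add (Algebra.TensorProduct.map (inl k H) (inl k H)), add_mul, HDual.add_apply, add_smul,
        Finset.sum_add_distrib, hu, hv]
    | tmul u v =>
      simp only [comm_tmul, Algebra.TensorProduct.map_tmul, drinfeldR, Finset.mul_sum,
        Algebra.TensorProduct.tmul_mul_tmul, map_sum, evD_tmul, ← map_mul, of_symm_inl,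
        HDual.evT_tmul, HDual.mul_coef, inl_mul_inr, LinearEquiv.symm_apply_apply]
      refine (sum_dualBasis_right (u x • (LinearMap.id : H →ₗ[k] H)) _ _ _).trans ?_
      refine Finset.sum_congr rfl fun r _ => ?_
      simp [← smul_tmul', smul_smul, mul_comm]
  have e3 : ∀ a b, ∑ r, q (coef k r n * (antipodeInv k (coef k b r : H) * (x * coef k m a))) =
      if b = n then q (x * coef k m a) else 0 := by
    intro a b
    have := congrArg (fun z => q (z * (x * coef k m a)))
      (sum_coef_antipodeInv (k := k) (H := H) b n)
    simp only [Finset.sum_mul, map_sum, mul_assoc] at this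
    rw [this]
    split_ifs <;> simp
  rw [e1, e2]
  simp only [HDual.evT_evT_comul]
  rw [Finset.sum_comm]
  refine Finset.sum_congr rfl fun a _ => ?_
  rw [Finset.sum_comm]
  simp only [← Finset.sum_smul, e3]
  simp

theorem drinfeldR_comul_inr (h : H) : drinfeldR k H * comul (R := k) (inr k H h) =
    TensorProduct.comm k _ _ (comul (R := k) (inr k H h)) * drinfeldR k H := by
  refine ext_evD_coef fun x m n => ?_
  rw [comul_inr]
  refine eq_of_coef k (evD x (coef k m n) ∘ₗ LinearMap.mulLeft k (drinfeldR k H) ∘ₗ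
    (Algebra.TensorProduct.map (inr k H) (inr k H)).toLinearMap ∘ₗ comul)
    (evD x (coef k m n) ∘ₗ LinearMap.mulRight k (drinfeldR k H) ∘ₗ
      (TensorProduct.comm k _ _).toLinearMap ∘ₗ
      (Algebra.TensorProduct.map (inr k H) (inr k H)).toLinearMap ∘ₗ comul)
      (fun i j => ?_) h
  simp only [LinearMap.comp_apply, LinearMap.mulLeft_apply, LinearMap.mulRight_apply,
    AlgHom.toLinearMap_apply, LinearEquiv.coe_coe, comul_coef, map_sum,
    Algebra.TensorProduct.map_tmul, comm_tmul, drinfeldR, Finset.sum_mul, Finset.mul_sum,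
    Algebra.TensorProduct.tmul_mul_tmul, inr_mul_inl, inl_mul_inr, tmul_sum, evD_tmul,
    ← map_mul, of_symm_inr, LinearEquiv.symm_apply_apply, HDual.evT_tmul, conj_apply]
  have l1 : ∀ l, ∑ t, (HDual.evT x ((1 : HDual k H) ⊗ₜ[k] (Module.finBasis k H t * coef k i l)))
      ⊗ₜ[k] (dualBasis k H t (coef k m n) • (coef k l j : H)) =
      (1 : HDual k H) x • ((coef k m n * coef k i l) ⊗ₜ[k] coef k l j) := fun l =>
    (sum_dualBasis_one ((1 : HDual k H) x • LinearMap.mulRight k (coef k i l : H))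
      (coef k m n) _).trans (by simp [smul_tmul'])
  have l2 : ∀ l a b, ∑ t, (HDual.evT x ((1 : HDual k H) ⊗ₜ[k] (coef k l j *
      Module.finBasis k H t))) ⊗ₜ[k] (dualBasis k H t (antipodeInv k (coef k b l) *
        (coef k m n * coef k i a)) • (coef k a b : H)) =
      (1 : HDual k H) x • ((coef k l j * (antipodeInv k (coef k b l) *
        (coef k m n * coef k i a))) ⊗ₜ[k] coef k a b) := fun l a b =>
    (sum_dualBasis_one ((1 : HDual k H) x • LinearMap.mulLeft k (coef k l j : H)) _ _).trans
      (by simp [smul_tmul'])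
  have e3 : ∀ a b, ∑ l, coef k l j * (antipodeInv k (coef k b l) *
        (coef k m n * coef k i a)) = if b = j then coef k m n * (coef k i a : H) else 0 := by
    intro a b
    have := congrArg (fun z => z * (coef k m n * (coef k i a : H)))
      (sum_coef_antipodeInv (k := k) (H := H) b j)
    simp only [Finset.sum_mul, mul_assoc] at this
    rw [this]
    split_ifs <;> simp
  have e5 : ∀ f : Fin (Module.finrank k H) → Fin (Module.finrank k H) →
      Fin (Module.finrank k H) → Fin (Module.finrank k H) → H ⊗[k] H,
      ∑ l, ∑ t, ∑ a, ∑ b, f l t a b = ∑ a, ∑ b, ∑ l, ∑ t, f l t a b := sum_perm_3412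
  simp only [HDual.evT_tmul] at l1 l2
  rw [e5]
  simp only [l1, l2, ← Finset.smul_sum, ← sum_tmul, e3]
  congr 1
  refine Finset.sum_congr rfl fun a _ => ?_
  simp [ite_tmul]

theorem drinfeldR_comul_left :
    TensorProduct.assoc k _ _ _ ((comul (R := k)).rTensor _ (drinfeldR k H)) =
    leg₁₃ k _ (drinfeldR k H) * leg₂₃ k _ (drinfeldR k H) := by
  let L : (H ⊗[k] H) ⊗[k] HDual k H →ₗ[k] DrinfeldDouble k H ⊗[k]
      (DrinfeldDouble k H ⊗[k] DrinfeldDouble k H) :=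
    (TensorProduct.assoc k _ _ _).toLinearMap ∘ₗ TensorProduct.map
      (TensorProduct.map (inr k H).toLinearMap (inr k H).toLinearMap) (inl k H).toLinearMap
  have e : ∑ i, comul (R := k) (Module.finBasis k H i) ⊗ₜ[k] dualBasis k H i =
      ∑ i, ∑ j, (Module.finBasis k H i ⊗ₜ[k] Module.finBasis k H j) ⊗ₜ[k]
        (dualBasis k H i * dualBasis k H j) := by
    refine ext_evR fun m n => ?_
    simp only [map_sum, comm_tmul, HDual.evT_tmul, sum_dualBasis, HDual.mul_coef, comul_coef,
      Finset.sum_smul]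
    refine Eq.trans (Finset.sum_congr rfl fun l _ =>
      (sum_dualBasis₂ (TensorProduct.mk k H H) (coef k m l) (coef k l n)).symm) ?_
    rw [Finset.sum_comm]
    refine Finset.sum_congr rfl fun i _ => ?_
    rw [Finset.sum_comm]
    rfl
  have e2 := congrArg L e
  simp only [map_sum] at e2
  refine Eq.trans ?_ (e2.trans ?_)
  · simp only [drinfeldR, map_sum, LinearMap.rTensor_tmul, comul_inr]
    refine Finset.sum_congr rfl fun i _ => ?_
    rfl
  · simp only [drinfeldR, map_sum, Finset.sum_mul_sum]
    refine Finset.sum_congr rfl fun i _ => Finset.sum_congr rfl fun j _ => ?_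
    simp [L, leg₁₃, leg₂₃]

theorem drinfeldR_comul_right :
    (comul (R := k)).lTensor _ (drinfeldR k H) =
    leg₁₃ k _ (drinfeldR k H) * leg₁₂ k _ (drinfeldR k H) := by
  let L : (H ⊗[k] HDual k H) ⊗[k] HDual k H →ₗ[k] DrinfeldDouble k H ⊗[k]
      (DrinfeldDouble k H ⊗[k] DrinfeldDouble k H) :=
    (TensorProduct.assoc k _ _ _).toLinearMap ∘ₗ TensorProduct.map
      (TensorProduct.map (inr k H).toLinearMap (inl k H).toLinearMap) (inl k H).toLinearMap
  have e : ∑ i, (TensorProduct.assoc k _ _ _).symm (Module.finBasis k H i ⊗ₜ[k]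
      (TensorProduct.comm k _ _ (comul (R := k) (dualBasis k H i)))) =
      ∑ i, ∑ j, ((Module.finBasis k H i * Module.finBasis k H j) ⊗ₜ[k] dualBasis k H j) ⊗ₜ[k]
        dualBasis k H i := by
    refine ext_evR fun m n => ext_evR fun r s => ?_
    have h1 : ∀ (x : H) (w : HDual k H ⊗[k] HDual k H), HDual.evT (coef k r s)
        (TensorProduct.comm k _ _ (HDual.evT (coef k m n) (TensorProduct.comm k _ _
          ((TensorProduct.assoc k _ _ _).symm (x ⊗ₜ[k] TensorProduct.comm k _ _ w))))) =
        HDual.evT (coef k m n) w (coef k r s) • x := by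
      intro x w
      induction w with
      | zero => simp only [LinearMap.map_zero, LinearEquiv.map_zero, zero_tmul, tmul_zero, zero_smul, zero_mul, mul_zero, LinearMap.zero_apply, HDual.zero_apply, Finset.sum_const_zero]
      | add u v hu hv => simp only [LinearMap.map_add, LinearEquiv.map_add, tmul_add, HDual.add_apply, add_smul, hu, hv]
      | tmul u v => simp [smul_smul]
    simp only [map_sum, h1, HDual.evT_evT_comul, comm_tmul, HDual.evT_tmul, map_smul]
    refine (sum_dualBasis (LinearMap.id : H →ₗ[k] H) (coef k m n * coef k r s)).trans ?_
    refine (sum_dualBasis₂ (LinearMap.mul k H) (coef k m n) (coef k r s)).symm.trans ?_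
    simp [smul_smul]
  have e2 := congrArg L e
  simp only [map_sum] at e2
  refine Eq.trans ?_ (e2.trans ?_)
  · simp only [drinfeldR, map_sum, LinearMap.lTensor_tmul, comul_inl]
    refine Finset.sum_congr rfl fun i _ => ?_
    generalize TensorProduct.comm k _ _ (comul (R := k) (dualBasis k H i)) = w
    induction w with
    | zero => simp only [LinearMap.map_zero, LinearEquiv.map_zero, TensorProduct.tmul_zero, mul_zero, zero_mul,
        zero_smul, HDual.zero_apply, Finset.sum_const_zero, map_zero (Algebra.TensorProduct.map (inl k H) (inl k H))]
    | add u v hu hv => simp only [LinearMap.map_add, LinearEquiv.map_add,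
        map_add (Algebra.TensorProduct.map (inl k H) (inl k H)), tmul_add, hu, hv]
    | tmul u v => simp [L]
  · simp only [drinfeldR, map_sum, Finset.sum_mul_sum]
    refine Finset.sum_congr rfl fun i _ => Finset.sum_congr rfl fun j _ => ?_
    simp [L, leg₁₃, leg₁₂]

theorem isUnit_drinfeldR : IsUnit (drinfeldR k H) := by
  let Q : H ⊗[k] HDual k H := ∑ i, Module.finBasis k H i ⊗ₜ[k] dualBasis k H i
  let Q' : H ⊗[k] HDual k H := ∑ i, antipode k (Module.finBasis k H i) ⊗ₜ[k] dualBasis k H i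
  have key : ∀ (F G : H →ₗ[k] H), (∀ m n, ∑ l, F (coef k m l) * G (coef k l n) =
      if m = n then 1 else 0) → (∑ i, F (Module.finBasis k H i) ⊗ₜ[k] dualBasis k H i) *
      (∑ i, G (Module.finBasis k H i) ⊗ₜ[k] dualBasis k H i) = 1 := by
    intro F G hFG
    refine ext_evR fun m n => ?_
    simp only [Finset.sum_mul_sum, Algebra.TensorProduct.tmul_mul_tmul, map_sum, comm_tmul,
      HDual.evT_tmul, HDual.mul_coef, Algebra.TensorProduct.one_def, HDual.one_apply, counit_coef,
      Finset.sum_smul]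
    have h1 : ∀ l, ∑ i, ∑ j, (dualBasis k H i (coef k m l) * dualBasis k H j (coef k l n)) •
        (F (Module.finBasis k H i) * G (Module.finBasis k H j)) =
        F (coef k m l) * G (coef k l n) := fun l =>
      sum_dualBasis₂ ((LinearMap.mul k H).compl₁₂ F G) (coef k m l) (coef k l n)
    refine Eq.trans ?_ ((Finset.sum_congr rfl fun l _ => h1 l).trans ((hFG m n).trans ?_))
    · symm
      rw [Finset.sum_comm]
      exact Finset.sum_congr rfl fun i _ => Finset.sum_comm
    · split_ifs <;> simp
  have hQ : IsUnit Q := ⟨⟨Q, Q', key LinearMap.id (antipode k) sum_coef_antipode,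
    key (antipode k) LinearMap.id sum_antipode_coef⟩, rfl⟩
  have := hQ.map (Algebra.TensorProduct.map (inr k H) (inl k H))
  simpa [Q, map_sum, drinfeldR] using this

variable (k H) in
/-- `D(H)` is quasitriangular, with `R = ∑ (ε ⋈ x_i) ⊗ (p_i ⋈ 1)`. -/
instance : QuasiTriangular k (DrinfeldDouble k H) where
  R := drinfeldR k H
  isUnit_R := isUnit_drinfeldR
  R_mul_comul x := by
    refine gen_induction (P := fun x => drinfeldR k H * comul (R := k) x =
      TensorProduct.comm k _ _ (comul (R := k) x) * drinfeldR k H) ?_ drinfeldR_comul_inl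
      drinfeldR_comul_inr ?_ ?_ x
    · simp
    · intro x y hx hy
      simp only [map_add, mul_add, add_mul, hx, hy]
    · intro x y hx hy
      have := map_mul (Algebra.TensorProduct.comm k (DrinfeldDouble k H) (DrinfeldDouble k H))
        (comul x) (comul y)
      rw [Bialgebra.comul_mul]
      refine Eq.trans ?_ (congrArg (· * drinfeldR k H) this).symm
      rw [← mul_assoc, hx, mul_assoc, hy, ← mul_assoc]; rfl
  comul_left := drinfeldR_comul_left
  comul_right := drinfeldR_comul_right

/-- `H` is a quantum commutative `D(H)`-module algebra. -/
instance : QuantumCommutative k (DrinfeldDouble k H) H where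
  mul_eq a b := by
    have h1 : LinearMap.mul' k H (TensorProduct.map (actOn k b) (actOn k a)
        (TensorProduct.comm k _ _ (drinfeldR k H))) =
        ∑ i, actDualLin k H (dualBasis k H i) b * adjLin k H (Module.finBasis k H i) a := by
      simp only [drinfeldR, map_sum, comm_tmul, map_tmul, LinearMap.mul'_apply, actOn_apply]
      refine Finset.sum_congr rfl fun i _ => ?_
      change drinfeldAct k H _ _ * drinfeldAct k H _ _ = _
      rw [drinfeldAct_inl, drinfeldAct_inr]; rfl
    refine Eq.trans ?_ h1.symm
    let f : H →ₗ[k] H := ∑ i, LinearMap.mulRight k (adjLin k H (Module.finBasis k H i) a) ∘ₗ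
      actDualLin k H (dualBasis k H i)
    have hf : ∑ i, actDualLin k H (dualBasis k H i) b * adjLin k H (Module.finBasis k H i) a =
      f b := by simp [f]
    rw [hf]
    refine eq_of_coef k (LinearMap.mulLeft k a) f (fun m n => ?_) b
    simp only [f, LinearMap.sum_apply, LinearMap.comp_apply, LinearMap.mulRight_apply,
      LinearMap.mulLeft_apply, actDualLin_coef, Finset.sum_mul]
    rw [Finset.sum_comm]
    have h2 : ∀ r, ∑ i, dualBasis k H i (antipodeInv k (coef k m r : H)) • (coef k r n : H) *
        adjLin k H (Module.finBasis k H i) a = ∑ l, coef k r n *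
          (antipodeInv k (coef k l r : H) * (a * (coef k m l : H))) := by
      intro r
      have := sum_dualBasis (k := k) (H := H) (LinearMap.mulLeft k (coef k r n : H) ∘ₗ
        LinearMap.applyₗ a ∘ₗ adjLin k H) (antipodeInv k (coef k m r : H))
      simp only [LinearMap.comp_apply, LinearMap.mulLeft_apply,
        LinearMap.applyₗ_apply_apply] at this
      simp only [smul_mul_assoc]
      rw [this]
      simp only [adjLin, LinearMap.comp_apply, comul_antipodeInv_coef, map_sum, lift.tmul,
        LinearMap.sum_apply, LinearMap.mk₂_apply, LinearMap.mulLeft_apply,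
        LinearMap.mulRight_apply, antipode_antipodeInv, Finset.mul_sum]
    have h3 : ∀ l, ∑ r, coef k r n *
          (antipodeInv k (coef k l r : H) * (a * (coef k m l : H))) =
          if l = n then a * (coef k m l : H) else 0 := by
      intro l
      have := congrArg (fun z => z * (a * (coef k m l : H)))
        (sum_coef_antipodeInv (k := k) (H := H) l n)
      simp only [Finset.sum_mul, mul_assoc] at this
      rw [this]
      split_ifs <;> simp
    simp only [h2]
    rw [Finset.sum_comm]
    simp [h3]

end DrinfeldQT


/-! ### The right action on modules over a smash product -/

section RightElt
variable (k K A : Type*) [Field k] [Ring K] [Bialgebra k K] [Module.Finite k K]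
  [Ring A] [Algebra k A] [ModuleAlgebra k K A]

open ModuleAlgebra QuasiTriangular

namespace Smash

/-- The map `a ↦ a # 1`. -/
def inl : A →ₐ[k] Smash k K A := (smashTwist k K A).inl

/-- The map `x ↦ 1 # x`. -/
def inr : K →ₐ[k] Smash k K A := (smashTwist k K A).inr

variable {k K A} in
/-- The map `x ⊗ y ↦ (x · a) # y`. -/
def actSmash (a : A) : K ⊗[k] K →ₗ[k] Smash k K A :=
  LinearMap.mul' k _ ∘ₗ TensorProduct.map ((inl k K A).toLinearMap ∘ₗ actOn k a)
    (inr k K A).toLinearMap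

variable {k K A} in
theorem actSmash_tmul (a : A) (x y : K) : actSmash a (x ⊗ₜ[k] y) =
    inl k K A (act (k := k) x a) * inr k K A y := by
  simp [actSmash, actOn_apply]

variable {k K A}

theorem inr_mul_inl (x : K) (a : A) : inr k K A x * inl k K A a =
    actSmash a (comul (R := k) x) := by
  refine ((smashTwist k K A).inr_mul_inl a x).trans ?_
  rw [TwistingMap.of_eq_sum]
  change LinearMap.mul' k _ (TensorProduct.map (inl k K A).toLinearMap (inr k K A).toLinearMap
    (smashMap k K A (x ⊗ₜ a))) = _
  rw [smashMap_tmul, actSmash]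
  generalize comul (R := k) x = z
  induction z with
  | zero => simp only [LinearMap.map_zero, LinearEquiv.map_zero, zero_tmul, tmul_zero, zero_smul, zero_mul, mul_zero, LinearMap.zero_apply, HDual.zero_apply, Finset.sum_const_zero]
  | add x y hx hy => simp only [LinearMap.map_add, LinearEquiv.map_add, hx, hy]
  | tmul x y => simp

theorem inr_coef_mul_inl (i j : Fin (Module.finrank k K)) (a : A) :
    inr k K A (coef k i j) * inl k K A a =
      ∑ l, inl k K A (act (k := k) (coef k i l : K) a) * inr k K A (coef k l j) := by
  rw [inr_mul_inl, comul_coef]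
  simp [map_sum, actSmash_tmul]

variable (k K A) in
theorem coact_compat (a : A) (x : K) :
    ((Algebra.TensorProduct.map (inr k K A) (AlgHom.id k K)).comp (Bialgebra.comulAlgHom k K)) x *
      (Algebra.TensorProduct.includeLeft.comp (inl k K A) :
        A →ₐ[k] Smash k K A ⊗[k] K) a = LinearMap.mul' k _ (TensorProduct.map
      (Algebra.TensorProduct.includeLeft.comp (inl k K A) :
        A →ₐ[k] Smash k K A ⊗[k] K).toLinearMap
      ((Algebra.TensorProduct.map (inr k K A) (AlgHom.id k K)).comp
        (Bialgebra.comulAlgHom k K)).toLinearMap ((smashTwist k K A).map (x ⊗ₜ a))) := by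
  refine eq_of_coef k (LinearMap.mulRight k (inl k K A a ⊗ₜ[k] (1 : K)) ∘ₗ
    (Algebra.TensorProduct.map (inr k K A) (AlgHom.id k K)).toLinearMap ∘ₗ comul (R := k))
    (LinearMap.mul' k _ ∘ₗ TensorProduct.map
      (Algebra.TensorProduct.includeLeft.comp (inl k K A)).toLinearMap
      ((Algebra.TensorProduct.map (inr k K A) (AlgHom.id k K)).toLinearMap ∘ₗ comul (R := k)) ∘ₗ
      smashMap k K A ∘ₗ (TensorProduct.mk k K A).flip a) (fun i j => ?_) x
  simp only [LinearMap.comp_apply, LinearMap.mulRight_apply, AlgHom.toLinearMap_apply,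
    comul_coef, map_sum, Algebra.TensorProduct.map_tmul, AlgHom.id_apply, Finset.sum_mul,
    Algebra.TensorProduct.tmul_mul_tmul, mul_one, inr_coef_mul_inl, sum_tmul,
    LinearMap.flip_apply, mk_apply, smashMap_coef, map_tmul, LinearMap.mul'_apply,
    Finset.mul_sum, AlgHom.comp_apply, Algebra.TensorProduct.includeLeft_apply, one_mul]
  rw [Finset.sum_comm]

variable (k K A) in
/-- The coaction `a # x ↦ (a # x₁) ⊗ x₂`. -/
def coact : Smash k K A →ₐ[k] Smash k K A ⊗[k] K :=
  (smashTwist k K A).lift (Algebra.TensorProduct.includeLeft.comp (inl k K A))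
    ((Algebra.TensorProduct.map (inr k K A) (AlgHom.id k K)).comp (Bialgebra.comulAlgHom k K))
    (coact_compat k K A)

theorem coact_inl (a : A) : coact k K A (inl k K A a) = inl k K A a ⊗ₜ 1 :=
  (smashTwist k K A).lift_inl _ _ (coact_compat k K A) a

theorem coact_inr (x : K) : coact k K A (inr k K A x) =
    Algebra.TensorProduct.map (inr k K A) (AlgHom.id k K) (comul x) :=
  (smashTwist k K A).lift_inr _ _ (coact_compat k K A) x

theorem coact_inr_coef (i j : Fin (Module.finrank k K)) : coact k K A (inr k K A (coef k i j)) =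
    ∑ l, inr k K A (coef k i l) ⊗ₜ[k] (coef k l j : K) := by
  rw [coact_inr, comul_coef]
  simp [map_sum]

theorem gen_induction {P : Smash k K A → Prop} (h0 : P 0) (hl : ∀ a, P (inl k K A a))
    (hr : ∀ x, P (inr k K A x)) (hadd : ∀ x y, P x → P y → P (x + y))
    (hmul : ∀ x y, P x → P y → P (x * y)) (x : Smash k K A) : P x :=
  (smashTwist k K A).gen_induction (P := P) h0 hl hr hadd hmul x


variable [QuasiTriangular k K]

variable (k K A) in
/-- The element `(R² · a) # R¹` of `A # K`, through which `a` acts from the right on an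
`A # K`-module. -/
def rightElt (a : A) : Smash k K A := actSmash a (TensorProduct.comm k K K R)

variable (k K) in
theorem exists_R : ∃ S : Finset (K × K), (R : K ⊗[k] K) = ∑ t ∈ S, t.1 ⊗ₜ[k] t.2 :=
  TensorProduct.exists_finset _

theorem rightElt_eq {S : Finset (K × K)} (hS : (R : K ⊗[k] K) = ∑ t ∈ S, t.1 ⊗ₜ[k] t.2) (a : A) :
    rightElt k K A a = ∑ t ∈ S, inl k K A (act (k := k) t.2 a) * inr k K A t.1 := by
  simp [rightElt, hS, map_sum, actSmash_tmul]

theorem comul_left_eq {S : Finset (K × K)} (hS : (R : K ⊗[k] K) = ∑ t ∈ S, t.1 ⊗ₜ[k] t.2) :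
    ∑ t ∈ S, (comul (R := k) t.1) ⊗ₜ[k] t.2 =
      ∑ s ∈ S, ∑ t ∈ S, (s.1 ⊗ₜ[k] t.1) ⊗ₜ[k] (s.2 * t.2) := by
  refine (TensorProduct.assoc k K K K).injective ?_
  have := comul_left (k := k) (K := K)
  simp only [hS, map_sum, LinearMap.rTensor_tmul, Finset.sum_mul_sum] at this
  rw [map_sum, this, map_sum]
  refine Finset.sum_congr rfl fun s _ => ?_
  rw [map_sum]
  refine Finset.sum_congr rfl fun t _ => ?_
  simp [leg₁₃, leg₂₃]

theorem comul_right_eq {S : Finset (K × K)} (hS : (R : K ⊗[k] K) = ∑ t ∈ S, t.1 ⊗ₜ[k] t.2) :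
    ∑ t ∈ S, t.1 ⊗ₜ[k] (comul (R := k) t.2) =
      ∑ s ∈ S, ∑ t ∈ S, (s.1 * t.1) ⊗ₜ[k] (t.2 ⊗ₜ[k] s.2) := by
  have := comul_right (k := k) (K := K)
  simp only [hS, map_sum, LinearMap.lTensor_tmul, Finset.sum_mul_sum] at this
  rw [this]
  refine Finset.sum_congr rfl fun s _ => ?_
  refine Finset.sum_congr rfl fun t _ => ?_
  simp [leg₁₃, leg₁₂]

theorem rightElt_one : rightElt k K A 1 = 1 := by
  obtain ⟨S, hS⟩ := exists_R k K
  let E : K ⊗[k] K →ₐ[k] K := (Algebra.TensorProduct.rid k k K).toAlgHom.comp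
    (Algebra.TensorProduct.map (AlgHom.id k K) (Bialgebra.counitAlgHom k K))
  have hE : ∀ x y : K, E (x ⊗ₜ y) = counit (R := k) y • x := fun x y => by simp [E]
  have h1 : E R * E R = E R := by
    have := congrArg ((TensorProduct.rid k K).toLinearMap ∘ₗ LinearMap.lTensor K (counit (R := k) ∘ₗ
      (TensorProduct.rid k K).toLinearMap ∘ₗ LinearMap.lTensor K (counit (R := k)))) (comul_right_eq hS)
    have h2 : ∀ t : K, counit (R := k) (TensorProduct.rid k K (LinearMap.lTensor K (counit (R := k))
        (comul (R := k) t))) = counit (R := k) t := by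
      intro t
      rw [Coalgebra.lTensor_counit_comul]; simp
    simp only [map_sum, LinearMap.comp_apply, LinearMap.lTensor_tmul, LinearEquiv.coe_coe, h2,
      rid_tmul] at this
    rw [hS]
    simp only [map_sum, hE, Finset.sum_mul_sum]
    rw [this]
    refine Finset.sum_congr rfl fun s _ => Finset.sum_congr rfl fun t _ => ?_
    simp [smul_smul, mul_comm]
  have h3 : E R = 1 := ((isUnit_R (k := k) (K := K)).map E).mul_left_cancel (by rw [h1, mul_one])
  have h4 : rightElt k K A 1 = inr k K A (E R) := by
    rw [rightElt_eq hS, hS]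
    simp only [map_sum, hE, act_one]
    simp
  rw [h4, h3, map_one]

theorem inr_mul_rightElt (i j : Fin (Module.finrank k K)) (a : A) :
    inr k K A (coef k i j) * rightElt k K A a =
      ∑ l, rightElt k K A (act (k := k) (coef k l j : K) a) * inr k K A (coef k i l) := by
  obtain ⟨S, hS⟩ := exists_R k K
  have := congrArg (actSmash a ∘ₗ (TensorProduct.comm k _ _).toLinearMap)
    (R_mul_comul (k := k) (coef k i j : K))
  simp only [hS, comul_coef, map_sum, Finset.sum_mul_sum, comm_tmul,
    Algebra.TensorProduct.tmul_mul_tmul, LinearMap.comp_apply, LinearEquiv.coe_coe, actSmash_tmul,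
    map_mul, Module.End.mul_apply] at this
  simp only [rightElt_eq hS, Finset.sum_mul, Finset.mul_sum]
  rw [Finset.sum_comm]
  simp only [mul_assoc]
  rw [this, Finset.sum_comm]
  refine Finset.sum_congr rfl fun t _ => ?_
  rw [← mul_assoc, inr_coef_mul_inl, Finset.sum_mul]
  simp only [mul_assoc]

theorem coact_rightElt {S : Finset (K × K)} (hS : (R : K ⊗[k] K) = ∑ t ∈ S, t.1 ⊗ₜ[k] t.2) (a : A) :
    coact k K A (rightElt k K A a) =
      ∑ t ∈ S, rightElt k K A (act (k := k) t.2 a) ⊗ₜ[k] t.1 := by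
  have := congrArg (LinearMap.mul' k _ ∘ₗ TensorProduct.map
    (Algebra.TensorProduct.includeLeft.toLinearMap ∘ₗ (inl k K A).toLinearMap ∘ₗ actOn k a)
    (Algebra.TensorProduct.map (inr k K A) (AlgHom.id k K)).toLinearMap ∘ₗ
    (TensorProduct.comm k _ _).toLinearMap) (comul_left_eq hS)
  simp only [map_sum, LinearMap.comp_apply, LinearEquiv.coe_coe, comm_tmul, map_tmul,
    LinearMap.mul'_apply, actOn_apply, AlgHom.toLinearMap_apply, map_mul, Module.End.mul_apply,
    Algebra.TensorProduct.map_tmul, AlgHom.id_apply, Algebra.TensorProduct.includeLeft_apply,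
    Algebra.TensorProduct.tmul_mul_tmul, one_mul] at this
  simp only [rightElt_eq hS, map_sum, map_mul, coact_inl, coact_inr, sum_tmul]
  rw [this, Finset.sum_comm]

variable [QuantumCommutative k K A]

theorem mul_eq_sum {S : Finset (K × K)} (hS : (R : K ⊗[k] K) = ∑ t ∈ S, t.1 ⊗ₜ[k] t.2)
    (a b : A) : a * b = ∑ t ∈ S, act (k := k) t.2 b * act (k := k) t.1 a := by
  rw [QuantumCommutative.mul_eq (k := k) (K := K), hS]
  simp [map_sum, actOn_apply]

theorem inl_mul_rightElt (a b : A) : inl k K A a * rightElt k K A b =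
    rightElt k K A b * inl k K A a := by
  obtain ⟨S, hS⟩ := exists_R k K
  have := congrArg (LinearMap.mul' k _ ∘ₗ TensorProduct.map ((inl k K A).toLinearMap ∘ₗ actOn k b)
    (actSmash a) ∘ₗ (TensorProduct.comm k _ _).toLinearMap) (comul_left_eq hS)
  simp only [map_sum, LinearMap.comp_apply, LinearEquiv.coe_coe, comm_tmul, map_tmul,
    LinearMap.mul'_apply, actOn_apply, actSmash_tmul, AlgHom.toLinearMap_apply, ← inr_mul_inl,
    map_mul, Module.End.mul_apply] at this
  rw [rightElt_eq hS, Finset.sum_mul]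
  simp only [mul_assoc]
  rw [this, Finset.sum_comm, Finset.mul_sum]
  refine Finset.sum_congr rfl fun t _ => ?_
  simp only [← mul_assoc, ← map_mul, ← Finset.sum_mul, ← map_sum]
  rw [← mul_eq_sum hS]

theorem rightElt_mul (a b : A) : rightElt k K A a * rightElt k K A b = rightElt k K A (b * a) := by
  obtain ⟨S, hS⟩ := exists_R k K
  have := congrArg (LinearMap.mul' k _ ∘ₗ TensorProduct.map ((inl k K A).toLinearMap ∘ₗ
    LinearMap.mul' k A ∘ₗ TensorProduct.map (actOn k b) (actOn k a)) (inr k K A).toLinearMap ∘ₗ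
    (TensorProduct.comm k _ _).toLinearMap) (comul_right_eq hS)
  simp only [map_sum, LinearMap.comp_apply, LinearEquiv.coe_coe, comm_tmul, map_tmul,
    LinearMap.mul'_apply, actOn_apply, AlgHom.toLinearMap_apply, map_mul] at this
  rw [rightElt_eq hS (b * a)]
  simp only [act_mul]
  refine Eq.trans ?_ this.symm
  conv_lhs => rw [rightElt_eq hS b, Finset.mul_sum]
  rw [Finset.sum_comm]
  refine Finset.sum_congr rfl fun t _ => ?_
  rw [← mul_assoc, ← inl_mul_rightElt, rightElt_eq hS, Finset.mul_sum, Finset.sum_mul]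
  simp only [mul_assoc]

end Smash
end RightElt


/-! ### Categories of finite-dimensional modules -/

open CategoryTheory

/-- A finite-dimensional left module over a `k`-algebra `R`, given as a finite-dimensional vector
space `V` with an algebra map `R → End(V)`. -/
structure FDMod (k : Type u) [Field k] (R : Type u) [Ring R] [Algebra k R] where
  /-- the underlying vector space -/
  V : Type u
  [addCommGroup : AddCommGroup V]
  [module : Module k V]
  [finite : Module.Finite k V]
  /-- the action of `R` -/
  ρ : R →ₐ[k] Module.End k V

namespace FDMod

section Basic
variable {k : Type u} [Field k] {R : Type u} [Ring R] [Algebra k R]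

attribute [instance] addCommGroup module finite

/-- The space of module maps. -/
def homSub (M N : FDMod k R) : Submodule k (M.V →ₗ[k] N.V) where
  carrier := {f | ∀ r m, f (M.ρ r m) = N.ρ r (f m)}
  add_mem' := fun hf hg r m => by simp [hf r m, hg r m]
  zero_mem' := fun r m => by simp
  smul_mem' := fun c f hf r m => by simp [hf r m]

/-- The category of finite-dimensional left `R`-modules. -/
instance : Category.{u} (FDMod k R) where
  Hom M N := homSub M N
  id M := ⟨LinearMap.id, fun _ _ => rfl⟩
  comp f g := ⟨g.1 ∘ₗ f.1, fun r m => by simp [f.2 r m, g.2 r]⟩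

/-- The linear map underlying a morphism. -/
def toLin {M N : FDMod k R} (f : M ⟶ N) : M.V →ₗ[k] N.V := f.1

theorem toLin_act {M N : FDMod k R} (f : M ⟶ N) (r : R) (m : M.V) :
    toLin f (M.ρ r m) = N.ρ r (toLin f m) := f.2 r m

/-- A morphism from a linear map which commutes with the actions. -/
def mkHom {M N : FDMod k R} (f : M.V →ₗ[k] N.V) (h : ∀ r m, f (M.ρ r m) = N.ρ r (f m)) : M ⟶ N :=
  ⟨f, h⟩

@[simp] theorem toLin_mkHom {M N : FDMod k R} (f : M.V →ₗ[k] N.V)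
    (h : ∀ r m, f (M.ρ r m) = N.ρ r (f m)) : toLin (mkHom f h) = f := rfl

@[simp] theorem toLin_id (M : FDMod k R) : toLin (𝟙 M) = LinearMap.id := rfl

@[simp] theorem toLin_comp {M N P : FDMod k R} (f : M ⟶ N) (g : N ⟶ P) :
    toLin (f ≫ g) = toLin g ∘ₗ toLin f := rfl

theorem hom_ext {M N : FDMod k R} {f g : M ⟶ N} (h : toLin f = toLin g) : f = g := Subtype.ext h

instance : Preadditive (FDMod k R) where
  homGroup M N := inferInstanceAs (AddCommGroup (homSub M N))
  add_comp _ _ _ f f' g := Subtype.ext (LinearMap.comp_add f.1 f'.1 g.1)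
  comp_add _ _ _ f g g' := Subtype.ext (LinearMap.add_comp f.1 g'.1 g.1)

instance : Linear k (FDMod k R) where
  homModule M N := inferInstanceAs (Module k (homSub M N))
  smul_comp _ _ _ r f g := Subtype.ext (LinearMap.comp_smul g.1 r f.1)
  comp_smul _ _ _ f r g := Subtype.ext (LinearMap.smul_comp r g.1 f.1)

/-- An isomorphism from two inverse linear maps, one of which commutes with the actions. -/
def mkIso {M N : FDMod k R} (f : M.V →ₗ[k] N.V) (g : N.V →ₗ[k] M.V)
    (h : ∀ r m, f (M.ρ r m) = N.ρ r (f m)) (h1 : ∀ m, g (f m) = m) (h2 : ∀ n, f (g n) = n) :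
    M ≅ N where
  hom := mkHom f h
  inv := mkHom g fun r n => by
    have : f (g (N.ρ r n)) = f (M.ρ r (g n)) := by rw [h2, h, h2]
    rw [← h1 (M.ρ r (g n)), ← this, h1]
  hom_inv_id := hom_ext (LinearMap.ext h1)
  inv_hom_id := hom_ext (LinearMap.ext h2)

@[simp] theorem toLin_mkIso_hom {M N : FDMod k R} (f : M.V →ₗ[k] N.V) (g : N.V →ₗ[k] M.V)
    (h h1 h2) : toLin (mkIso f g h h1 h2).hom = f := rfl

end Basic

/-! ### The tensor category of modules over a bialgebra -/

section Bialgebra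
variable {k : Type u} [Field k] {B : Type u} [Ring B] [Bialgebra k B]

section Rep
variable {V W X : Type u} [AddCommGroup V] [Module k V] [AddCommGroup W] [Module k W]
  [AddCommGroup X] [Module k X]

/-- The diagonal action `b (v ⊗ w) = b₁ v ⊗ b₂ w`. -/
def diag (ρ : B →ₐ[k] Module.End k V) (σ : B →ₐ[k] Module.End k W) :
    B →ₐ[k] Module.End k (V ⊗[k] W) :=
  (Module.endTensorEndAlgHom (R := k) (A := k) (M := V) (N := W)).comp
    ((Algebra.TensorProduct.map ρ σ).comp (Bialgebra.comulAlgHom k B))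

variable [Module.Finite k B]

theorem diag_coef (ρ : B →ₐ[k] Module.End k V) (σ : B →ₐ[k] Module.End k W)
    (i j : Fin (Module.finrank k B)) (z : V ⊗[k] W) :
    diag ρ σ (coef k i j) z = ∑ l, TensorProduct.map (ρ (coef k i l)) (σ (coef k l j)) z := by
  change (Module.endTensorEndAlgHom (R := k) (A := k) (M := V) (N := W))
    (Algebra.TensorProduct.map ρ σ (comul (coef k i j : B))) z = _
  rw [comul_coef]
  simp only [map_sum, Algebra.TensorProduct.map_tmul, LinearMap.sum_apply]
  rfl

/-- It suffices to check compatibility with the actions on matrix coefficients. -/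
theorem act_of_coef (ρ : B →ₐ[k] Module.End k V) (σ : B →ₐ[k] Module.End k W) (f : V →ₗ[k] W)
    (h : ∀ i j v, f (ρ (coef k i j) v) = σ (coef k i j) (f v)) (b : B) (v : V) :
    f (ρ b v) = σ b (f v) :=
  eq_of_coef k (f ∘ₗ LinearMap.applyₗ v ∘ₗ ρ.toLinearMap)
    (LinearMap.applyₗ (f v) ∘ₗ σ.toLinearMap) (fun i j => h i j v) b

theorem diag_map {V' W' : Type u} [AddCommGroup V'] [Module k V'] [AddCommGroup W'] [Module k W']
    {ρ : B →ₐ[k] Module.End k V} {σ : B →ₐ[k] Module.End k W}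
    {ρ' : B →ₐ[k] Module.End k V'} {σ' : B →ₐ[k] Module.End k W'} (f : V →ₗ[k] V')
    (g : W →ₗ[k] W') (hf : ∀ b v, f (ρ b v) = ρ' b (f v)) (hg : ∀ b v, g (σ b v) = σ' b (g v))
    (b : B) (z : V ⊗[k] W) :
    TensorProduct.map f g (diag ρ σ b z) = diag ρ' σ' b (TensorProduct.map f g z) := by
  refine act_of_coef _ _ _ (fun i j z => ?_) b z
  rw [diag_coef, diag_coef, map_sum]
  refine Finset.sum_congr rfl fun l _ => ?_
  induction z with
  | zero => simp only [LinearMap.map_zero, LinearEquiv.map_zero, zero_tmul, tmul_zero, zero_smul, zero_mul, mul_zero, LinearMap.zero_apply, HDual.zero_apply, Finset.sum_const_zero]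
  | add x y hx hy => simp only [LinearMap.map_add, LinearEquiv.map_add, hx, hy]
  | tmul x y => simp only [map_tmul, hf, hg]

theorem diag_assoc (ρ : B →ₐ[k] Module.End k V) (σ : B →ₐ[k] Module.End k W)
    (τ : B →ₐ[k] Module.End k X) (b : B) (z : (V ⊗[k] W) ⊗[k] X) :
    (TensorProduct.assoc k V W X).toLinearMap (diag (diag ρ σ) τ b z) =
      diag ρ (diag σ τ) b ((TensorProduct.assoc k V W X).toLinearMap z) := by
  refine act_of_coef _ _ _ (fun i j z => ?_) b z
  rw [diag_coef, diag_coef]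
  induction z with
  | zero => simp only [LinearMap.map_zero, LinearEquiv.map_zero, zero_tmul, tmul_zero, zero_smul, zero_mul, mul_zero, LinearMap.zero_apply, HDual.zero_apply, Finset.sum_const_zero]
  | add x y hx hy => simp only [LinearMap.map_add, LinearEquiv.map_add, Finset.sum_add_distrib, hx, hy]
  | tmul x p =>
    induction x with
    | zero => simp only [LinearMap.map_zero, LinearEquiv.map_zero, zero_tmul, tmul_zero, zero_smul, zero_mul, mul_zero, LinearMap.zero_apply, HDual.zero_apply, Finset.sum_const_zero]
    | add x y hx hy => simp only [LinearMap.map_add, LinearEquiv.map_add, add_tmul, Finset.sum_add_distrib, hx, hy]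
    | tmul m n =>
      simp only [map_tmul, diag_coef, sum_tmul, map_sum, LinearEquiv.coe_coe, assoc_tmul,
        tmul_sum]
      rw [Finset.sum_comm]

variable (k B) in
/-- The trivial action on `k`. -/
def triv : B →ₐ[k] Module.End k k := (Algebra.lmul k k).comp (Bialgebra.counitAlgHom k B)

theorem triv_apply (b : B) (c : k) : triv k B b c = counit (R := k) b * c := rfl

theorem diag_lid (ρ : B →ₐ[k] Module.End k V) (b : B) (z : k ⊗[k] V) :
    (TensorProduct.lid k V).toLinearMap (diag (triv k B) ρ b z) =
      ρ b ((TensorProduct.lid k V).toLinearMap z) := by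
  refine act_of_coef _ _ _ (fun i j z => ?_) b z
  rw [diag_coef]
  induction z with
  | zero => simp only [LinearMap.map_zero, LinearEquiv.map_zero, zero_tmul, tmul_zero, zero_smul, zero_mul, mul_zero, LinearMap.zero_apply, HDual.zero_apply, Finset.sum_const_zero]
  | add x y hx hy => simp only [LinearMap.map_add, LinearEquiv.map_add, Finset.sum_add_distrib, hx, hy]
  | tmul c m =>
    simp only [map_tmul, triv_apply, map_sum, LinearEquiv.coe_coe, counit_coef]
    simp

theorem diag_rid (ρ : B →ₐ[k] Module.End k V) (b : B) (z : V ⊗[k] k) :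
    (TensorProduct.rid k V).toLinearMap (diag ρ (triv k B) b z) =
      ρ b ((TensorProduct.rid k V).toLinearMap z) := by
  refine act_of_coef _ _ _ (fun i j z => ?_) b z
  rw [diag_coef]
  induction z with
  | zero => simp only [LinearMap.map_zero, LinearEquiv.map_zero, zero_tmul, tmul_zero, zero_smul, zero_mul, mul_zero, LinearMap.zero_apply, HDual.zero_apply, Finset.sum_const_zero]
  | add x y hx hy => simp only [LinearMap.map_add, LinearEquiv.map_add, Finset.sum_add_distrib, hx, hy]
  | tmul m c =>
    simp only [map_tmul, triv_apply, map_sum, LinearEquiv.coe_coe, counit_coef]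
    simp

end Rep

/-- The tensor product of two modules over a bialgebra, `b (m ⊗ n) = b₁ m ⊗ b₂ n`. -/
def tensor (M N : FDMod k B) : FDMod k B where
  V := M.V ⊗[k] N.V
  ρ := diag M.ρ N.ρ

/-- The trivial module `k`, on which `b` acts by `ε(b)`. -/
def unit (k : Type u) [Field k] (B : Type u) [Ring B] [Bialgebra k B] : FDMod k B where
  V := k
  ρ := triv k B

variable [Module.Finite k B]

/-- The tensor product of morphisms. -/
def tensorMap {M N M' N' : FDMod k B} (f : M ⟶ M') (g : N ⟶ N') : tensor M N ⟶ tensor M' N' :=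
  mkHom (M := tensor M N) (N := tensor M' N') (TensorProduct.map (toLin f) (toLin g))
    (diag_map _ _ (toLin_act f) (toLin_act g))

/-- The associativity isomorphism. -/
def assoc (M N P : FDMod k B) : tensor (tensor M N) P ≅ tensor M (tensor N P) :=
  mkIso (M := tensor (tensor M N) P) (N := tensor M (tensor N P))
    (TensorProduct.assoc k M.V N.V P.V).toLinearMap
    (TensorProduct.assoc k M.V N.V P.V).symm.toLinearMap
    (diag_assoc M.ρ N.ρ P.ρ)
    (TensorProduct.assoc k M.V N.V P.V).symm_apply_apply
    (TensorProduct.assoc k M.V N.V P.V).apply_symm_apply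

/-- The left unit isomorphism. -/
def lunit (M : FDMod k B) : tensor (unit k B) M ≅ M :=
  mkIso (M := tensor (unit k B) M) (N := M)
    (TensorProduct.lid k M.V).toLinearMap (TensorProduct.lid k M.V).symm.toLinearMap
    (diag_lid M.ρ)
    (TensorProduct.lid k M.V).symm_apply_apply (TensorProduct.lid k M.V).apply_symm_apply

/-- The right unit isomorphism. -/
def runit (M : FDMod k B) : tensor M (unit k B) ≅ M :=
  mkIso (M := tensor M (unit k B)) (N := M)
    (TensorProduct.rid k M.V).toLinearMap (TensorProduct.rid k M.V).symm.toLinearMap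
    (diag_rid M.ρ)
    (TensorProduct.rid k M.V).symm_apply_apply (TensorProduct.rid k M.V).apply_symm_apply

/-- The tensor category of finite-dimensional modules over a bialgebra. -/
instance : MonoidalCategoryStruct (FDMod k B) where
  tensorObj := tensor
  whiskerLeft M _ _ f := tensorMap (𝟙 M) f
  whiskerRight f N := tensorMap f (𝟙 N)
  tensorHom := tensorMap
  tensorUnit := unit k B
  associator := assoc
  leftUnitor := lunit
  rightUnitor := runit

theorem tensor_triangle (V W : Type u) [AddCommGroup V] [Module k V] [AddCommGroup W] [Module k W] :
    TensorProduct.map LinearMap.id (TensorProduct.lid k W).toLinearMap ∘ₗ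
      (TensorProduct.assoc k V k W).toLinearMap =
    TensorProduct.map (TensorProduct.rid k V).toLinearMap LinearMap.id :=
  TensorProduct.ext_threefold fun v c w => (TensorProduct.smul_tmul c v w).symm

theorem tensor_pentagon (U V W X : Type u) [AddCommGroup U] [Module k U] [AddCommGroup V]
    [Module k V] [AddCommGroup W] [Module k W] [AddCommGroup X] [Module k X] :
    (TensorProduct.map LinearMap.id (TensorProduct.assoc k V W X).toLinearMap ∘ₗ
      (TensorProduct.assoc k U (V ⊗[k] W) X).toLinearMap) ∘ₗ
      TensorProduct.map (TensorProduct.assoc k U V W).toLinearMap LinearMap.id =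
    (TensorProduct.assoc k U V (W ⊗[k] X)).toLinearMap ∘ₗ
      (TensorProduct.assoc k (U ⊗[k] V) W X).toLinearMap :=
  TensorProduct.ext_fourfold fun _ _ _ _ => rfl

instance : MonoidalCategory (FDMod k B) :=
  MonoidalCategory.ofTensorHom
    (id_tensorHom_id := fun M N => hom_ext
      (TensorProduct.map_id : TensorProduct.map (LinearMap.id : M.V →ₗ[k] M.V)
        (LinearMap.id : N.V →ₗ[k] N.V) = LinearMap.id))
    (id_tensorHom := fun _ _ _ _ => rfl)
    (tensorHom_id := fun _ _ => rfl)
    (tensorHom_comp_tensorHom := fun f g f' g' => hom_ext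
      (TensorProduct.map_comp (toLin f') (toLin g') (toLin f) (toLin g)).symm)
    (associator_naturality := fun f g h => hom_ext (TensorProduct.ext_threefold fun _ _ _ => rfl))
    (leftUnitor_naturality := fun {M N} f => hom_ext (TensorProduct.ext' fun (c : k) m =>
      (map_smul (toLin f) c m).symm))
    (rightUnitor_naturality := fun f => hom_ext (TensorProduct.ext' fun m (c : k) =>
      (map_smul (toLin f) c m).symm))
    (pentagon := fun M N P Q => hom_ext (tensor_pentagon M.V N.V P.V Q.V))
    (triangle := fun M N => hom_ext (tensor_triangle M.V N.V))

end Bialgebra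
end FDMod


/-! ### The tensor category of modules over a smash product -/

section SmashModules
variable {k K A : Type u} [Field k] [Ring K] [Bialgebra k K] [Module.Finite k K]
  [Ring A] [Algebra k A] [ModuleAlgebra k K A] [QuasiTriangular k K]

open ModuleAlgebra QuasiTriangular Smash

/-- The action induced on a quotient. -/
def descend {R V : Type u} [Ring R] [Algebra k R] [AddCommGroup V] [Module k V]
    (ρ : R →ₐ[k] Module.End k V) (U : Submodule k V) (h : ∀ r, U ≤ U.comap (ρ r)) :
    R →ₐ[k] Module.End k (V ⧸ U) :=
  AlgHom.ofLinearMap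
    { toFun := fun r => U.mapQ U (ρ r) (h r)
      map_add' := fun r s => by
        refine Submodule.linearMap_qext _ (LinearMap.ext fun v => ?_)
        simp
      map_smul' := fun c r => by
        refine Submodule.linearMap_qext _ (LinearMap.ext fun v => ?_)
        simp }
    (by
      refine Submodule.linearMap_qext _ (LinearMap.ext fun v => ?_)
      simp)
    (fun r s => by
      refine Submodule.linearMap_qext _ (LinearMap.ext fun v => ?_)
      simp)

variable {V W X : Type u} [AddCommGroup V] [Module k V] [AddCommGroup W] [Module k W]
  [AddCommGroup X] [Module k X]
variable (ρ : Smash k K A →ₐ[k] Module.End k V) (σ : Smash k K A →ₐ[k] Module.End k W)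
  (τ : Smash k K A →ₐ[k] Module.End k X)

/-- The action `(a # x) (v ⊗ w) = (a # x₁) v ⊗ (1 # x₂) w` on `V ⊗ W`. -/
def preAct : Smash k K A →ₐ[k] Module.End k (V ⊗[k] W) :=
  (Module.endTensorEndAlgHom (R := k) (A := k) (M := V) (N := W)).comp
    ((Algebra.TensorProduct.map ρ (σ.comp (inr k K A))).comp (coact k K A))

theorem preAct_inl (a : A) (v : V) (w : W) :
    preAct ρ σ (inl k K A a) (v ⊗ₜ w) = ρ (inl k K A a) v ⊗ₜ w := by
  simp only [preAct, AlgHom.comp_apply, coact_inl, Algebra.TensorProduct.map_tmul, map_one]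
  rfl

theorem preAct_inr (i j : Fin (Module.finrank k K)) (v : V) (w : W) :
    preAct ρ σ (inr k K A (coef k i j)) (v ⊗ₜ w) =
      ∑ l, ρ (inr k K A (coef k i l)) v ⊗ₜ σ (inr k K A (coef k l j)) w := by
  simp only [preAct, AlgHom.comp_apply, coact_inr_coef, Algebra.TensorProduct.map_tmul, map_sum,
    LinearMap.sum_apply]
  rfl

theorem preAct_rightElt {S : Finset (K × K)} (hS : (R : K ⊗[k] K) = ∑ t ∈ S, t.1 ⊗ₜ[k] t.2)
    (a : A) (v : V) (w : W) : preAct ρ σ (rightElt k K A a) (v ⊗ₜ w) =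
      ∑ t ∈ S, ρ (rightElt k K A (act (k := k) t.2 a)) v ⊗ₜ σ (inr k K A t.1) w := by
  simp only [preAct, AlgHom.comp_apply, coact_rightElt hS, Algebra.TensorProduct.map_tmul, map_sum,
    LinearMap.sum_apply]
  rfl

variable (k K A) in
/-- The map `a ↦ (R² · a) # R¹`. -/
def rightEltLin : A →ₗ[k] Smash k K A where
  toFun := rightElt k K A
  map_add' a b := by
    obtain ⟨S, hS⟩ := exists_R k K
    simp [rightElt_eq hS, add_mul, Finset.sum_add_distrib]
  map_smul' c a := by
    obtain ⟨S, hS⟩ := exists_R k K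
    simp [rightElt_eq hS, Finset.smul_sum]

theorem rightEltLin_apply (a : A) : rightEltLin k K A a = rightElt k K A a := rfl

/-- The subspace of `V ⊗ W` spanned by the elements `v · a ⊗ w - v ⊗ a w`, where
`v · a = ((R² · a) # R¹) v` and `a w = (a # 1) w`. -/
def bal : Submodule k (V ⊗[k] W) :=
  Submodule.span k {z | ∃ (a : A) (v : V) (w : W),
    z = ρ (rightElt k K A a) v ⊗ₜ w - v ⊗ₜ σ (inl k K A a) w}

/-- The tensor product `V ⊗_A W` of two `A # K`-modules. -/
abbrev BT : Type u := (V ⊗[k] W) ⧸ bal ρ σ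

/-- The class of `v ⊗ w` in `V ⊗_A W`. -/
def tq : V →ₗ[k] W →ₗ[k] BT ρ σ := (TensorProduct.mk k V W).compr₂ (bal ρ σ).mkQ

theorem mkQ_tmul (v : V) (w : W) : (bal ρ σ).mkQ (v ⊗ₜ w) = tq ρ σ v w := rfl

theorem tq_balanced (a : A) (v : V) (w : W) :
    tq ρ σ (ρ (rightElt k K A a) v) w = tq ρ σ v (σ (inl k K A a) w) :=
  (Submodule.Quotient.eq _).2 (Submodule.subset_span ⟨a, v, w, rfl⟩)

variable {ρ σ τ}

theorem ext_tq {Z : Type u} [AddCommGroup Z] [Module k Z] {f g : BT ρ σ →ₗ[k] Z}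
    (h : ∀ v w, f (tq ρ σ v w) = g (tq ρ σ v w)) : f = g :=
  Submodule.linearMap_qext _ (TensorProduct.ext' h)

/-- Linear maps out of `V ⊗_A W`. -/
def liftT {Z : Type u} [AddCommGroup Z] [Module k Z] (F : V →ₗ[k] W →ₗ[k] Z)
    (h : ∀ a v w, F (ρ (rightElt k K A a) v) w = F v (σ (inl k K A a) w)) : BT ρ σ →ₗ[k] Z :=
  (bal ρ σ).liftQ (TensorProduct.lift F) (Submodule.span_le.2 (by
    rintro _ ⟨a, v, w, rfl⟩
    simp [h]))

@[simp] theorem liftT_tq {Z : Type u} [AddCommGroup Z] [Module k Z] (F : V →ₗ[k] W →ₗ[k] Z)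
    (h : ∀ a v w, F (ρ (rightElt k K A a) v) w = F v (σ (inl k K A a) w)) (v : V) (w : W) :
    liftT F h (tq ρ σ v w) = F v w := rfl

theorem act_of_gen (f : V →ₗ[k] W) (hl : ∀ a v, f (ρ (inl k K A a) v) = σ (inl k K A a) (f v))
    (hr : ∀ i j v, f (ρ (inr k K A (coef k i j)) v) = σ (inr k K A (coef k i j)) (f v))
    (s : Smash k K A) (v : V) : f (ρ s v) = σ s (f v) := by
  refine Smash.gen_induction (P := fun s => ∀ v, f (ρ s v) = σ s (f v)) ?_ hl (fun x v => ?_)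
    ?_ ?_ s v
  · simp
  · exact eq_of_coef k (f ∘ₗ LinearMap.applyₗ v ∘ₗ ρ.toLinearMap ∘ₗ (inr k K A).toLinearMap)
      (LinearMap.applyₗ (f v) ∘ₗ σ.toLinearMap ∘ₗ (inr k K A).toLinearMap) (fun i j => hr i j v) x
  · intro x y hx hy v
    simp [hx, hy]
  · intro x y hx hy v
    simp [hx, hy]

variable [QuantumCommutative k K A]

theorem bal_stable (s : Smash k K A) : bal ρ σ ≤ (bal ρ σ).comap (preAct ρ σ s) := by
  refine Smash.gen_induction (P := fun s => bal ρ σ ≤ (bal ρ σ).comap (preAct ρ σ s)) ?_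
    (fun b => ?_) (fun x => ?_) ?_ ?_ s
  · intro z hz
    simp
  · refine Submodule.span_le.2 ?_
    rintro _ ⟨a, v, w, rfl⟩
    change preAct ρ σ (inl k K A b) _ ∈ bal ρ σ
    rw [map_sub, preAct_inl, preAct_inl, ← Module.End.mul_apply, ← map_mul, inl_mul_rightElt,
      map_mul, Module.End.mul_apply]
    exact Submodule.subset_span ⟨a, _, w, rfl⟩
  · refine Submodule.span_le.2 ?_
    rintro _ ⟨a, v, w, rfl⟩
    change preAct ρ σ (inr k K A x) _ ∈ bal ρ σ
    rw [map_sub, ← Submodule.Quotient.eq]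
    refine eq_of_coef k ((bal ρ σ).mkQ ∘ₗ LinearMap.applyₗ (ρ (rightElt k K A a) v ⊗ₜ[k] w) ∘ₗ
      (preAct ρ σ).toLinearMap ∘ₗ (inr k K A).toLinearMap)
      ((bal ρ σ).mkQ ∘ₗ LinearMap.applyₗ (v ⊗ₜ[k] σ (inl k K A a) w) ∘ₗ
      (preAct ρ σ).toLinearMap ∘ₗ (inr k K A).toLinearMap) (fun i j => ?_) x
    simp only [LinearMap.comp_apply, LinearMap.applyₗ_apply_apply, AlgHom.toLinearMap_apply,
      preAct_inr, map_sum, mkQ_tmul, ← Module.End.mul_apply, ← map_mul, inr_mul_rightElt,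
      inr_coef_mul_inl, LinearMap.sum_apply]
    simp only [map_mul, Module.End.mul_apply, tq_balanced]
    rw [Finset.sum_comm]
  · intro x y hx hy z hz
    change preAct ρ σ (x + y) z ∈ bal ρ σ
    rw [map_add]
    exact add_mem (hx hz) (hy hz)
  · intro x y hx hy z hz
    change preAct ρ σ (x * y) z ∈ bal ρ σ
    rw [map_mul]
    exact hx (hy hz)

variable (ρ σ τ)

/-- The action `(a # x) (v ⊗ w) = (a # x₁) v ⊗ (1 # x₂) w` on `V ⊗_A W`. -/
def actT : Smash k K A →ₐ[k] Module.End k (BT ρ σ) := descend (preAct ρ σ) (bal ρ σ) bal_stable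

theorem actT_inl (a : A) (v : V) (w : W) :
    actT ρ σ (inl k K A a) (tq ρ σ v w) = tq ρ σ (ρ (inl k K A a) v) w :=
  congrArg (bal ρ σ).mkQ (preAct_inl ρ σ a v w)

theorem actT_inr (i j : Fin (Module.finrank k K)) (v : V) (w : W) :
    actT ρ σ (inr k K A (coef k i j)) (tq ρ σ v w) =
      ∑ l, tq ρ σ (ρ (inr k K A (coef k i l)) v) (σ (inr k K A (coef k l j)) w) :=
  (congrArg (bal ρ σ).mkQ (preAct_inr ρ σ i j v w)).trans (map_sum _ _ _)

theorem actT_rightElt (a : A) (v : V) (w : W) :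
    actT ρ σ (rightElt k K A a) (tq ρ σ v w) = tq ρ σ v (σ (rightElt k K A a) w) := by
  obtain ⟨S, hS⟩ := exists_R k K
  refine (congrArg (bal ρ σ).mkQ (preAct_rightElt ρ σ hS a v w)).trans ?_
  simp only [map_sum, mkQ_tmul, tq_balanced]
  simp only [rightElt_eq hS, map_sum, map_mul, LinearMap.sum_apply, Module.End.mul_apply]

variable {ρ σ τ}

section Map
variable {V' W' : Type u} [AddCommGroup V'] [Module k V'] [AddCommGroup W'] [Module k W']
  {ρ' : Smash k K A →ₐ[k] Module.End k V'} {σ' : Smash k K A →ₐ[k] Module.End k W'}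

/-- The map `f ⊗_A g`. -/
def mapT (f : V →ₗ[k] V') (g : W →ₗ[k] W') (hf : ∀ s v, f (ρ s v) = ρ' s (f v))
    (hg : ∀ s v, g (σ s v) = σ' s (g v)) : BT ρ σ →ₗ[k] BT ρ' σ' :=
  liftT ((tq ρ' σ').compl₁₂ f g) (fun a v w => by
    simp [hf, hg, tq_balanced])

theorem mapT_tq (f : V →ₗ[k] V') (g : W →ₗ[k] W') (hf : ∀ s v, f (ρ s v) = ρ' s (f v))
    (hg : ∀ s v, g (σ s v) = σ' s (g v)) (v : V) (w : W) :
    mapT f g hf hg (tq ρ σ v w) = tq ρ' σ' (f v) (g w) := rfl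

theorem mapT_act (f : V →ₗ[k] V') (g : W →ₗ[k] W') (hf : ∀ s v, f (ρ s v) = ρ' s (f v))
    (hg : ∀ s v, g (σ s v) = σ' s (g v)) (s : Smash k K A) (z : BT ρ σ) :
    mapT f g hf hg (actT ρ σ s z) = actT ρ' σ' s (mapT f g hf hg z) := by
  refine act_of_gen _ (fun a z => ?_) (fun i j z => ?_) s z
  · refine LinearMap.congr_fun (f := mapT f g hf hg ∘ₗ actT ρ σ (inl k K A a))
      (g := actT ρ' σ' (inl k K A a) ∘ₗ mapT f g hf hg) (ext_tq fun v w => ?_) z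
    simp only [LinearMap.comp_apply, actT_inl, mapT_tq, hf]
  · refine LinearMap.congr_fun (f := mapT f g hf hg ∘ₗ actT ρ σ (inr k K A (coef k i j)))
      (g := actT ρ' σ' (inr k K A (coef k i j)) ∘ₗ mapT f g hf hg) (ext_tq fun v w => ?_) z
    simp only [LinearMap.comp_apply, actT_inr, mapT_tq, hf, hg, map_sum]

end Map

section Assoc

theorem ext_tq₃ {Z : Type u} [AddCommGroup Z] [Module k Z] {f g : BT (actT ρ σ) τ →ₗ[k] Z}
    (h : ∀ v w x, f (tq _ τ (tq ρ σ v w) x) = g (tq _ τ (tq ρ σ v w) x)) : f = g :=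
  ext_tq fun q x => LinearMap.congr_fun (f := f ∘ₗ (tq (actT ρ σ) τ).flip x)
    (g := g ∘ₗ (tq (actT ρ σ) τ).flip x) (ext_tq fun v w => h v w x) q

theorem ext_tq₃' {Z : Type u} [AddCommGroup Z] [Module k Z] {f g : BT ρ (actT σ τ) →ₗ[k] Z}
    (h : ∀ v w x, f (tq ρ _ v (tq σ τ w x)) = g (tq ρ _ v (tq σ τ w x))) : f = g :=
  ext_tq fun v q => LinearMap.congr_fun (f := f ∘ₗ (tq ρ (actT σ τ)) v)
    (g := g ∘ₗ (tq ρ (actT σ τ)) v) (ext_tq fun w x => h v w x) q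

theorem ext_tq₄ {Y : Type u} [AddCommGroup Y] [Module k Y]
    {υ : Smash k K A →ₐ[k] Module.End k Y} {Z : Type u} [AddCommGroup Z] [Module k Z]
    {f g : BT (actT (actT ρ σ) τ) υ →ₗ[k] Z}
    (h : ∀ v w x y, f (tq _ υ (tq _ τ (tq ρ σ v w) x) y) = g (tq _ υ (tq _ τ (tq ρ σ v w) x) y)) :
    f = g :=
  ext_tq fun q y => LinearMap.congr_fun (f := f ∘ₗ (tq (actT (actT ρ σ) τ) υ).flip y)
    (g := g ∘ₗ (tq (actT (actT ρ σ) τ) υ).flip y) (ext_tq₃ fun v w x => h v w x y) q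

variable (ρ σ τ)

/-- The map `v ⊗ w ↦ (x ↦ v ⊗ (w ⊗ x))`. -/
def assocAux : BT ρ σ →ₗ[k] X →ₗ[k] BT ρ (actT σ τ) :=
  liftT (LinearMap.mk₂ k (fun v w => tq ρ (actT σ τ) v ∘ₗ tq σ τ w)
      (fun v v' w => by ext; simp) (fun c v w => by ext; simp) (fun v w w' => by ext; simp)
      (fun c v w => by ext; simp))
    (fun a v w => LinearMap.ext fun x => by
      simp [tq_balanced, actT_inl])

theorem assocAux_tq (v : V) (w : W) (x : X) : assocAux ρ σ τ (tq ρ σ v w) x =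
    tq ρ _ v (tq σ τ w x) := rfl

/-- The map `(v ⊗ w) ⊗ x ↦ v ⊗ (w ⊗ x)`. -/
def assocT : BT (actT ρ σ) τ →ₗ[k] BT ρ (actT σ τ) :=
  liftT (assocAux ρ σ τ)
    (fun a q x => by
      refine LinearMap.congr_fun (f := LinearMap.flip (assocAux ρ σ τ) x ∘ₗ
        actT ρ σ (rightElt k K A a)) (g := LinearMap.flip (assocAux ρ σ τ) (τ (inl k K A a) x))
        (ext_tq fun v w => ?_) q
      simp [actT_rightElt, tq_balanced, assocAux_tq])

theorem assocT_tq (v : V) (w : W) (x : X) : assocT ρ σ τ (tq _ τ (tq ρ σ v w) x) =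
    tq ρ _ v (tq σ τ w x) := rfl

/-- The map `v ↦ (w ⊗ x ↦ (v ⊗ w) ⊗ x)`. -/
def assocInvAux : V →ₗ[k] BT σ τ →ₗ[k] BT (actT ρ σ) τ where
  toFun v := liftT (tq (actT ρ σ) τ ∘ₗ tq ρ σ v) (fun a w x => by
    simp [← actT_rightElt, tq_balanced])
  map_add' v v' := ext_tq fun w x => by simp
  map_smul' c v := ext_tq fun w x => by simp

theorem assocInvAux_tq (v : V) (w : W) (x : X) : assocInvAux ρ σ τ v (tq σ τ w x) =
    tq _ τ (tq ρ σ v w) x := rfl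

/-- The map `v ⊗ (w ⊗ x) ↦ (v ⊗ w) ⊗ x`. -/
def assocTInv : BT ρ (actT σ τ) →ₗ[k] BT (actT ρ σ) τ :=
  liftT (assocInvAux ρ σ τ) (fun a v q => by
    refine LinearMap.congr_fun (f := assocInvAux ρ σ τ (ρ (rightElt k K A a) v))
      (g := assocInvAux ρ σ τ v ∘ₗ actT σ τ (inl k K A a)) (ext_tq fun w x => ?_) q
    simp [actT_inl, tq_balanced, assocInvAux_tq])

theorem assocTInv_tq (v : V) (w : W) (x : X) : assocTInv ρ σ τ (tq ρ _ v (tq σ τ w x)) =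
    tq _ τ (tq ρ σ v w) x := rfl

theorem assocT_act (s : Smash k K A) (z : BT (actT ρ σ) τ) :
    assocT ρ σ τ (actT (actT ρ σ) τ s z) = actT ρ (actT σ τ) s (assocT ρ σ τ z) := by
  refine act_of_gen _ (fun a z => ?_) (fun i j z => ?_) s z
  · refine LinearMap.congr_fun (f := assocT ρ σ τ ∘ₗ actT (actT ρ σ) τ (inl k K A a))
      (g := actT ρ (actT σ τ) (inl k K A a) ∘ₗ assocT ρ σ τ) (ext_tq₃ fun v w x => ?_) z
    simp only [LinearMap.comp_apply, actT_inl, assocT_tq]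
  · refine LinearMap.congr_fun (f := assocT ρ σ τ ∘ₗ actT (actT ρ σ) τ (inr k K A (coef k i j)))
      (g := actT ρ (actT σ τ) (inr k K A (coef k i j)) ∘ₗ assocT ρ σ τ)
      (ext_tq₃ fun v w x => ?_) z
    simp only [LinearMap.comp_apply, actT_inr, assocT_tq, map_sum, LinearMap.sum_apply]
    rw [Finset.sum_comm]

end Assoc

section Unit
variable (k K A)

/-- The action `(a # x) · b = a (x · b)` of `A # K` on `A`. -/
def unitAct : Smash k K A →ₐ[k] Module.End k A :=
  (smashTwist k K A).lift (Algebra.lmul k A) (act (k := k) (K := K) (A := A)) (fun a x => by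
    refine eq_of_coef k (LinearMap.mulRight k (Algebra.lmul k A a) ∘ₗ
      (act (k := k) (K := K) (A := A)).toLinearMap) (LinearMap.mul' k _ ∘ₗ
      TensorProduct.map (Algebra.lmul k A).toLinearMap
        (act (k := k) (K := K) (A := A)).toLinearMap ∘ₗ smashMap k K A ∘ₗ
        (TensorProduct.mk k K A).flip a) (fun i j => ?_) x
    refine LinearMap.ext fun b => ?_
    simp only [LinearMap.comp_apply, LinearMap.flip_apply, mk_apply, smashMap_coef, map_sum,
      map_tmul, LinearMap.mul'_apply, LinearMap.sum_apply, LinearMap.mulRight_apply,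
      Module.End.mul_apply, AlgHom.toLinearMap_apply]
    exact act_mul_coef k i j a b)

variable {k K A}

theorem unitAct_inl (a b : A) : unitAct k K A (inl k K A a) b = a * b :=
  LinearMap.congr_fun ((smashTwist k K A).lift_inl _ _ _ a) b

theorem unitAct_inr (x : K) (b : A) : unitAct k K A (inr k K A x) b = act (k := k) x b :=
  LinearMap.congr_fun ((smashTwist k K A).lift_inr _ _ _ x) b

theorem unitAct_rightElt (a b : A) : unitAct k K A (rightElt k K A a) b = b * a := by
  obtain ⟨S, hS⟩ := exists_R k K
  rw [mul_eq_sum hS, rightElt_eq hS]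
  simp [map_sum, unitAct_inl, unitAct_inr]

variable (ρ)

/-- The map `a ⊗ v ↦ a v`. -/
def lunitT : BT (unitAct k K A) ρ →ₗ[k] V :=
  liftT (ρ.toLinearMap ∘ₗ (inl k K A).toLinearMap) (fun a b v => by
    simp [unitAct_rightElt])

theorem lunitT_tq (a : A) (v : V) : lunitT ρ (tq _ ρ a v) = ρ (inl k K A a) v := rfl

theorem lunitT_one (v : V) : lunitT ρ (tq (unitAct k K A) ρ 1 v) = v := by simp [lunitT_tq]

theorem lunitT_act (s : Smash k K A) (z : BT (unitAct k K A) ρ) :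
    lunitT ρ (actT (unitAct k K A) ρ s z) = ρ s (lunitT ρ z) := by
  refine act_of_gen _ (fun a z => ?_) (fun i j z => ?_) s z
  · refine LinearMap.congr_fun (f := lunitT ρ ∘ₗ actT (unitAct k K A) ρ (inl k K A a))
      (g := ρ (inl k K A a) ∘ₗ lunitT ρ) (ext_tq fun b v => ?_) z
    simp [actT_inl, lunitT_tq, unitAct_inl]
  · refine LinearMap.congr_fun
      (f := lunitT ρ ∘ₗ actT (unitAct k K A) ρ (inr k K A (coef k i j)))
      (g := ρ (inr k K A (coef k i j)) ∘ₗ lunitT ρ) (ext_tq fun b v => ?_) z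
    simp only [LinearMap.comp_apply, actT_inr, lunitT_tq, unitAct_inr, map_sum,
      ← Module.End.mul_apply, ← map_mul]
    rw [inr_coef_mul_inl, map_sum, LinearMap.sum_apply]

theorem lunitT_inv (z : BT (unitAct k K A) ρ) : tq (unitAct k K A) ρ 1 (lunitT ρ z) = z := by
  refine LinearMap.congr_fun (f := tq (unitAct k K A) ρ 1 ∘ₗ lunitT ρ) (g := LinearMap.id)
    (ext_tq fun b v => ?_) z
  simp [lunitT_tq, ← tq_balanced, unitAct_rightElt]

/-- The map `v ⊗ a ↦ v · a`. -/
def runitT : BT ρ (unitAct k K A) →ₗ[k] V :=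
  liftT (LinearMap.flip (ρ.toLinearMap ∘ₗ rightEltLin k K A)) (fun a v b => by
    simp only [LinearMap.flip_apply, LinearMap.comp_apply, AlgHom.toLinearMap_apply,
      rightEltLin_apply, ← Module.End.mul_apply, ← map_mul, rightElt_mul, unitAct_inl])

theorem runitT_tq (v : V) (a : A) : runitT ρ (tq ρ _ v a) = ρ (rightElt k K A a) v := rfl

theorem runitT_one (v : V) : runitT ρ (tq ρ (unitAct k K A) v 1) = v := by
  simp [runitT_tq, rightElt_one]

theorem runitT_act (s : Smash k K A) (z : BT ρ (unitAct k K A)) :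
    runitT ρ (actT ρ (unitAct k K A) s z) = ρ s (runitT ρ z) := by
  refine act_of_gen _ (fun a z => ?_) (fun i j z => ?_) s z
  · refine LinearMap.congr_fun (f := runitT ρ ∘ₗ actT ρ (unitAct k K A) (inl k K A a))
      (g := ρ (inl k K A a) ∘ₗ runitT ρ) (ext_tq fun v b => ?_) z
    simp only [LinearMap.comp_apply, actT_inl, runitT_tq, ← Module.End.mul_apply, ← map_mul,
      inl_mul_rightElt]
  · refine LinearMap.congr_fun
      (f := runitT ρ ∘ₗ actT ρ (unitAct k K A) (inr k K A (coef k i j)))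
      (g := ρ (inr k K A (coef k i j)) ∘ₗ runitT ρ) (ext_tq fun v b => ?_) z
    simp only [LinearMap.comp_apply, actT_inr, runitT_tq, unitAct_inr, map_sum,
      ← Module.End.mul_apply, ← map_mul]
    rw [inr_mul_rightElt, map_sum, LinearMap.sum_apply]

theorem runitT_inv (z : BT ρ (unitAct k K A)) : tq ρ (unitAct k K A) (runitT ρ z) 1 = z := by
  refine LinearMap.congr_fun (f := (tq ρ (unitAct k K A)).flip 1 ∘ₗ runitT ρ) (g := LinearMap.id)
    (ext_tq fun v b => ?_) z
  simp [runitT_tq, tq_balanced, unitAct_inl]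

end Unit

end SmashModules

namespace FDMod
section SmashCat
open CategoryTheory

variable {k K A : Type u} [Field k] [Ring K] [Bialgebra k K] [Module.Finite k K]
  [Ring A] [Algebra k A] [ModuleAlgebra k K A] [QuasiTriangular k K]
  [QuantumCommutative k K A]

/-- The tensor product `M ⊗_A N` of two `A # K`-modules. -/
def tensorT (M N : FDMod k (Smash k K A)) : FDMod k (Smash k K A) where
  V := BT M.ρ N.ρ
  ρ := actT M.ρ N.ρ

/-- The tensor product of morphisms. -/
def tensorMapT {M N M' N' : FDMod k (Smash k K A)} (f : M ⟶ M') (g : N ⟶ N') :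
    tensorT M N ⟶ tensorT M' N' :=
  mkHom (M := tensorT M N) (N := tensorT M' N')
    (mapT (toLin f) (toLin g) (toLin_act f) (toLin_act g)) (mapT_act _ _ _ _)

/-- The associativity isomorphism `(m ⊗ n) ⊗ p ↦ m ⊗ (n ⊗ p)`. -/
def assocIso (M N P : FDMod k (Smash k K A)) :
    tensorT (tensorT M N) P ≅ tensorT M (tensorT N P) :=
  mkIso (M := tensorT (tensorT M N) P) (N := tensorT M (tensorT N P))
    (assocT M.ρ N.ρ P.ρ) (assocTInv M.ρ N.ρ P.ρ) (assocT_act M.ρ N.ρ P.ρ)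
    (fun z => LinearMap.congr_fun (f := assocTInv M.ρ N.ρ P.ρ ∘ₗ assocT M.ρ N.ρ P.ρ)
      (g := LinearMap.id) (ext_tq₃ fun _ _ _ => rfl) z)
    (fun z => LinearMap.congr_fun (f := assocT M.ρ N.ρ P.ρ ∘ₗ assocTInv M.ρ N.ρ P.ρ)
      (g := LinearMap.id) (ext_tq₃' fun _ _ _ => rfl) z)

variable [Module.Finite k A]

/-- The unit object: `A` with the action `(a # x) · b = a (x · b)`. -/
def unitT (k K A : Type u) [Field k] [Ring K] [Bialgebra k K] [Module.Finite k K]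
    [Ring A] [Algebra k A] [Module.Finite k A] [ModuleAlgebra k K A] : FDMod k (Smash k K A) where
  V := A
  ρ := unitAct k K A

/-- The left unit isomorphism `a ⊗ m ↦ a m`. -/
def lunitIso (M : FDMod k (Smash k K A)) : tensorT (unitT k K A) M ≅ M :=
  mkIso (M := tensorT (unitT k K A) M) (N := M) (lunitT M.ρ) (tq (unitAct k K A) M.ρ 1)
    (lunitT_act M.ρ) (lunitT_inv M.ρ) (lunitT_one M.ρ)

/-- The right unit isomorphism `m ⊗ a ↦ m · a`. -/
def runitIso (M : FDMod k (Smash k K A)) : tensorT M (unitT k K A) ≅ M :=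
  mkIso (M := tensorT M (unitT k K A)) (N := M) (runitT M.ρ) ((tq M.ρ (unitAct k K A)).flip 1)
    (runitT_act M.ρ) (runitT_inv M.ρ) (runitT_one M.ρ)

/-- The tensor category of finite-dimensional `A # K`-modules: the tensor product is `⊗_A`. -/
instance : MonoidalCategoryStruct (FDMod k (Smash k K A)) where
  tensorObj := tensorT
  whiskerLeft M _ _ f := tensorMapT (𝟙 M) f
  whiskerRight f N := tensorMapT f (𝟙 N)
  tensorHom := tensorMapT
  tensorUnit := unitT k K A
  associator := assocIso
  leftUnitor := lunitIso
  rightUnitor := runitIso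

instance : MonoidalCategory (FDMod k (Smash k K A)) :=
  MonoidalCategory.ofTensorHom
    (id_tensorHom_id := fun M N => hom_ext (ext_tq fun _ _ => rfl))
    (id_tensorHom := fun _ _ _ _ => rfl)
    (tensorHom_id := fun _ _ => rfl)
    (tensorHom_comp_tensorHom := fun f g f' g' => hom_ext (ext_tq fun _ _ => rfl))
    (associator_naturality := fun f g h => hom_ext (ext_tq₃ fun _ _ _ => rfl))
    (leftUnitor_naturality := fun {M N} f => hom_ext (ext_tq fun (a : A) m =>
      (toLin_act f _ m).symm))
    (rightUnitor_naturality := fun f => hom_ext (ext_tq fun m (a : A) =>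
      (toLin_act f _ m).symm))
    (pentagon := fun M N P Q => hom_ext (ext_tq₄ fun _ _ _ _ => rfl))
    (triangle := fun M N => hom_ext (ext_tq₃ fun m (a : A) n => (tq_balanced M.ρ N.ρ a m n).symm))

end SmashCat
end FDMod

end HopfDouble
end

open CategoryTheory HopfDouble

/-! Put n = dim H. Both assertions are read off from one algebra, E = End(H) ⊗ H.

The Heisenberg double of H^cop acts on H by left multiplications and by the operators l ↦ ⟨p, l₁⟩
l₂. An element z of H ⊗ H^*, seen as a linear map H → H, acts as T : l ↦ z(l₁) l₂, and z(l) = T(l₁)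
S(l₂) recovers it. The action is therefore faithful, and since both sides have dimension n²,
ℋ(H^cop) ≅ End(H). It remains to compare H # D(H) with E.

The comparison map `smashTensor` is the action of H # D(H) on its unit object H, refined by keeping
the middle leg of the iterated coproduct: a goes to L_a ⊗ 1, p to (l ↦ ⟨p, S⁻¹(l₁)⟩ l₂) ⊗ 1, and h
to (l ↦ h₁ l S(h₃)) ⊗ h₂. Applying ε to the second factor gives back the action on the unit object.
Two relations make it an algebra map: the straightening rule of D(H) (`sandwich_mul_actDual`,
`doubleTensor_compat`) and the commutation rule of the smash product (`doubleTensor_mul_lmul`). Its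
image contains End(H) ⊗ 1, because the operators of the Heisenberg double are among the images of H
and H^*; it then contains 1 ⊗ h, since l ↦ S(h₁) l h₅ cancels the outer legs of the image of h₂ and
leaves the middle one. Both dimensions are n³, so the map is bijective.

Modules over E are modules over H by Morita theory: the functor is F(V) = H ⊗ V, and a module W
comes from eW, where e = ε(-)1 is a rank one idempotent of End(H). As algebras H and H^cop coincide;
the flip matters only for tensor products.

For the tensor structure, the right action of b on an H # D(H)-module becomes (y ⊗ v) · b = y b₁ ⊗
S⁻¹(b₂) v on F(V) (`smashTensor_rightElt`). In F(V) ⊗_H F(W) one has z ⊗ (y ⊗ w) = (z · y) ⊗ (1 ⊗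
w), so this space is F(V) ⊗ W = H ⊗ V ⊗ W. The point is that the identification respects the action
of h. The identity (h₁ z) · h₂ = h z (`sum_rightElt_mul_inr`), whose right-hand side is left
multiplication, reduces the action on (x ⊗ v) ⊗ (1 ⊗ w) to h₁ x S(h₄) ⊗ h₃ v ⊗ h₂ w: the legs reach
V and W in reversed order, and this is why H^cop appears.

Identities linear in h are checked on the matrix coefficients `coef k i j`, which span H and satisfy
Δ(c_ij) = ∑ c_il ⊗ c_lj. Sweedler legs become summation indices, and the antipode axioms become
Kronecker deltas. -/

noncomputable section
namespace HopfDouble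

/-! ### Mapping the Drinfeld double to `End(H) ⊗ H`. -/

section SmashDouble
variable (k H : Type*) [Field k] [Ring H] [HopfAlgebra k H] [Module.Finite k H]

open HopfAlgebra ModuleAlgebra

/-- The operator `l ↦ g l S(h)`. -/
def sandwich (g h : H) : Module.End k H :=
  LinearMap.mulLeft k g ∘ₗ LinearMap.mulRight k (antipode k h)

variable {k H} in
theorem sandwich_apply (g h l : H) : sandwich k H g h l = g * (l * antipode k h) := rfl

variable {k H} in
theorem actDual_coef (p : HDual k H) (m n : Fin (Module.finrank k H)) :
    actDual k H p (coef k m n) = ∑ r, p (antipodeInv k (coef k m r : H)) • (coef k r n : H) :=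
  actDualLin_coef p m n

variable {k H} in
theorem actDual_apply (p : HDual k H) (x : H) : actDual k H p x = TensorProduct.lid k H
    ((HDual.toDual k H p ∘ₗ antipodeInv k).rTensor H (comul x)) := rfl

-- In Sweedler form, g (q · l) S(h) = (g₁ ⇀ q ↼ S⁻¹(h₂)) · (g₂ l S(h₁)) for independent g and h.
-- This is the straightening rule of D(H) with the two outer legs separated, so that a middle leg
-- can be stored in another tensor factor. It holds because S⁻¹ of the first leg of g₂ l S(h₁) is h₂
-- S⁻¹(l₁) S⁻¹(g₂), after renumbering, and both ends cancel against the arguments of the coregular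
-- actions.
variable {k H} in
theorem sandwich_mul_actDual (i c d j : Fin (Module.finrank k H)) (q : HDual k H) :
    sandwich k H (coef k i c) (coef k d j) * actDual k H q = ∑ a, ∑ b,
      actDual k H (conj k H (coef k i a) (coef k b j) q) *
        sandwich k H (coef k a c) (coef k d b) := by
  refine ext_coef k fun m n => ?_
  have e2 : ∀ a b, comul (R := k) (sandwich k H (coef k a c) (coef k d b) (coef k m n) : H) =
    ∑ t, ∑ r, ∑ s, (coef k a s * (coef k m r * antipode k (coef k t b : H))) ⊗ₜ[k]
      (coef k s c * (coef k r n * antipode k (coef k d t : H))) := by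
    intro a b
    simp only [sandwich_apply, map_sum, Bialgebra.comul_mul, comul_antipode, comul_coef, comm_tmul,
      map_tmul, Finset.sum_mul, Finset.mul_sum, Algebra.TensorProduct.tmul_mul_tmul]
  have e3 : ∀ a b, actDual k H (conj k H (coef k i a) (coef k b j) q)
      (sandwich k H (coef k a c) (coef k d b) (coef k m n)) = ∑ t, ∑ r, ∑ s,
       q (antipodeInv k (coef k b j) * coef k t b * antipodeInv k (coef k m r : H) *
        (antipodeInv k (coef k a s) * coef k i a)) •
      (coef k s c * (coef k r n * antipode k (coef k d t : H))) := by
    intro a b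
    rw [actDual_apply, e2]
    simp only [map_sum, LinearMap.rTensor_tmul, lid_tmul, LinearMap.comp_apply,
      HDual.toDual_apply, conj_apply, antipodeInv_mul, antipodeInv_antipode, mul_assoc]
  -- Two independent cancellations of the form S⁻¹(x₂) x₁ = ε(x), one on each side of S⁻¹(l₁),
  -- carried out at once under q.
  have e4 : ∀ r s t, ∑ a, ∑ b, q (antipodeInv k (coef k b j) * coef k t b *
      antipodeInv k (coef k m r : H) * (antipodeInv k (coef k a s) * coef k i a)) =
      if t = j then if i = s then q (antipodeInv k (coef k m r : H)) else 0 else 0 := by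
    intro r s t
    have h := congrArg q (congrArg₂ (fun x y : H => x * antipodeInv k (coef k m r : H) * y)
      (sum_antipodeInv_coef (k := k) (H := H) t j) (sum_antipodeInv_coef (k := k) (H := H) i s))
    simp only [Finset.sum_mul, Finset.mul_sum, map_sum] at h
    refine h.trans ?_
    split_ifs <;> simp
  have e5 : ∀ f : Fin (Module.finrank k H) → Fin (Module.finrank k H) →
      Fin (Module.finrank k H) → Fin (Module.finrank k H) → Fin (Module.finrank k H) → H,
      ∑ a, ∑ b, ∑ t, ∑ r, ∑ s, f a b t r s = ∑ t, ∑ r, ∑ s, ∑ a, ∑ b, f a b t r s := by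
    intro f
    rw [sum_perm_3412]
    refine Finset.sum_congr rfl fun t _ => Finset.sum_congr rfl fun r _ => ?_
    refine (Finset.sum_congr rfl fun _ _ => Finset.sum_comm).trans Finset.sum_comm
  simp only [LinearMap.sum_apply, Module.End.mul_apply, e3]
  rw [e5]
  simp only [← Finset.sum_smul, e4, ite_smul, zero_smul, Finset.sum_ite_eq, Finset.sum_ite_eq',
    Finset.mem_univ, if_true, Finset.sum_const_zero, apply_ite]
  rw [Finset.sum_comm]
  simp [actDual_coef, sandwich_apply, map_sum]

/-- The algebra `End(H) ⊗ H`. -/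
def EndTensor : Type _ := Module.End k H ⊗[k] H

namespace EndTensor

instance : Ring (EndTensor k H) := inferInstanceAs (Ring (Module.End k H ⊗[k] H))
instance : Algebra k (EndTensor k H) := inferInstanceAs (Algebra k (Module.End k H ⊗[k] H))
instance : Module.Finite k (EndTensor k H) :=
  inferInstanceAs (Module.Finite k (Module.End k H ⊗[k] H))

/-- The identity map from `End(H) ⊗ H` to `EndTensor k H`. -/
def of : Module.End k H ⊗[k] H ≃ₐ[k] EndTensor k H := AlgEquiv.refl

variable {k H} in
/-- The elementary tensor `f ⊗ h`. -/
def tm : Module.End k H →ₗ[k] H →ₗ[k] EndTensor k H :=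
  (TensorProduct.mk k (Module.End k H) H).compr₂ (of k H).toLinearMap

variable {k H}

theorem of_tmul (f : Module.End k H) (h : H) : of k H (f ⊗ₜ h) = tm f h := rfl

theorem tm_mul_tm (f g : Module.End k H) (h h' : H) : tm f h * tm g h' = tm (f * g) (h * h') :=
  Algebra.TensorProduct.tmul_mul_tmul f g h h'

theorem tm_one_one : tm (1 : Module.End k H) (1 : H) = 1 := rfl

theorem sum_tm {ι : Type*} (s : Finset ι) (f : ι → Module.End k H) (h : H) :
    tm (∑ i ∈ s, f i) h = ∑ i ∈ s, tm (f i) h := by simp [map_sum]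

variable (k H) in
/-- The inclusion `f ↦ f ⊗ 1`. -/
def incl : Module.End k H →ₐ[k] EndTensor k H :=
  AlgHom.ofLinearMap (tm.flip 1) tm_one_one (fun f g => by simp [tm_mul_tm])

end EndTensor

open EndTensor

/-- The map `p ↦ (l ↦ ⟨p, S⁻¹(l₁)⟩ l₂) ⊗ 1`. -/
def dualTensor : HDual k H →ₐ[k] EndTensor k H := (incl k H).comp (actDual k H)

/-- The map `(g, h) ↦ (l ↦ g l S(h))`. -/
def sandwichLin : H →ₗ[k] H →ₗ[k] Module.End k H :=
  LinearMap.mk₂ k (sandwich k H)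
    (fun x y z => by ext l; simp [sandwich, add_mul]) (fun c x y => by ext l; simp [sandwich])
    (fun x y z => by ext l; simp [sandwich, mul_add]) (fun c x y => by ext l; simp [sandwich])

/-- The map `g ⊗ (l ⊗ h) ↦ (m ↦ g m S(h)) ⊗ l`. -/
def sandwichTensor : H ⊗[k] (H ⊗[k] H) →ₗ[k] EndTensor k H :=
  TensorProduct.lift
    { toFun := fun g => TensorProduct.lift ((tm (k := k) (H := H)).flip.compl₂ (sandwichLin k H g))
      map_add' := fun x y => TensorProduct.ext' fun a b => by simp
      map_smul' := fun c x => TensorProduct.ext' fun a b => by simp }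

variable {k H} in
theorem sandwichTensor_tmul (g l h : H) :
    sandwichTensor k H (g ⊗ₜ (l ⊗ₜ h)) = tm (sandwich k H g h) l := rfl

/-- The linear map `h ↦ (l ↦ h₁ l S(h₃)) ⊗ h₂`. -/
def adjTensorLin : H →ₗ[k] EndTensor k H :=
  sandwichTensor k H ∘ₗ (comul (R := k) (A := H)).lTensor H ∘ₗ comul

variable {k H}

theorem adjTensorLin_coef (i j : Fin (Module.finrank k H)) : adjTensorLin k H (coef k i j) =
    ∑ a, ∑ b, tm (sandwich k H (coef k i a) (coef k b j)) (coef k a b : H) := by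
  simp [adjTensorLin, comul_coef, map_sum, tmul_sum, sandwichTensor_tmul]

/-- Since S reverses products, the pair (g, h) acts multiplicatively. Combined with the
multiplicativity of Δ, this makes h ↦ (l ↦ h₁ l S(h₃)) ⊗ h₂ an algebra map. -/
theorem sandwich_mul (g g' h h' : H) :
    sandwich k H (g * g') (h * h') = sandwich k H g h * sandwich k H g' h' := by
  ext l
  simp [sandwich_apply, antipode_mul_antidistrib, mul_assoc]

variable (k H) in
/-- The map `h ↦ (l ↦ h₁ l S(h₃)) ⊗ h₂`. -/
def adjTensor : H →ₐ[k] EndTensor k H :=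
  AlgHom.ofLinearMap (adjTensorLin k H)
    (by
      have : sandwich k H 1 1 = 1 := by ext l; simp [sandwich_apply]
      simp [adjTensorLin, Algebra.TensorProduct.one_def, sandwichTensor_tmul, this, tm_one_one])
    (fun g h => by
      refine eq_of_coef k (adjTensorLin k H ∘ₗ LinearMap.mulRight k h)
        (LinearMap.mulRight k (adjTensorLin k H h) ∘ₗ adjTensorLin k H) (fun i j => ?_) g
      refine eq_of_coef k (adjTensorLin k H ∘ₗ LinearMap.mulLeft k (coef k i j))
        (LinearMap.mulLeft k (adjTensorLin k H (coef k i j)) ∘ₗ adjTensorLin k H)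
        (fun m n => ?_) h
      simp only [LinearMap.comp_apply, LinearMap.mulLeft_apply, adjTensorLin_coef]
      simp only [adjTensorLin, LinearMap.comp_apply, Bialgebra.comul_mul, comul_coef,
        Finset.sum_mul_sum, Algebra.TensorProduct.tmul_mul_tmul, map_sum,
        LinearMap.lTensor_tmul, tmul_sum, sandwichTensor_tmul, tm_mul_tm,
        LinearMap.mulRight_apply, LinearMap.mulLeft_apply, sandwich_mul])

theorem adjTensor_coef (i j : Fin (Module.finrank k H)) : adjTensor k H (coef k i j) =
    ∑ a, ∑ b, tm (sandwich k H (coef k i a) (coef k b j)) (coef k a b : H) :=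
  adjTensorLin_coef i j

theorem dualTensor_apply (p : HDual k H) : dualTensor k H p = tm (actDual k H p) 1 := rfl

-- The middle leg h₂ sits in the second tensor factor, where the image of q is 1, so only the
-- operators have to be exchanged, and that is `sandwich_mul_actDual`.
variable (k H) in
theorem doubleTensor_compat (q : HDual k H) (h : H) : adjTensor k H h * dualTensor k H q =
    LinearMap.mul' k _ (TensorProduct.map (dualTensor k H).toLinearMap
      (adjTensor k H).toLinearMap ((drinfeldTwist k H).map (h ⊗ₜ q))) := by
  refine eq_of_coef k (LinearMap.mulRight k (dualTensor k H q) ∘ₗ (adjTensor k H).toLinearMap)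
    (LinearMap.mul' k _ ∘ₗ TensorProduct.map (dualTensor k H).toLinearMap
      (adjTensor k H).toLinearMap ∘ₗ
      drinfeldMap k H ∘ₗ (TensorProduct.mk k _ _).flip q) (fun i j => ?_) h
  simp only [LinearMap.comp_apply, LinearMap.flip_apply, mk_apply, LinearMap.mulRight_apply,
    AlgHom.toLinearMap_apply, drinfeldMap_coef, map_sum, map_tmul, LinearMap.mul'_apply,
    dualTensor_apply, adjTensor_coef, Finset.sum_mul, Finset.mul_sum,
    tm_mul_tm, one_mul, mul_one, sandwich_mul_actDual, sum_tm, LinearMap.sum_apply]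
  exact sum_perm_3412 _

variable (k H) in
/-- The map `D(H) → End(H) ⊗ H` which extends `dualTensor` and `adjTensor`. -/
def doubleTensor : DrinfeldDouble k H →ₐ[k] EndTensor k H :=
  (drinfeldTwist k H).lift (dualTensor k H) (adjTensor k H) (doubleTensor_compat k H)

theorem doubleTensor_inl (p : HDual k H) :
    doubleTensor k H (DrinfeldDouble.inl k H p) = tm (actDual k H p) 1 :=
  (drinfeldTwist k H).lift_inl _ _ (doubleTensor_compat k H) p

theorem doubleTensor_inr (h : H) :
    doubleTensor k H (DrinfeldDouble.inr k H h) = adjTensor k H h :=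
  (drinfeldTwist k H).lift_inr _ _ (doubleTensor_compat k H) h

/-- The map `x ⊗ y ↦ ((x · a) · ⊗ 1) y` from `D(H) ⊗ D(H)` to `End(H) ⊗ H`. -/
def actTensor (a : H) :
    DrinfeldDouble k H ⊗[k] DrinfeldDouble k H →ₗ[k] EndTensor k H :=
  LinearMap.mul' k _ ∘ₗ TensorProduct.map
    ((incl k H).toLinearMap ∘ₗ (Algebra.lmul k H).toLinearMap ∘ₗ actOn k a)
    (doubleTensor k H).toLinearMap

theorem actTensor_tmul (a : H) (x y : DrinfeldDouble k H) : actTensor a (x ⊗ₜ[k] y) =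
    tm (Algebra.lmul k H (act (k := k) x a)) 1 * doubleTensor k H y := rfl

theorem act_inl (p : HDual k H) (a : H) :
    act (k := k) (DrinfeldDouble.inl k H p) a = actDual k H p a :=
  LinearMap.congr_fun (drinfeldAct_inl p) a

theorem act_inr (h : H) (a : H) :
    act (k := k) (DrinfeldDouble.inr k H h) a = adjLin k H h a :=
  LinearMap.congr_fun (drinfeldAct_inr h) a

theorem lmul_apply (a b : H) : Algebra.lmul k H a b = a * b := rfl

/-- The smash product relation x a = (x₁ · a) x₂, inside `End(H) ⊗ H`. It is multiplicative in x, so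
the two generating subalgebras of D(H) suffice. The element a is quantified inside the induction
because the product step changes it. -/
theorem doubleTensor_mul_lmul (x : DrinfeldDouble k H) : ∀ (a : H),
    doubleTensor k H x * tm (Algebra.lmul k H a) 1 = actTensor a (comul (R := k) x) := by
  refine DrinfeldDouble.gen_induction (P := fun x => ∀ a, doubleTensor k H x *
    tm (Algebra.lmul k H a) 1 = actTensor a (comul (R := k) (A := DrinfeldDouble k H) x))
    ?_ (fun p a => ?_) (fun h a => ?_) ?_ ?_ x
  · intro a
    simp
  · have h1 : ∀ w : HDual k H ⊗[k] HDual k H, actTensor a (Algebra.TensorProduct.map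
        (DrinfeldDouble.inl k H) (DrinfeldDouble.inl k H) w) =
        tm (LinearMap.mul' k _ (TensorProduct.map ((Algebra.lmul k H).toLinearMap ∘ₗ
          LinearMap.applyₗ a ∘ₗ (actDual k H).toLinearMap) (actDual k H).toLinearMap w)) 1 := by
      intro w
      induction w with
      | zero => simp
      | add u v hu hv => simp only [map_add, LinearMap.add_apply, hu, hv]
      | tmul u v =>
        simp [actTensor_tmul, act_inl, doubleTensor_inl, tm_mul_tm]
    rw [DrinfeldDouble.comul_inl, h1, doubleTensor_inl, tm_mul_tm,
      mul_one]
    refine congrArg (fun f => tm f (1 : H)) (LinearMap.ext fun b => ?_)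
    -- On H^* nothing happens in the second factor, so the relation is the module algebra axiom for
    -- p · (a b), read as an identity of operators in b.
    have h2 := act_mul (k := k) (DrinfeldDouble.inl k H p) a b
    rw [act_inl, DrinfeldDouble.comul_inl] at h2
    refine h2.trans ?_
    generalize TensorProduct.comm k _ _ (comul (R := k) p) = w
    induction w with
    | zero => simp
    | add u v hu hv => simp only [map_add, LinearMap.add_apply, hu, hv]
    | tmul u v => simp [act_inl]
  · rw [doubleTensor_inr, DrinfeldDouble.comul_inr]
    refine eq_of_coef k (LinearMap.mulRight k (tm (Algebra.lmul k H a) (1 : H)) ∘ₗ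
      (adjTensor k H).toLinearMap) (actTensor a ∘ₗ (Algebra.TensorProduct.map
      (DrinfeldDouble.inr k H) (DrinfeldDouble.inr k H)).toLinearMap ∘ₗ comul) (fun i j => ?_) h
    simp only [LinearMap.comp_apply, LinearMap.mulRight_apply, AlgHom.toLinearMap_apply,
      comul_coef, map_sum, Algebra.TensorProduct.map_tmul, actTensor_tmul, act_inr,
      doubleTensor_inr, adjTensor_coef, Finset.sum_mul, Finset.mul_sum,
      tm_mul_tm, one_mul, mul_one]
    -- For h in H the operators to compare are b ↦ h₁ a S(h₂) h₃ b S(h₅) and b ↦ h₁ a b S(h₃). The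
    -- factor S(h₂) h₃ collapses, and the leg in the second factor is untouched.
    have h1 : ∀ x y, ∑ l, Algebra.lmul k H (adjLin k H (coef k i l) a) *
        sandwich k H (coef k l x) (coef k y j) =
        sandwich k H (coef k i x) (coef k y j) * Algebra.lmul k H a := by
      intro x y
      ext b
      have h2 : ∀ s, ∑ l, coef k i s * (a * (antipode k (coef k s l : H) * (coef k l x * (b *
          antipode k (coef k y j : H))))) = if s = x then coef k i s * (a * (b *
          antipode k (coef k y j : H))) else 0 := by
        intro s
        have := congrArg (fun z => coef k i s * (a * (z * (b * antipode k (coef k y j : H)))))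
          (sum_antipode_coef (k := k) (H := H) s x)
        simp only [Finset.sum_mul, Finset.mul_sum, mul_assoc] at this
        rw [this]
        split_ifs <;> simp
      simp only [LinearMap.sum_apply, Module.End.mul_apply, sandwich_apply, lmul_apply,
        adjLin_coef, Finset.sum_mul, mul_assoc]
      rw [Finset.sum_comm]
      simp [h2]
    simp only [← h1, sum_tm, LinearMap.sum_apply]
    refine Eq.trans ?_ Finset.sum_comm
    exact Finset.sum_congr rfl fun _ _ => Finset.sum_comm
  · intro x y hx hy a
    simp only [map_add, add_mul, hx, hy]
  · intro x y hx hy a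
    -- For w = u ⊗ v the induction hypothesis for x is used at the element u · a, not at a.
    have h1 : ∀ w, doubleTensor k H x * actTensor a w = actTensor a (comul x * w) := by
      intro w
      induction w with
      | zero => simp
      | add u v hu hv => simp only [map_add, mul_add, hu, hv]
      | tmul u v =>
        rw [actTensor_tmul, ← mul_assoc, hx]
        generalize comul (R := k) x = z
        induction z with
        | zero => simp
        | add s t hs ht => simp only [map_add, add_mul, hs, ht]
        | tmul s t => simp [actTensor_tmul, mul_assoc]
    rw [map_mul, mul_assoc, hy, h1, Bialgebra.comul_mul]

end SmashDouble
-- The algebra map from `H # D(H)` to `End(H) ⊗ H`.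
section SmashDouble
variable (k H : Type u) [Field k] [Ring H] [HopfAlgebra k H] [Module.Finite k H]

open HopfAlgebra ModuleAlgebra EndTensor

/-- This is `doubleTensor_mul_lmul` rewritten through the twisting map x ⊗ a ↦ (x₁ · a) ⊗ x₂, in the
form required by the universal property of the smash product. -/
theorem smashTensor_compat (a : H) (x : DrinfeldDouble k H) :
    doubleTensor k H x * (incl k H).comp (Algebra.lmul k H) a = LinearMap.mul' k _
      (TensorProduct.map ((incl k H).comp (Algebra.lmul k H)).toLinearMap
        (doubleTensor k H).toLinearMap ((smashTwist k (DrinfeldDouble k H) H).map (x ⊗ₜ a))) := by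
  refine (doubleTensor_mul_lmul x a).trans ?_
  change _ = LinearMap.mul' k _ (TensorProduct.map _ _ (smashMap k (DrinfeldDouble k H) H (x ⊗ₜ a)))
  rw [smashMap_tmul]
  generalize comul (R := k) x = z
  induction z with
  | zero => simp
  | add s t hs ht => simp only [map_add, hs, ht]
  | tmul s t => rfl

/-- The algebra map `H # D(H) → End(H) ⊗ H`. -/
def smashTensor : Smash k (DrinfeldDouble k H) H →ₐ[k] EndTensor k H :=
  (smashTwist k (DrinfeldDouble k H) H).lift ((incl k H).comp (Algebra.lmul k H))
    (doubleTensor k H) (smashTensor_compat k H)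

variable {k H}

theorem smashTensor_inl (a : H) :
    smashTensor k H (Smash.inl k _ H a) = tm (Algebra.lmul k H a) 1 :=
  (smashTwist k (DrinfeldDouble k H) H).lift_inl _ _ (smashTensor_compat k H) a

theorem smashTensor_inr (x : DrinfeldDouble k H) :
    smashTensor k H (Smash.inr k _ H x) = doubleTensor k H x :=
  (smashTwist k (DrinfeldDouble k H) H).lift_inr _ _ (smashTensor_compat k H) x

theorem smashTensor_inr_inl (p : HDual k H) :
    smashTensor k H (Smash.inr k _ H (DrinfeldDouble.inl k H p)) = tm (actDual k H p) 1 := by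
  rw [smashTensor_inr, doubleTensor_inl]

theorem smashTensor_inr_inr (h : H) :
    smashTensor k H (Smash.inr k _ H (DrinfeldDouble.inr k H h)) = adjTensor k H h := by
  rw [smashTensor_inr, doubleTensor_inr]

/-! ### The Heisenberg double is a matrix algebra -/

variable (k H) in
/-- The identity map from `H` to `H^cop`. -/
def toCop : H ≃ₐ[k] Cop H := (AlgEquiv.refl : H ≃ₐ[k] H)

/-- A linear form on `H^cop` as a linear form on `H`. -/
def HDual.ofCop (p : HDual k (Cop H)) : H →ₗ[k] k :=
  HDual.toDual k (Cop H) p ∘ₗ (toCop k H).toLinearMap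

theorem HDual.ofCop_apply (p : HDual k (Cop H)) (x : H) :
    HDual.ofCop p x = p (toCop k H x) := rfl

/-- The flipped comultiplication turns b₁ ⟨p, b₂⟩ into ⟨p, b₁⟩ b₂. The coefficients are those of the
coalgebra H, not of H^cop, so that the antipode identities of H remain available. -/
theorem act_toCop (p : HDual k (Cop H)) (i j : Fin (Module.finrank k H)) :
    (toCop k H).symm (act (k := k) p (toCop k H (coef k i j))) =
      ∑ l, p (toCop k H (coef k i l)) • (coef k l j : H) := by
  change TensorProduct.rid k H ((HDual.ofCop p).lTensor H
    (TensorProduct.comm k H H (comul (R := k) (A := H) (coef k i j : H)))) = _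
  rw [comul_coef]
  simp only [map_sum, comm_tmul, LinearMap.lTensor_tmul, rid_tmul, HDual.ofCop_apply]

variable (k H) in
/-- The action of the Heisenberg double of `H^cop` on `H`. -/
def heisenbergAct : Heisenberg k (Cop H) →ₐ[k] Module.End k H :=
  ((toCop k H).symm.toLinearEquiv.conjAlgEquiv k).toAlgHom.comp
    (unitAct k (HDual k (Cop H)) (Cop H))

theorem heisenbergAct_of (a : H) (p : HDual k (Cop H)) (x : H) :
    heisenbergAct k H ((smashTwist k _ _).of (toCop k H a ⊗ₜ p)) x =
      a * (toCop k H).symm (act (k := k) p (toCop k H x)) := by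
  have h : unitAct k (HDual k (Cop H)) (Cop H) ((smashTwist k _ _).of (toCop k H a ⊗ₜ p)) =
      Algebra.lmul k _ (toCop k H a) * act (k := k) p := by
    change LinearMap.mul' k _ (TensorProduct.map (Algebra.lmul k (Cop H)).toLinearMap
      (act (k := k) (K := HDual k (Cop H)) (A := Cop H)).toLinearMap (toCop k H a ⊗ₜ p)) = _
    simp
  exact LinearMap.congr_fun h (toCop k H x)

/-- With z viewed as a linear map H → H through evaluation of its dual leg, the operator is l ↦
z(l₁) l₂. -/
theorem heisenbergAct_of_coef (z : Cop H ⊗[k] HDual k (Cop H)) (i j : Fin (Module.finrank k H)) :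
    heisenbergAct k H ((smashTwist k _ _).of z) (coef k i j) =
      ∑ l, (toCop k H).symm (HDual.evT (toCop k H (coef k i l)) (TensorProduct.comm k _ _ z)) *
        coef k l j := by
  induction z with
  | zero => simp
  | add x y hx hy =>
    simp only [map_add, LinearMap.add_apply, hx, hy, add_mul, Finset.sum_add_distrib]
  | tmul a p =>
    obtain ⟨a, rfl⟩ := (toCop k H).surjective a
    rw [heisenbergAct_of, act_toCop]
    simp [Finset.mul_sum]

/-- The operator T(l) = z(l₁) l₂ determines z, because T(l₁) S(l₂) = z(l₁) l₂ S(l₃) = z(l). -/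
theorem heisenbergAct_injective : Function.Injective (heisenbergAct k H) := by
  refine (injective_iff_map_eq_zero _).2 fun w hw => ?_
  obtain ⟨z, rfl⟩ := (smashTwist k (HDual k (Cop H)) (Cop H)).of.surjective w
  suffices h : z = 0 by rw [h, map_zero]
  refine (TensorProduct.comm k _ _).injective (HDual.ext_evT fun x => ?_)
  obtain ⟨x, rfl⟩ := (toCop k H).surjective x
  rw [map_zero, map_zero]
  refine eq_of_coef k (HDual.evTLin (TensorProduct.comm k _ _ z) ∘ₗ (toCop k H).toLinearMap) 0
    (fun i m => ?_) x
  have h1 : ∀ j, ∑ l, (toCop k H).symm (HDual.evT (toCop k H (coef k i l))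
      (TensorProduct.comm k _ _ z)) * coef k l j = 0 := fun j => by
    rw [← heisenbergAct_of_coef, hw]; rfl
  -- This is T(l₁) S(l₂) with T = 0. Exchanging the sums makes l₂ S(l₃) collapse and leaves the
  -- value of z at the coefficient.
  have h2 : ∑ j, (∑ l, (toCop k H).symm (HDual.evT (toCop k H (coef k i l))
      (TensorProduct.comm k _ _ z)) * coef k l j) * antipode k (coef k j m : H) = 0 := by
    simp [h1]
  simp only [Finset.sum_mul, mul_assoc] at h2
  rw [Finset.sum_comm] at h2
  simp only [← Finset.mul_sum, sum_coef_antipode, mul_ite, mul_one, mul_zero,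
    Finset.sum_ite_eq', Finset.mem_univ, if_true] at h2
  exact (toCop k H).symm.injective (h2.trans (map_zero _).symm)

theorem finrank_hDual (C : Type*) [Ring C] [Bialgebra k C] [Module.Finite k C] :
    Module.finrank k (HDual k C) = Module.finrank k C :=
  (HDual.toDual k C).finrank_eq.trans Subspace.dual_finrank_eq

/-- Both sides have dimension n², so injectivity suffices. -/
theorem heisenbergAct_bijective : Function.Bijective (heisenbergAct k H) := by
  refine ⟨heisenbergAct_injective, (LinearMap.injective_iff_surjective_of_finrank_eq_finrank
    (f := (heisenbergAct k H).toLinearMap) ?_).1 heisenbergAct_injective⟩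
  rw [← (smashTwist k (HDual k (Cop H)) (Cop H)).of.finrank_eq, Module.finrank_tensorProduct,
    finrank_hDual, Module.finrank_linearMap, ← (toCop k H).toLinearEquiv.finrank_eq]

/-! ### `H # D(H)` is isomorphic to `End(H) ⊗ H` -/

/-- Every operator on H comes from the Heisenberg double of H^cop, hence is a sum of operators of
the form left multiplication times l ↦ ⟨p, l₁⟩ l₂. Both kinds are operators of H and of H^* inside H
# D(H), and these map to End(H) ⊗ 1. -/
theorem tm_one_mem_range (f : Module.End k H) : tm f 1 ∈ (smashTensor k H).range := by
  obtain ⟨w, rfl⟩ := heisenbergAct_bijective.2 f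
  obtain ⟨z, rfl⟩ := (smashTwist k (HDual k (Cop H)) (Cop H)).of.surjective w
  induction z with
  | zero => simp
  | add x y hx hy =>
    simp only [map_add, LinearMap.add_apply]
    exact add_mem hx hy
  | tmul a p =>
    obtain ⟨a, rfl⟩ := (toCop k H).surjective a
    -- The form p ∘ S is chosen because the action of H^* in D(H) evaluates at S⁻¹(l₁).
    have h1 : heisenbergAct k H ((smashTwist k _ _).of (toCop k H a ⊗ₜ p)) =
        Algebra.lmul k H a * actDual k H ((HDual.toDual k H).symm
          (HDual.ofCop p ∘ₗ antipode k)) := by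
      refine ext_coef k fun i j => ?_
      rw [heisenbergAct_of, act_toCop, Module.End.mul_apply, actDual_coef, lmul_apply]
      simp [HDual.ofCop_apply]
    refine ⟨Smash.inl k _ H a * Smash.inr k _ H (DrinfeldDouble.inl k H
      ((HDual.toDual k H).symm (HDual.ofCop p ∘ₗ antipode k))), ?_⟩
    rw [h1]
    change smashTensor k H _ = _
    rw [map_mul, smashTensor_inl, smashTensor_inr_inl, tm_mul_tm, one_mul]

/-- The image of h carries h₂ in the second factor together with the unwanted operator l ↦ h₁ l
S(h₃). As all of End(H) ⊗ 1 is in the range already, that operator can be undone by left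
multiplication with operators depending on further legs of h. -/
theorem one_tm_mem_range (h : H) : tm 1 h ∈ (smashTensor k H).range := by
  refine coef_induction k (P := fun h => tm 1 h ∈ (smashTensor k H).range) h ?_ ?_ ?_
    fun i j => ?_
  · simp
  · intro x y hx hy
    simpa using add_mem hx hy
  · intro c x hx
    simpa using Subalgebra.smul_mem _ hx c
  -- The correcting operator is l ↦ S(h₁) l h₅. Composed with l ↦ h₂ l S(h₄) it gives S(h₁) h₂ l
  -- S(h₄) h₅, so both ends collapse and only h₃ remains.
  · have key : ∀ c d, ∑ a, ∑ b, (LinearMap.mulLeft k (antipode k (coef k i a : H)) ∘ₗ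
        LinearMap.mulRight k (coef k b j : H)) * sandwich k H (coef k a c) (coef k d b) =
        if i = c then if d = j then 1 else 0 else 0 := by
      intro c d
      ext l
      have h1 := congrArg₂ (fun x y : H => x * l * y) (sum_antipode_coef (k := k) (H := H) i c)
        (sum_antipode_coef (k := k) (H := H) d j)
      simp only [Finset.sum_mul, Finset.mul_sum] at h1
      rw [Finset.sum_comm] at h1
      refine Eq.trans ?_ (h1.trans ?_)
      · simp [LinearMap.sum_apply, sandwich_apply, mul_assoc]
      · split_ifs <;> simp
    have h2 : tm 1 (coef k i j : H) = ∑ a, ∑ b, tm (LinearMap.mulLeft k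
        (antipode k (coef k i a : H)) ∘ₗ LinearMap.mulRight k (coef k b j : H)) 1 *
        smashTensor k H (Smash.inr k _ H (DrinfeldDouble.inr k H (coef k a b))) := by
      simp only [smashTensor_inr_inr, adjTensor_coef, Finset.mul_sum, tm_mul_tm, one_mul]
      rw [sum_perm_3412]
      have h3 : ∀ c d, ∑ a, ∑ b, tm ((LinearMap.mulLeft k (antipode k (coef k i a : H)) ∘ₗ
          LinearMap.mulRight k (coef k b j : H)) * sandwich k H (coef k a c) (coef k d b))
          (coef k c d : H) = if i = c then if d = j then tm 1 (coef k c d) else 0 else 0 := by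
        intro c d
        have := congrArg (fun f => tm f (coef k c d : H)) (key c d)
        simp only [sum_tm, LinearMap.sum_apply] at this
        rw [this]
        split_ifs <;> simp
      simp [h3]
    rw [h2]
    exact sum_mem fun a _ => sum_mem fun b _ => mul_mem (tm_one_mem_range _) ⟨_, rfl⟩

theorem smashTensor_surjective : Function.Surjective (smashTensor k H) := by
  intro w
  obtain ⟨z, rfl⟩ := (EndTensor.of k H).surjective w
  induction z with
  | zero => exact ⟨0, by simp⟩
  | add x y hx hy =>
    obtain ⟨a, ha⟩ := hx
    obtain ⟨b, hb⟩ := hy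
    exact ⟨a + b, by simp [ha, hb]⟩
  | tmul f h =>
    obtain ⟨a, ha⟩ := tm_one_mem_range f
    obtain ⟨b, hb⟩ := one_tm_mem_range (k := k) h
    refine ⟨a * b, ?_⟩
    rw [map_mul, of_tmul]
    exact (congrArg₂ (· * ·) ha hb).trans (by rw [tm_mul_tm, mul_one, one_mul])

/-- The source is H ⊗ (H^* ⊗ H) and the target is End(H) ⊗ H, both of dimension n³, so surjectivity
suffices. -/
theorem smashTensor_bijective : Function.Bijective (smashTensor k H) := by
  refine ⟨(LinearMap.injective_iff_surjective_of_finrank_eq_finrank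
    (f := (smashTensor k H).toLinearMap) ?_).2 smashTensor_surjective, smashTensor_surjective⟩
  rw [← (smashTwist k (DrinfeldDouble k H) H).of.finrank_eq, Module.finrank_tensorProduct,
    ← (DrinfeldDouble.of k H).finrank_eq, Module.finrank_tensorProduct,
    finrank_hDual, ← (EndTensor.of k H).toLinearEquiv.finrank_eq, Module.finrank_tensorProduct,
    Module.finrank_linearMap, mul_assoc]

variable (k H) in
/-- The isomorphism `H # D(H) ≅ End(H) ⊗ H`. -/
def smashEquiv : Smash k (DrinfeldDouble k H) H ≃ₐ[k] EndTensor k H :=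
  AlgEquiv.ofBijective (smashTensor k H) (smashTensor_bijective (k := k) (H := H))

variable (k H) in
/-- The isomorphism `ℋ(H^cop) ≅ End(H)`. -/
def heisenbergEquiv : Heisenberg k (Cop H) ≃ₐ[k] Module.End k H :=
  AlgEquiv.ofBijective (heisenbergAct k H) heisenbergAct_bijective

variable (k H) in
/-- The isomorphism `H # D(H) ≅ ℋ(H^cop) ⊗ H`. -/
def smashEquivHeisenberg :
    Smash k (DrinfeldDouble k H) H ≃ₐ[k] Heisenberg k (Cop H) ⊗[k] H :=
  (smashEquiv k H).trans ((EndTensor.of k H).symm.trans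
    (Algebra.TensorProduct.congr (heisenbergEquiv k H).symm AlgEquiv.refl))

end SmashDouble
-- Morita equivalence between modules over `End(H) ⊗ H` and over `H`.
section Morita
variable {k H : Type u} [Field k] [Ring H] [HopfAlgebra k H] [Module.Finite k H]

open EndTensor

section Rep
variable {V : Type u} [AddCommGroup V] [Module k V] (ρ : Cop H →ₐ[k] Module.End k V)

/-- The action of `End(H) ⊗ H` on `H ⊗ V`. -/
def endAct : EndTensor k H →ₐ[k] Module.End k (H ⊗[k] V) :=
  (Module.endTensorEndAlgHom (R := k) (A := k) (M := H) (N := V)).comp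
    ((Algebra.TensorProduct.map (AlgHom.id k (Module.End k H))
      (ρ.comp (toCop k H).toAlgHom)).comp (EndTensor.of k H).symm.toAlgHom)

theorem endAct_tm (f : Module.End k H) (h : H) (z : H ⊗[k] V) :
    endAct ρ (tm f h) z = TensorProduct.map f (ρ (toCop k H h)) z := rfl

theorem endTensor_ext {X : Type*} [AddCommGroup X] [Module k X] {F G : EndTensor k H →ₗ[k] X}
    (h : ∀ f h, F (tm f h) = G (tm f h)) : F = G := by
  have : F ∘ₗ (EndTensor.of k H).toLinearMap = G ∘ₗ (EndTensor.of k H).toLinearMap :=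
    TensorProduct.ext' h
  exact LinearMap.ext fun t => LinearMap.congr_fun this t

/-- Elementary tensors span both `EndTensor k H` and H ⊗ V. This is the common source of linearity
over H # D(H), both for the images of morphisms under F and for `cornerMap`. -/
theorem endAct_commute {W : Type u} [AddCommGroup W] [Module k W]
    (σ : EndTensor k H →ₐ[k] Module.End k W) (f : H ⊗[k] V →ₗ[k] W)
    (h : ∀ g h x v, f (g x ⊗ₜ ρ (toCop k H h) v) = σ (tm g h) (f (x ⊗ₜ v)))
    (t : EndTensor k H) (z : H ⊗[k] V) : f (endAct ρ t z) = σ t (f z) := by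
  have h1 : (LinearMap.llcomp k _ _ _ f) ∘ₗ (endAct ρ).toLinearMap =
      (LinearMap.lcomp k W f) ∘ₗ σ.toLinearMap := by
    refine endTensor_ext fun g a => TensorProduct.ext' fun x v => ?_
    exact h g a x v
  exact LinearMap.congr_fun (LinearMap.congr_fun h1 t) z

/-- The action of `H # D(H)` on `H ⊗ V`. -/
def smashRep : Smash k (DrinfeldDouble k H) H →ₐ[k] Module.End k (H ⊗[k] V) :=
  (endAct ρ).comp (smashTensor k H)

end Rep

theorem lTensor_commute {M N : FDMod k (Cop H)} (f : M ⟶ N) (t : EndTensor k H)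
    (z : H ⊗[k] M.V) :
    (FDMod.toLin f).lTensor H (endAct M.ρ t z) = endAct N.ρ t ((FDMod.toLin f).lTensor H z) :=
  endAct_commute M.ρ (endAct N.ρ) _ (fun g h x v => by
    simp [endAct_tm, FDMod.toLin_act]) t z

variable (k H) in
/-- The functor `V ↦ H ⊗ V` from `H^cop`-modules to `H # D(H)`-modules. -/
def inducedFunctor : FDMod k (Cop H) ⥤ FDMod k (Smash k (DrinfeldDouble k H) H) where
  obj M := { V := H ⊗[k] M.V, ρ := smashRep M.ρ }
  map {M N} f := FDMod.mkHom (M := { V := H ⊗[k] M.V, ρ := smashRep M.ρ })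
    (N := { V := H ⊗[k] N.V, ρ := smashRep N.ρ }) ((FDMod.toLin f).lTensor H)
    fun r z => lTensor_commute f (smashTensor k H r) z
  map_id M := FDMod.hom_ext (LinearMap.lTensor_id H M.V)
  map_comp f g := FDMod.hom_ext (LinearMap.lTensor_comp H (FDMod.toLin g) (FDMod.toLin f))

/-- The map `ε ⊗ id : H ⊗ V → V`. -/
def counitTensor (V : Type u) [AddCommGroup V] [Module k V] : H ⊗[k] V →ₗ[k] V :=
  (TensorProduct.lid k V).toLinearMap ∘ₗ (counit (R := k) (A := H)).rTensor V

theorem counitTensor_tmul {V : Type u} [AddCommGroup V] [Module k V] (x : H) (v : V) :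
    counitTensor V (x ⊗ₜ[k] v) = counit (R := k) x • v := rfl

/-- Since ε(1) = 1, a map f is recovered from id ⊗ f by inserting 1 and then applying ε ⊗ id. -/
instance inducedFunctor_faithful : (inducedFunctor k H).Faithful where
  map_injective {M N f g} h := by
    refine FDMod.hom_ext (LinearMap.ext fun v => ?_)
    have h1 := congrArg (counitTensor N.V) (LinearMap.congr_fun (congrArg FDMod.toLin h)
      ((1 : H) ⊗ₜ[k] v))
    change counitTensor N.V ((1 : H) ⊗ₜ FDMod.toLin f v) =
      counitTensor N.V ((1 : H) ⊗ₜ FDMod.toLin g v) at h1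
    simpa [counitTensor_tmul] using h1

/-- A map which commutes with End(H) ⊗ 1 is of the form id ⊗ f, and commuting with 1 ⊗ H makes f
linear over H. -/
instance inducedFunctor_full : (inducedFunctor k H).Full where
  map_surjective {M N} g := by
    let g' : H ⊗[k] M.V →ₗ[k] H ⊗[k] N.V := FDMod.toLin g
    -- Linearity over H # D(H) is linearity over all of `EndTensor k H`, by surjectivity of
    -- `smashTensor`.
    have hg : ∀ (t : EndTensor k H) (z : H ⊗[k] M.V),
        g' (endAct M.ρ t z) = endAct N.ρ t (g' z) := by
      intro t z
      obtain ⟨s, rfl⟩ := smashTensor_surjective t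
      exact FDMod.toLin_act g s z
    -- The only candidate, by the formula that proves faithfulness.
    let f : M.V →ₗ[k] N.V := counitTensor (H := H) N.V ∘ₗ g' ∘ₗ TensorProduct.mk k H M.V 1
    refine ⟨FDMod.mkHom f (fun (h : Cop H) v => ?_), FDMod.hom_ext ?_⟩
    · obtain ⟨h, rfl⟩ := (toCop k H).surjective h
      have h1 := hg (tm 1 h) (1 ⊗ₜ v)
      rw [endAct_tm, endAct_tm, map_tmul, Module.End.one_apply] at h1
      change counitTensor N.V (g' (1 ⊗ₜ _)) = N.ρ _ (counitTensor N.V (g' (1 ⊗ₜ v)))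
      rw [h1]
      generalize g' (1 ⊗ₜ v) = z
      induction z with
      | zero => simp
      | add x y hx hy => simp only [map_add, hx, hy]
      | tmul x y => simp [counitTensor_tmul]
    · refine TensorProduct.ext' fun (x : H) v => ?_
      -- The rank one operator ε(-)x carries 1 to x, so g(x ⊗ v) = (ε(-)x ⊗ 1) g(1 ⊗ v); on the
      -- right this operator replaces the H-leg y by ε(y) x, which is x ⊗ f(v).
      have h1 := hg (tm ((counit (R := k)).smulRight x) 1) (1 ⊗ₜ v)
      simp only [endAct_tm, map_tmul, LinearMap.smulRight_apply, Bialgebra.counit_one, one_smul,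
        map_one, Module.End.one_apply] at h1
      change x ⊗ₜ counitTensor N.V (g' (1 ⊗ₜ v)) = g' (x ⊗ₜ v)
      rw [h1]
      generalize g' (1 ⊗ₜ v) = z
      induction z with
      | zero => simp
      | add x y hx hy => simp only [map_add, tmul_add, hx, hy]
      | tmul y w => simp [counitTensor_tmul, smul_tmul]

/-! ### Essential surjectivity through a rank one idempotent. -/

section EssSurj
variable {W : Type u} [AddCommGroup W] [Module k W] (σ : EndTensor k H →ₐ[k] Module.End k W)

/-- The matrix unit rule for rank one operators p(-)x. Every identity about the idempotent e = ε(-)1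
below is an instance of it. -/
theorem smulRight_mul_smulRight (p q : H →ₗ[k] k) (x y : H) :
    (p.smulRight x * q.smulRight y : Module.End k H) = p y • q.smulRight x := by
  ext l
  simp [smul_smul, mul_comm]

theorem mul_smulRight (f : Module.End k H) (p : H →ₗ[k] k) (x : H) :
    (f * p.smulRight x : Module.End k H) = p.smulRight (f x) := by
  ext l
  simp

/-- The image of the idempotent `x ↦ ε(x) 1` of `End(H)`. -/
def corner : Submodule k W := LinearMap.range (σ (tm ((counit (R := k)).smulRight (1 : H)) 1))

/-- The operator ε(-)1 is idempotent because ε(1) = 1, so it fixes its image. -/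
theorem corner_fix (v : corner σ) : σ (tm ((counit (R := k)).smulRight (1 : H)) 1) v = v := by
  obtain ⟨_, w, rfl⟩ := v
  rw [← Module.End.mul_apply, ← map_mul, tm_mul_tm, smulRight_mul_smulRight]
  simp

/-- Any rank one operator with values in the line k · 1 is unchanged by composing with e on the
left, so its image lies in eW. With p a coordinate form this yields the components of `cornerInv`.
-/
theorem mem_corner (p : H →ₗ[k] k) (w : W) : σ (tm (p.smulRight 1) 1) w ∈ corner σ :=
  ⟨σ (tm (p.smulRight 1) 1) w, by
    rw [← Module.End.mul_apply, ← map_mul, tm_mul_tm, smulRight_mul_smulRight]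
    simp⟩

/-- The factors End(H) ⊗ 1 and 1 ⊗ H commute, so H acts on eW. -/
theorem corner_stable (h : H) (w : W) (hw : w ∈ corner σ) : σ (tm 1 h) w ∈ corner σ := by
  obtain ⟨w, rfl⟩ := hw
  refine ⟨σ (tm 1 h) w, ?_⟩
  simp only [← Module.End.mul_apply, ← map_mul, tm_mul_tm, one_mul, mul_one]

/-- The action of `H` on the image of the idempotent. -/
def cornerRep : Cop H →ₐ[k] Module.End k (corner σ) :=
  AlgHom.ofLinearMap
    { toFun := fun h => (σ (tm 1 ((toCop k H).symm h))).restrict (corner_stable σ _)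
      map_add' := fun x y => by ext v; simp
      map_smul' := fun c x => by ext v; simp }
    (by ext v; simp [tm_one_one])
    (fun x y => by
      ext v
      change σ (tm 1 ((toCop k H).symm (x * y))) v =
        σ (tm 1 ((toCop k H).symm x)) (σ (tm 1 ((toCop k H).symm y)) v)
      rw [← Module.End.mul_apply, ← map_mul σ, tm_mul_tm, one_mul, map_mul])

theorem cornerRep_apply (h : H) (v : corner σ) :
    (cornerRep σ (toCop k H h) v : W) = σ (tm 1 h) v := rfl

/-- The map `x ⊗ v ↦ (ε(-) x ⊗ 1) v`. -/
def cornerMap : H ⊗[k] corner σ →ₗ[k] W :=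
  TensorProduct.lift
    (LinearMap.mk₂ k (fun x (v : corner σ) => σ (tm ((counit (R := k)).smulRight x) 1) v)
      (fun x y v => by
        have : (counit (R := k)).smulRight (x + y) = (counit (R := k) (A := H)).smulRight x +
          (counit (R := k) (A := H)).smulRight y := by ext; simp
        simp [this])
      (fun c x v => by
        have : (counit (R := k)).smulRight (c • x) =
          c • (counit (R := k) (A := H)).smulRight x := by ext; simp [mul_left_comm, smul_smul, mul_comm]
        simp [this])
      (fun x y v => by simp) (fun c x v => by simp))

theorem cornerMap_tmul (x : H) (v : corner σ) :
    cornerMap σ (x ⊗ₜ v) = σ (tm ((counit (R := k)).smulRight x) 1) v := rfl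

/-- The inverse of `cornerMap`. -/
def cornerInv : W →ₗ[k] H ⊗[k] corner σ :=
  ∑ i, TensorProduct.mk k H (corner σ) (Module.finBasis k H i) ∘ₗ
    (σ (tm (((Module.finBasis k H).coord i).smulRight 1) 1)).codRestrict (corner σ)
      (mem_corner σ _)

/-- The i-th component of the image of x ⊗ v is x_i^*(x) v, and ∑ x_i^*(x) x_i = x. -/
theorem cornerInv_cornerMap (z : H ⊗[k] corner σ) : cornerInv σ (cornerMap σ z) = z := by
  refine LinearMap.congr_fun (f := cornerInv σ ∘ₗ cornerMap σ) (g := LinearMap.id)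
    (TensorProduct.ext' fun x v => ?_) z
  -- Here (x_i^*(-)1) (ε(-)x) = x_i^*(x) e, and e fixes v.
  have h1 : ∀ i, (σ (tm (((Module.finBasis k H).coord i).smulRight 1) 1)).codRestrict (corner σ)
      (mem_corner σ _) (cornerMap σ (x ⊗ₜ v)) = (Module.finBasis k H).coord i x • v := by
    intro i
    refine Subtype.ext ?_
    rw [LinearMap.codRestrict_apply, cornerMap_tmul, ← Module.End.mul_apply, ← map_mul, tm_mul_tm,
      smulRight_mul_smulRight, one_mul, map_smul, LinearMap.smul_apply, map_smul,
      LinearMap.smul_apply, corner_fix]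
    rfl
  simp only [cornerInv, LinearMap.comp_apply, LinearMap.sum_apply, h1, mk_apply, ← smul_tmul,
    ← sum_tmul, Module.Basis.coord_apply, Module.Basis.sum_repr, LinearMap.id_apply]

/-- Resolution of the identity: (ε(-)x_i) (x_i^*(-)1) = x_i^*(-)x_i, and these operators sum to 1.
-/
theorem cornerMap_cornerInv (w : W) : cornerMap σ (cornerInv σ w) = w := by
  have h1 : ∑ i, ((Module.finBasis k H).coord i).smulRight (Module.finBasis k H i) =
      (1 : Module.End k H) := by
    ext x
    simp [LinearMap.sum_apply, Module.Basis.sum_repr]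
  have h2 := LinearMap.congr_fun (congrArg (fun f => σ (tm f 1)) h1) w
  simp only [map_sum, LinearMap.sum_apply, tm_one_one, map_one, Module.End.one_apply] at h2
  simp only [cornerInv, LinearMap.comp_apply, LinearMap.sum_apply, map_sum, mk_apply,
    cornerMap_tmul, LinearMap.codRestrict_apply]
  refine Eq.trans (Finset.sum_congr rfl fun i _ => ?_) h2
  rw [← Module.End.mul_apply, ← map_mul, tm_mul_tm, smulRight_mul_smulRight]
  simp

end EssSurj

instance inducedFunctor_essSurj : (inducedFunctor k H).EssSurj where
  mem_essImage N := by
    -- The given module becomes an `EndTensor k H`-module through the inverse isomorphism; its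
    -- preimage under the functor is eN.
    let σ : EndTensor k H →ₐ[k] Module.End k N.V := N.ρ.comp (smashEquiv k H).symm.toAlgHom
    have hσ : ∀ s, σ (smashTensor k H s) = N.ρ s := fun s =>
      congrArg N.ρ ((smashEquiv k H).symm_apply_apply s)
    let M : FDMod k (Cop H) := { V := corner σ, ρ := cornerRep σ }
    refine ⟨M, ⟨FDMod.mkIso (M := (inducedFunctor k H).obj M) (N := N) (cornerMap σ) (cornerInv σ)
      (fun s z => ?_) (cornerInv_cornerMap σ) (cornerMap_cornerInv σ)⟩⟩
    rw [← hσ]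
    refine endAct_commute (cornerRep σ) σ (cornerMap σ) (fun g h x v => ?_) (smashTensor k H s) z
    rw [cornerMap_tmul, cornerMap_tmul, cornerRep_apply, ← Module.End.mul_apply, ← map_mul,
      ← Module.End.mul_apply, ← map_mul, tm_mul_tm, tm_mul_tm, mul_smulRight, one_mul, mul_one,
      mul_one]

instance inducedFunctor_isEquivalence : (inducedFunctor k H).IsEquivalence where

end Morita
-- The right action of `H`, computed in `End(H) ⊗ H`.
section RightAction
variable {k H : Type u} [Field k] [Ring H] [HopfAlgebra k H] [Module.Finite k H]

open EndTensor HopfAlgebra ModuleAlgebra Smash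

/-- Inserting R = ∑ x_i ⊗ p_i gives ∑ (p_i · b) # x_i with p_i · b = ⟨p_i, S⁻¹(b₁)⟩ b₂. The dual
bases contract, and b acts from the right as b₂ # S⁻¹(b₁). -/
theorem rightElt_coef (m n : Fin (Module.finrank k H)) :
    rightElt k (DrinfeldDouble k H) H (coef k m n) = ∑ r, inl k _ H (coef k r n) *
      inr k _ H (DrinfeldDouble.inr k H (antipodeInv k (coef k m r))) := by
  change actSmash (coef k m n : H) (TensorProduct.comm k _ _ (drinfeldR k H)) = _
  simp only [drinfeldR, map_sum, comm_tmul, actSmash_tmul, act_inl, actDual_coef, Finset.sum_mul,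
    map_smul, smul_mul_assoc]
  rw [Finset.sum_comm]
  refine Finset.sum_congr rfl fun r _ => ?_
  exact sum_dualBasis (LinearMap.mulLeft k (inl k (DrinfeldDouble k H) H (coef k r n)) ∘ₗ
    (inr k (DrinfeldDouble k H) H).toLinearMap ∘ₗ (DrinfeldDouble.inr k H).toLinearMap)
    (antipodeInv k (coef k m r))

/-- S⁻¹ reverses coproducts, so the three legs of S⁻¹(b) are S⁻¹(b₃), S⁻¹(b₂), S⁻¹(b₁) in this
order. -/
theorem adjTensor_antipodeInv (m r : Fin (Module.finrank k H)) :
    adjTensor k H (antipodeInv k (coef k m r)) = ∑ t, ∑ s, tm (sandwich k H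
      (antipodeInv k (coef k t r)) (antipodeInv k (coef k m s))) (antipodeInv k (coef k s t)) := by
  change adjTensorLin k H _ = _
  simp [adjTensorLin, comul_antipodeInv_coef, map_sum, tmul_sum, sandwichTensor_tmul]

/-- The image of b₂ # S⁻¹(b₁) is, in renumbered legs, the operator y ↦ b₄ S⁻¹(b₃) y S(S⁻¹(b₁))
tensored with S⁻¹(b₂). The left end collapses, and y ↦ y b₁ remains. -/
theorem smashTensor_rightElt_coef (m n : Fin (Module.finrank k H)) :
    smashTensor k H (rightElt k _ H (coef k m n)) =
      ∑ s, tm (LinearMap.mulRight k (coef k m s)) (antipodeInv k (coef k s n)) := by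
  -- The cancellation is x₂ S⁻¹(x₁) = ε(x); on the right S undoes S⁻¹.
  have h1 : ∀ s t, ∑ r, Algebra.lmul k H (coef k r n) * sandwich k H
      (antipodeInv k (coef k t r)) (antipodeInv k (coef k m s)) =
      if t = n then LinearMap.mulRight k (coef k m s : H) else 0 := by
    intro s t
    ext y
    have := congrArg (fun z => z * (y * coef k m s))
      (sum_coef_antipodeInv (k := k) (H := H) t n)
    simp only [Finset.sum_mul, mul_assoc] at this
    simp only [LinearMap.sum_apply, Module.End.mul_apply, lmul_apply, sandwich_apply,
      antipode_antipodeInv]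
    rw [this]
    split_ifs <;> simp
  have h2 : ∀ s t, ∑ r, tm (Algebra.lmul k H (coef k r n) * sandwich k H
      (antipodeInv k (coef k t r)) (antipodeInv k (coef k m s))) (antipodeInv k (coef k s t)) =
      if t = n then tm (LinearMap.mulRight k (coef k m s : H)) (antipodeInv k (coef k s t))
        else 0 := by
    intro s t
    have := congrArg (fun f => tm f (antipodeInv k (coef k s t : H))) (h1 s t)
    simp only [sum_tm, LinearMap.sum_apply] at this
    rw [this]
    split_ifs <;> simp
  simp only [rightElt_coef, map_sum, map_mul, smashTensor_inl, smashTensor_inr_inr,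
    adjTensor_antipodeInv, Finset.mul_sum, tm_mul_tm, one_mul]
  rw [Finset.sum_comm]
  refine (Finset.sum_congr rfl fun _ _ => Finset.sum_comm).trans (Finset.sum_comm.trans ?_)
  simp only [h2, Finset.sum_ite_eq', Finset.mem_univ, if_true]

variable (k H) in
/-- The map `b ↦ (y ↦ y b₁) ⊗ S⁻¹(b₂)`. -/
def rightTensor : H →ₗ[k] EndTensor k H :=
  TensorProduct.lift ((tm (k := k) (H := H)).compl₁₂ (LinearMap.mul k H).flip (antipodeInv k)) ∘ₗ
    comul

/-- The formula freed from coefficients. It is needed at b = S(c_mn), which is not itself a matrix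
coefficient. -/
theorem smashTensor_rightElt (b : H) :
    smashTensor k H (rightElt k _ H b) = rightTensor k H b := by
  refine eq_of_coef k ((smashTensor k H).toLinearMap ∘ₗ rightEltLin k (DrinfeldDouble k H) H)
    (rightTensor k H) (fun i j => ?_) b
  refine (smashTensor_rightElt_coef i j).trans ?_
  simp only [rightTensor, LinearMap.comp_apply, comul_coef, map_sum, lift.tmul]
  rfl

/-- As S reverses coproducts and S⁻¹ S = id, right action by S(b) is (y ↦ y S(b₂)) ⊗ b₁. This is the
form in which the right action enters `splitT_act`. -/
theorem smashTensor_rightElt_antipode (m n : Fin (Module.finrank k H)) :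
    smashTensor k H (rightElt k _ H (antipode k (coef k m n))) =
      ∑ s, tm (LinearMap.mulRight k (antipode k (coef k s n))) (coef k m s) := by
  rw [smashTensor_rightElt]
  simp only [rightTensor, LinearMap.comp_apply, comul_antipode, comul_coef, map_sum, map_tmul,
    comm_tmul, lift.tmul, LinearMap.compl₁₂_apply, antipodeInv_antipode]
  rfl

/-- Left multiplication is recovered from the action of `D(H)` and the right action. -/
theorem sum_rightElt_mul_inr (i c : Fin (Module.finrank k H)) :
    ∑ l, rightElt k _ H (coef k l c) * inr k _ H (DrinfeldDouble.inr k H (coef k i l)) =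
      inl k _ H (coef k i c) := by
  -- After passing to `End(H) ⊗ H`, the left side is (y ↦ h₁ y S(h₃) h₄) ⊗ S⁻¹(h₅) h₂, where the
  -- factor S⁻¹(h₅) comes from the right action of the second leg.
  refine smashTensor_bijective.1 ?_
  -- The first cancellation: S(h₃) h₄ inside the operator.
  have h1 : ∀ s a b, ∑ l, LinearMap.mulRight k (coef k l s) *
      sandwich k H (coef k i a) (coef k b l) =
      if b = s then Algebra.lmul k H (coef k i a) else 0 := by
    intro s a b
    ext y
    have := congrArg (fun z => coef k i a * (y * z)) (sum_antipode_coef (k := k) (H := H) b s)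
    simp only [Finset.mul_sum] at this
    simp only [LinearMap.sum_apply, Module.End.mul_apply, sandwich_apply,
      LinearMap.mulRight_apply, mul_assoc]
    rw [this]
    split_ifs <;> simp [lmul_apply]
  have h2 : ∀ s a b, ∑ l, tm (LinearMap.mulRight k (coef k l s) *
      sandwich k H (coef k i a) (coef k b l)) (antipodeInv k (coef k s c) * coef k a b) =
      if b = s then tm (Algebra.lmul k H (coef k i a))
        (antipodeInv k (coef k s c) * coef k a b) else 0 := by
    intro s a b
    have := congrArg (fun f => tm f (antipodeInv k (coef k s c : H) * coef k a b)) (h1 s a b)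
    simp only [sum_tm, LinearMap.sum_apply] at this
    rw [this]
    split_ifs <;> simp
  -- The second cancellation, possible only after the first has made the legs adjacent: S⁻¹(h₃) h₂
  -- in the second tensor factor.
  have h3 : ∀ a, ∑ b, tm (Algebra.lmul k H (coef k i a))
      (antipodeInv k (coef k b c) * coef k a b) =
      if a = c then tm (Algebra.lmul k H (coef k i a)) 1 else 0 := by
    intro a
    rw [← map_sum, sum_antipodeInv_coef]
    split_ifs <;> simp
  simp only [map_sum, map_mul, smashTensor_inl, smashTensor_inr_inr, smashTensor_rightElt_coef,
    adjTensor_coef, Finset.sum_mul, Finset.mul_sum, tm_mul_tm]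
  have h4 : ∀ f : Fin (Module.finrank k H) → Fin (Module.finrank k H) →
      Fin (Module.finrank k H) → Fin (Module.finrank k H) → EndTensor k H,
      ∑ l, ∑ a, ∑ b, ∑ s, f l a b s = ∑ a, ∑ b, ∑ s, ∑ l, f l a b s := fun f => by
    rw [Finset.sum_comm]
    refine Finset.sum_congr rfl fun _ _ => ?_
    rw [Finset.sum_comm]
    exact Finset.sum_congr rfl fun _ _ => Finset.sum_comm
  rw [h4]
  simp only [h2, h3, Finset.sum_ite_eq, Finset.sum_ite_eq', Finset.mem_univ, if_true]

end RightAction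

/-! ### The isomorphism `F(V ⊗ W) ≅ F(V) ⊗_H F(W)` for `F(V) = H ⊗ V`. -/

section Comparison
variable {k H : Type u} [Field k] [Ring H] [HopfAlgebra k H] [Module.Finite k H]

open EndTensor HopfAlgebra ModuleAlgebra Smash

/-- H # D(H) is generated by H, H^* and the second copy of H. Unlike in `act_of_gen`, the
coefficients used are those of H rather than those of D(H), which keeps the explicit formulas
applicable. -/
theorem act_of_double_gen {V W : Type u} [AddCommGroup V] [Module k V] [AddCommGroup W]
    [Module k W] {ρ : Smash k (DrinfeldDouble k H) H →ₐ[k] Module.End k V}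
    {σ : Smash k (DrinfeldDouble k H) H →ₐ[k] Module.End k W} (f : V →ₗ[k] W)
    (hl : ∀ a v, f (ρ (inl k _ H a) v) = σ (inl k _ H a) (f v))
    (hd : ∀ p v, f (ρ (inr k _ H (DrinfeldDouble.inl k H p)) v) =
      σ (inr k _ H (DrinfeldDouble.inl k H p)) (f v))
    (hr : ∀ i j v, f (ρ (inr k _ H (DrinfeldDouble.inr k H (coef k i j))) v) =
      σ (inr k _ H (DrinfeldDouble.inr k H (coef k i j))) (f v))
    (s : Smash k (DrinfeldDouble k H) H) (v : V) : f (ρ s v) = σ s (f v) := by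
  refine Smash.gen_induction (P := fun s => ∀ v, f (ρ s v) = σ s (f v)) ?_ hl (fun x => ?_)
    ?_ ?_ s v
  · simp
  · refine DrinfeldDouble.gen_induction (P := fun x => ∀ v, f (ρ (inr k _ H x) v) =
      σ (inr k _ H x) (f v)) ?_ hd (fun h v => ?_) ?_ ?_ x
    · simp
    · exact eq_of_coef k (f ∘ₗ LinearMap.applyₗ v ∘ₗ ρ.toLinearMap ∘ₗ (inr k _ H).toLinearMap ∘ₗ
        (DrinfeldDouble.inr k H).toLinearMap) (LinearMap.applyₗ (f v) ∘ₗ σ.toLinearMap ∘ₗ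
        (inr k _ H).toLinearMap ∘ₗ (DrinfeldDouble.inr k H).toLinearMap) (fun i j => hr i j v) h
    · intro x y hx hy v
      simp [hx, hy]
    · intro x y hx hy v
      simp [hx, hy]
  · intro x y hx hy v
    simp [hx, hy]
  · intro x y hx hy v
    simp [hx, hy]

variable {V W : Type u} [AddCommGroup V] [Module k V] [AddCommGroup W] [Module k W]
  (ρ : Cop H →ₐ[k] Module.End k V) (σ : Cop H →ₐ[k] Module.End k W)

theorem smashRep_inl (a x : H) (v : V) :
    smashRep ρ (inl k _ H a) (x ⊗ₜ v) = (a * x) ⊗ₜ v := by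
  simp only [smashRep, AlgHom.comp_apply, smashTensor_inl, endAct_tm, map_tmul, map_one,
    Module.End.one_apply, lmul_apply]

theorem smashRep_dual (p : HDual k H) (x : H) (v : V) :
    smashRep ρ (inr k _ H (DrinfeldDouble.inl k H p)) (x ⊗ₜ v) = actDual k H p x ⊗ₜ v := by
  simp only [smashRep, AlgHom.comp_apply, smashTensor_inr_inl, endAct_tm, map_tmul, map_one,
    Module.End.one_apply]

theorem smashRep_adj (i j : Fin (Module.finrank k H)) (x : H) (v : V) :
    smashRep ρ (inr k _ H (DrinfeldDouble.inr k H (coef k i j))) (x ⊗ₜ v) =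
      ∑ a, ∑ b, (coef k i a * (x * antipode k (coef k b j))) ⊗ₜ ρ (toCop k H (coef k a b)) v := by
  simp only [smashRep, AlgHom.comp_apply, smashTensor_inr_inr, adjTensor_coef, map_sum,
    LinearMap.sum_apply, endAct_tm, map_tmul, sandwich_apply]

theorem smashRep_rightElt_antipode (m n : Fin (Module.finrank k H)) (x : H) (v : V) :
    smashRep ρ (rightElt k _ H (antipode k (coef k m n))) (x ⊗ₜ v) =
      ∑ s, (x * antipode k (coef k s n)) ⊗ₜ ρ (toCop k H (coef k m s)) v := by
  simp only [smashRep, AlgHom.comp_apply, smashTensor_rightElt_antipode, map_sum,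
    LinearMap.sum_apply, endAct_tm, map_tmul, LinearMap.mulRight_apply]

/-- The diagonal action of `H^cop` on `V ⊗ W`. -/
abbrev diagCop := FDMod.diag (B := Cop H) ρ σ

/-- The second leg of h acts on V and the first on W. This reversal is what the action on F(V) ⊗_H
F(W) must reproduce. -/
theorem diag_toCop (i j : Fin (Module.finrank k H)) (v : V) (w : W) :
    diagCop ρ σ (toCop k H (coef k i j)) (v ⊗ₜ w) =
      ∑ l, ρ (toCop k H (coef k l j)) v ⊗ₜ σ (toCop k H (coef k i l)) w := by
  have h : comul (R := k) (toCop k H (coef k i j)) =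
      ∑ l, toCop k H (coef k l j) ⊗ₜ[k] toCop k H (coef k i l) := by
    refine (Cop.comul_eq k H (coef k i j)).trans ?_
    rw [comul_coef]
    simp only [map_sum, comm_tmul]
    rfl
  change Module.endTensorEndAlgHom (R := k) (A := k) (M := V) (N := W)
    (Algebra.TensorProduct.map ρ σ (comul (R := k) (toCop k H (coef k i j)))) (v ⊗ₜ w) = _
  rw [h]
  simp only [map_sum, Algebra.TensorProduct.map_tmul, LinearMap.sum_apply]
  rfl

/-- The map `x ⊗ (v ⊗ w) ↦ (x ⊗ v) ⊗ (1 ⊗ w)`. -/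
def splitT : H ⊗[k] (V ⊗[k] W) →ₗ[k] BT (smashRep ρ) (smashRep σ) :=
  TensorProduct.lift ((tq (smashRep ρ) (smashRep σ)).compl₂ (TensorProduct.mk k H W 1)) ∘ₗ
    (TensorProduct.assoc k H V W).symm.toLinearMap

theorem splitT_tmul (x : H) (v : V) (w : W) :
    splitT ρ σ (x ⊗ₜ (v ⊗ₜ w)) = tq (smashRep ρ) (smashRep σ) (x ⊗ₜ v) (1 ⊗ₜ w) := rfl

/-- The same map with an arbitrary z in H ⊗ V, the form in which it composes with `joinT`, where z ·
y is not an elementary tensor. -/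
theorem splitT_assoc (z : H ⊗[k] V) (w : W) :
    splitT ρ σ (TensorProduct.assoc k H V W (z ⊗ₜ w)) =
      tq (smashRep ρ) (smashRep σ) z (1 ⊗ₜ w) := by
  rw [splitT, LinearMap.comp_apply, LinearEquiv.coe_coe, LinearEquiv.symm_apply_apply]
  rfl

/-- The bilinear map `(y ⊗ w, z) ↦ (z · y) ⊗ w`. -/
def joinAux : H ⊗[k] W →ₗ[k] H ⊗[k] V →ₗ[k] H ⊗[k] (V ⊗[k] W) :=
  TensorProduct.lift (LinearMap.mk₂ k (fun y w => (TensorProduct.assoc k H V W).toLinearMap ∘ₗ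
      (TensorProduct.mk k (H ⊗[k] V) W).flip w ∘ₗ
      smashRep ρ (rightEltLin k (DrinfeldDouble k H) H y))
    (fun x y z => by simp [LinearMap.add_comp, LinearMap.comp_add])
    (fun c x y => by simp [LinearMap.smul_comp, LinearMap.comp_smul])
    (fun x y z => by simp [LinearMap.add_comp, LinearMap.comp_add])
    (fun c x y => by simp [LinearMap.smul_comp, LinearMap.comp_smul]))

theorem joinAux_tmul (y : H) (w : W) (z : H ⊗[k] V) : joinAux ρ (y ⊗ₜ[k] w) z =
    TensorProduct.assoc k H V W (smashRep ρ (rightElt k _ H y) z ⊗ₜ w) := rfl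

/-- The map `z ⊗ (y ⊗ w) ↦ (z · y) ⊗ w`. -/
def joinT : BT (smashRep ρ) (smashRep σ) →ₗ[k] H ⊗[k] (V ⊗[k] W) :=
  liftT (joinAux ρ).flip (fun a z u => by
    simp only [LinearMap.flip_apply]
    induction u with
    | zero => simp
    | add s t hs ht => simp only [map_add, LinearMap.add_apply, hs, ht]
    | tmul y w =>
      -- Balancedness is (z · a) · y = z · (a y), that is, the right action really is a right
      -- action.
      rw [smashRep_inl, joinAux_tmul, joinAux_tmul, ← Module.End.mul_apply, ← map_mul,
        rightElt_mul])

theorem joinT_tq (z : H ⊗[k] V) (y : H) (w : W) :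
    joinT ρ σ (tq (smashRep ρ) (smashRep σ) z (y ⊗ₜ w)) =
    TensorProduct.assoc k H V W (smashRep ρ (rightElt k _ H y) z ⊗ₜ w) := rfl

theorem joinT_splitT (z : H ⊗[k] (V ⊗[k] W)) : joinT ρ σ (splitT ρ σ z) = z := by
  obtain ⟨z, rfl⟩ := (TensorProduct.assoc k H V W).surjective z
  induction z with
  | zero => simp
  | add s t hs ht => simp only [map_add, hs, ht]
  | tmul z w => rw [splitT_assoc, joinT_tq, rightElt_one, map_one, Module.End.one_apply]

/-- In the tensor product over H, (z · y) ⊗ (1 ⊗ w) = z ⊗ y (1 ⊗ w) = z ⊗ (y ⊗ w). -/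
theorem splitT_joinT (z : BT (smashRep ρ) (smashRep σ)) : splitT ρ σ (joinT ρ σ z) = z := by
  refine LinearMap.congr_fun (f := splitT ρ σ ∘ₗ joinT ρ σ) (g := LinearMap.id)
    (ext_tq fun z u => ?_) z
  induction u with
  | zero => simp
  | add s t hs ht => simp only [map_add, hs, ht]
  | tmul y w =>
    rw [LinearMap.comp_apply, joinT_tq, splitT_assoc, tq_balanced, smashRep_inl, mul_one]
    rfl

/-- The defining formula is available on matrix coefficients of D(H). This version holds for every d
and can be evaluated on the images of H^* and H, whose coproducts in D(H) are known. -/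
theorem actT_inr_comul {X Y : Type u} [AddCommGroup X] [Module k X] [AddCommGroup Y] [Module k Y]
    (μ : Smash k (DrinfeldDouble k H) H →ₐ[k] Module.End k X)
    (ν : Smash k (DrinfeldDouble k H) H →ₐ[k] Module.End k Y) (d : DrinfeldDouble k H)
    (x : X) (y : Y) : actT μ ν (inr k _ H d) (tq μ ν x y) =
      TensorProduct.lift ((tq μ ν).compl₁₂
        (LinearMap.applyₗ x ∘ₗ μ.toLinearMap ∘ₗ (inr k _ H).toLinearMap)
        (LinearMap.applyₗ y ∘ₗ ν.toLinearMap ∘ₗ (inr k _ H).toLinearMap)) (comul (R := k) d) := by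
  refine eq_of_coef k (LinearMap.applyₗ (tq μ ν x y) ∘ₗ (actT μ ν).toLinearMap ∘ₗ
    (inr k _ H).toLinearMap) (TensorProduct.lift ((tq μ ν).compl₁₂
        (LinearMap.applyₗ x ∘ₗ μ.toLinearMap ∘ₗ (inr k _ H).toLinearMap)
        (LinearMap.applyₗ y ∘ₗ ν.toLinearMap ∘ₗ (inr k _ H).toLinearMap)) ∘ₗ comul)
    (fun i j => ?_) d
  simp only [LinearMap.comp_apply, comul_coef, map_sum, lift.tmul]
  exact actT_inr μ ν i j x y

/-- The central compatibility, checked on three kinds of generators. Left multiplication touches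
only x. For p the second leg of the action meets 1, where it reduces to evaluation at 1. For h the
unwanted left factor of the second tensorand is moved across ⊗_H, where it acts from the right. -/
theorem splitT_act (s : Smash k (DrinfeldDouble k H) H) (z : H ⊗[k] (V ⊗[k] W)) :
    splitT ρ σ (smashRep (diagCop ρ σ) s z) =
      actT (smashRep ρ) (smashRep σ) s (splitT ρ σ z) := by
  refine act_of_double_gen _ (fun a z => ?_) (fun p z => ?_) (fun i j z => ?_) s z
  · refine LinearMap.congr_fun (f := splitT ρ σ ∘ₗ smashRep (diagCop ρ σ) (inl k _ H a))
      (g := actT (smashRep ρ) (smashRep σ) (inl k _ H a) ∘ₗ splitT ρ σ)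
      (TensorProduct.ext_threefold' fun x v w => ?_) z
    simp only [LinearMap.comp_apply, smashRep_inl, splitT_tmul, actT_inl]
  · refine LinearMap.congr_fun (f := splitT ρ σ ∘ₗ smashRep (diagCop ρ σ)
      (inr k _ H (DrinfeldDouble.inl k H p)))
      (g := actT (smashRep ρ) (smashRep σ) (inr k _ H (DrinfeldDouble.inl k H p)) ∘ₗ splitT ρ σ)
      (TensorProduct.ext_threefold' fun x v w => ?_) z
    simp only [LinearMap.comp_apply, smashRep_dual, splitT_tmul, actT_inr_comul,
      DrinfeldDouble.comul_inl]
    -- In D(H) the coproduct of p is p₂ ⊗ p₁. On 1 ⊗ w the form p₁ acts by p₁(1), its counit, so p₂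
    -- alone remains to act on x, and the counit axiom restores p.
    have h1 : ∀ w' : HDual k H ⊗[k] HDual k H, TensorProduct.lift
        ((tq (smashRep ρ) (smashRep σ)).compl₁₂
          (LinearMap.applyₗ (x ⊗ₜ[k] v) ∘ₗ (smashRep ρ).toLinearMap ∘ₗ (inr k _ H).toLinearMap)
          (LinearMap.applyₗ (1 ⊗ₜ[k] w) ∘ₗ (smashRep σ).toLinearMap ∘ₗ (inr k _ H).toLinearMap))
        (Algebra.TensorProduct.map (DrinfeldDouble.inl k H) (DrinfeldDouble.inl k H)
          (TensorProduct.comm k _ _ w')) = tq (smashRep ρ) (smashRep σ)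
        (actDual k H (TensorProduct.lid k _ ((counit (R := k)).rTensor _ w')) x ⊗ₜ v)
        (1 ⊗ₜ w) := by
      intro w'
      induction w' with
      | zero => simp
      | add s t hs ht =>
        simp only [map_add, hs, ht, LinearMap.add_apply, add_tmul]
      | tmul p q =>
        have h2 : actDual k H p 1 = p 1 • (1 : H) := by
          rw [actDual_apply]
          simp [Algebra.TensorProduct.one_def]
        simp only [comm_tmul, Algebra.TensorProduct.map_tmul, lift.tmul, LinearMap.compl₁₂_apply,
          LinearMap.comp_apply, LinearMap.applyₗ_apply_apply, AlgHom.toLinearMap_apply,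
          smashRep_dual, h2, LinearMap.rTensor_tmul, lid_tmul, HDual.counit_eq, map_smul,
          LinearMap.smul_apply, ← smul_tmul']
    rw [h1, Coalgebra.rTensor_counit_comul, lid_tmul, one_smul]
  · refine LinearMap.congr_fun (f := splitT ρ σ ∘ₗ smashRep (diagCop ρ σ)
      (inr k _ H (DrinfeldDouble.inr k H (coef k i j))))
      (g := actT (smashRep ρ) (smashRep σ) (inr k _ H (DrinfeldDouble.inr k H (coef k i j))) ∘ₗ
        splitT ρ σ) (TensorProduct.ext_threefold' fun x v w => ?_) z
    simp only [LinearMap.comp_apply, smashRep_adj (diagCop ρ σ), smashRep_adj σ, splitT_tmul, actT_inr_comul,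
      DrinfeldDouble.comul_inr, comul_coef, map_sum, Algebra.TensorProduct.map_tmul, lift.tmul,
      LinearMap.compl₁₂_apply, LinearMap.applyₗ_apply_apply, AlgHom.toLinearMap_apply, diag_toCop,
      tmul_sum, one_mul]
    -- On the second tensorand, h₂ produces h₂ S(h₄) ⊗ h₃ w. The factor h₂ S(h₄) is pushed to the
    -- left, so that the result is again of the form z ⊗ (1 ⊗ u).
    have h1 : ∀ (y y' : H) (z : H ⊗[k] V) (u : W),
        tq (smashRep ρ) (smashRep σ) z ((y * y') ⊗ₜ u) = tq (smashRep ρ) (smashRep σ)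
          (smashRep ρ (rightElt k _ H (y * y')) z) (1 ⊗ₜ u) := fun y y' z u => by
      rw [tq_balanced, smashRep_inl, mul_one]
    -- By `sum_rightElt_mul_inr`, (h₁ z) · (h₂ S(b)) = (h z) · S(b). Right action of S(b) on h x ⊗ v
    -- then gives h x S(b₂) ⊗ b₁ v. Here c_ic plays the role of h and c_dj that of b, while the leg
    -- c_cd between them acts on w.
    have h2 : ∀ c d, ∑ l, smashRep ρ (rightElt k _ H (coef k l c * antipode k (coef k d j)))
        (smashRep ρ (inr k _ H (DrinfeldDouble.inr k H (coef k i l))) (x ⊗ₜ v)) =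
        ∑ e, (coef k i c * (x * antipode k (coef k e j))) ⊗ₜ
          ρ (toCop k H (coef k d e)) v := by
      intro c d
      have := congrArg (fun s => smashRep ρ (rightElt k _ H (antipode k (coef k d j)) * s)
        (x ⊗ₜ v)) (sum_rightElt_mul_inr (k := k) (H := H) i c)
      simp only [Finset.mul_sum, ← mul_assoc, rightElt_mul, map_sum, LinearMap.sum_apply] at this
      simp only [← Module.End.mul_apply, ← map_mul, this]
      rw [map_mul, Module.End.mul_apply, smashRep_inl, smashRep_rightElt_antipode]
      simp only [mul_assoc]
    have h3 : ∀ c d, ∑ l, tq (smashRep ρ) (smashRep σ)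
        (smashRep ρ (rightElt k _ H (coef k l c * antipode k (coef k d j)))
          (smashRep ρ (inr k _ H (DrinfeldDouble.inr k H (coef k i l))) (x ⊗ₜ v)))
        ((1 : H) ⊗ₜ σ (toCop k H (coef k c d)) w) =
        ∑ e, tq (smashRep ρ) (smashRep σ) ((coef k i c * (x * antipode k (coef k e j))) ⊗ₜ
          ρ (toCop k H (coef k d e)) v) ((1 : H) ⊗ₜ σ (toCop k H (coef k c d)) w) := by
      intro c d
      have := congrArg (fun z => tq (smashRep ρ) (smashRep σ) z
        ((1 : H) ⊗ₜ σ (toCop k H (coef k c d)) w)) (h2 c d)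
      simpa only [map_sum, LinearMap.sum_apply] using this
    simp only [h1]
    rw [Finset.sum_comm]
    refine Eq.trans ?_ ((Finset.sum_congr rfl fun c _ =>
      (Finset.sum_congr rfl fun d _ => h3 c d).symm.trans Finset.sum_comm).trans Finset.sum_comm)
    rw [Finset.sum_comm]
    exact Finset.sum_congr rfl fun _ _ => Finset.sum_comm

end Comparison
-- The strong monoidal structure of the functor.
section Monoidal
variable {k H : Type u} [Field k] [Ring H] [HopfAlgebra k H] [Module.Finite k H]

open Smash MonoidalCategory

/-- The isomorphism `F(M ⊗ N) ≅ F(M) ⊗_H F(N)`, where `F(M) = H ⊗ M`. -/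
def inducedTensorIso (M N : FDMod k (Cop H)) :
    (inducedFunctor k H).obj (M ⊗ N) ≅ (inducedFunctor k H).obj M ⊗ (inducedFunctor k H).obj N :=
  FDMod.mkIso (M := (inducedFunctor k H).obj (M ⊗ N))
    (N := (inducedFunctor k H).obj M ⊗ (inducedFunctor k H).obj N) (splitT M.ρ N.ρ)
    (joinT M.ρ N.ρ) (splitT_act M.ρ N.ρ) (joinT_splitT M.ρ N.ρ) (splitT_joinT M.ρ N.ρ)

/-- On the trivial module the middle leg acts by ε, so h₁ x S(h₃) ⊗ h₂ becomes the adjoint action h₁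
x S(h₂), which is how H acts on the unit object. -/
theorem rid_act (s : Smash k (DrinfeldDouble k H) H) (z : H ⊗[k] k) :
    TensorProduct.rid k H (smashRep (FDMod.triv k (Cop H)) s z) =
      unitAct k (DrinfeldDouble k H) H s (TensorProduct.rid k H z) := by
  refine act_of_double_gen (TensorProduct.rid k H).toLinearMap (fun a z => ?_) (fun p z => ?_)
    (fun i j z => ?_) s z
  · refine LinearMap.congr_fun (f := (TensorProduct.rid k H).toLinearMap ∘ₗ
        smashRep (FDMod.triv k (Cop H)) (inl k _ H a))
      (g := unitAct k (DrinfeldDouble k H) H (inl k _ H a) ∘ₗ (TensorProduct.rid k H).toLinearMap)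
      (TensorProduct.ext' fun x (c : k) => ?_) z
    refine (congrArg (TensorProduct.rid k H) (smashRep_inl _ a x c)).trans ?_
    simp [unitAct_inl]
  · refine LinearMap.congr_fun (f := (TensorProduct.rid k H).toLinearMap ∘ₗ
        smashRep (FDMod.triv k (Cop H)) (inr k _ H (DrinfeldDouble.inl k H p)))
      (g := unitAct k (DrinfeldDouble k H) H (inr k _ H (DrinfeldDouble.inl k H p)) ∘ₗ
        (TensorProduct.rid k H).toLinearMap) (TensorProduct.ext' fun x (c : k) => ?_) z
    refine (congrArg (TensorProduct.rid k H) (smashRep_dual _ p x c)).trans ?_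
    simp [unitAct_inr, act_inl]
  · refine LinearMap.congr_fun (f := (TensorProduct.rid k H).toLinearMap ∘ₗ
        smashRep (FDMod.triv k (Cop H)) (inr k _ H (DrinfeldDouble.inr k H (coef k i j))))
      (g := unitAct k (DrinfeldDouble k H) H (inr k _ H (DrinfeldDouble.inr k H (coef k i j))) ∘ₗ
        (TensorProduct.rid k H).toLinearMap) (TensorProduct.ext' fun x (c : k) => ?_) z
    refine (congrArg (TensorProduct.rid k H) (smashRep_adj _ i j x c)).trans ?_
    have h1 : ∀ a b, FDMod.triv k (Cop H) (toCop k H (coef k a b)) c =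
        (if a = b then 1 else 0) * c := fun a b => by
      rw [← counit_coef k a b]
      exact FDMod.triv_apply _ _
    have h2 : ∀ (y : H), TensorProduct.rid k H (y ⊗ₜ[k] c) = c • y := fun y => rid_tmul y c
    rw [map_sum]
    simp only [map_sum, h1]
    simp [unitAct_inr, act_inr, adjLin_coef, Finset.smul_sum]

/-- The isomorphism `F(k) ≅ H`. -/
def inducedUnitIso : (inducedFunctor k H).obj (𝟙_ (FDMod k (Cop H))) ≅
    𝟙_ (FDMod k (Smash k (DrinfeldDouble k H) H)) :=
  FDMod.mkIso (M := (inducedFunctor k H).obj (𝟙_ (FDMod k (Cop H))))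
    (N := 𝟙_ (FDMod k (Smash k (DrinfeldDouble k H) H))) (TensorProduct.rid k H).toLinearMap
    (TensorProduct.rid k H).symm.toLinearMap rid_act
    (TensorProduct.rid k H).symm_apply_apply (TensorProduct.rid k H).apply_symm_apply

/-- The oplax direction is convenient because `splitT` is given on elementary tensors by inserting
1, whereas its inverse involves the right action. Naturality and associativity then hold by
computation on elementary tensors. -/
instance inducedFunctor_oplaxMonoidal : (inducedFunctor k H).OplaxMonoidal where
  η := inducedUnitIso.hom
  δ M N := (inducedTensorIso M N).hom
  δ_natural_left f N := FDMod.hom_ext (TensorProduct.ext_threefold' fun _ _ _ => rfl)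
  δ_natural_right N f := FDMod.hom_ext (TensorProduct.ext_threefold' fun _ _ _ => rfl)
  oplax_associativity M N P := FDMod.hom_ext (TensorProduct.ext (LinearMap.ext fun (x : H) =>
    TensorProduct.ext_threefold fun _ _ _ => rfl))
  oplax_left_unitality M := FDMod.hom_ext (TensorProduct.ext' fun (x : H) v => by
    change tq (unitAct k (DrinfeldDouble k H) H) (smashRep M.ρ) 1 (x ⊗ₜ v) =
      tq (unitAct k (DrinfeldDouble k H) H) (smashRep M.ρ) ((1 : k) • x) ((1 : H) ⊗ₜ v)
    -- In the unit object x is 1 · x for the right action, so it passes through ⊗_H to the second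
    -- factor: x ⊗ (1 ⊗ v) = 1 ⊗ (x ⊗ v).
    have h : x = unitAct k (DrinfeldDouble k H) H (rightElt k _ H x) 1 := by
      rw [unitAct_rightElt, one_mul]
    conv_rhs => rw [one_smul, h, tq_balanced, smashRep_inl, mul_one])
  oplax_right_unitality M := FDMod.hom_ext (TensorProduct.ext' fun (x : H) v => by
    change tq (smashRep M.ρ) (unitAct k (DrinfeldDouble k H) H) (x ⊗ₜ v) 1 =
      tq (smashRep M.ρ) (unitAct k (DrinfeldDouble k H) H) (x ⊗ₜ v) ((1 : k) • (1 : H))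
    rw [one_smul])

instance : IsIso (Functor.OplaxMonoidal.η (inducedFunctor k H)) :=
  inferInstanceAs (IsIso (inducedUnitIso (k := k) (H := H)).hom)

instance (M N : FDMod k (Cop H)) : IsIso (Functor.OplaxMonoidal.δ (inducedFunctor k H) M N) :=
  inferInstanceAs (IsIso (inducedTensorIso M N).hom)

/-- The functor `V ↦ H ⊗ V` is strong monoidal. -/
instance inducedFunctor_monoidal : (inducedFunctor k H).Monoidal :=
  Functor.Monoidal.ofOplaxMonoidal _

instance inducedFunctor_additive : (inducedFunctor k H).Additive where
  map_add {M N f g} := FDMod.hom_ext (LinearMap.lTensor_add H (FDMod.toLin f) (FDMod.toLin g))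

end Monoidal
end HopfDouble
end

theorem mainTheorem7 (k : Type u) [Field k] [CharZero k] (H : Type u) [Ring H] [HopfAlgebra k H]
    [Module.Finite k H] :
    Nonempty (Smash k (DrinfeldDouble k H) H ≃ₐ[k] Heisenberg k (Cop H) ⊗[k] H) ∧
    ∃ (F : FDMod k (Cop H) ⥤ FDMod k (Smash k (DrinfeldDouble k H) H)) (_ : F.Monoidal),
      F.IsEquivalence ∧ F.Additive ∧
        ∀ (M N : FDMod k (Cop H)) (c : k) (f : M ⟶ N), F.map (c • f) = c • F.map f :=
  ⟨⟨smashEquivHeisenberg k H⟩, inducedFunctor k H, inducedFunctor_monoidal,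
    inducedFunctor_isEquivalence, inducedFunctor_additive,
    fun _ _ c f => FDMod.hom_ext (LinearMap.lTensor_smul H c (FDMod.toLin f))⟩
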